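/- **Setting.** The hard core model with activity $\lambda'>0$ on a finite graph $G$ gives each independent set $I$ the weight $\lambda'^{|I|}$; $Z(G,\lambda')=\sum_I\lambda'^{|I|}$ is the partition function. A boundary condition $\sigma=(S,I_S)$ is a vertex set $S$ with an independent set $I_S\subseteq S$; $p_v(\sigma,G)$ is the probability that $v$ is occupied, conditioned on agreeing with $I_S$ on $S$, and $R_v(\sigma,G)=p_v/(1-p_v)$ (for $v\notin I_S$). On an infinite locally finite graph, $p_v$ is taken with respect to any Gibbs (DLR) measure of the model with boundary condition $\sigma$. $N(v,\ell)$ is the number of self-avoiding walks of length $\ell$ from $v$. An infinite graph has connective constant $\sup_v\limsup_{\ell}N(v,\ell)^{1/\ell}$; a family of finite graphs has connective constant at most $\Delta$ if there are constants $a,c$ with $\sum_{i=1}^{\ell}N(v,i)\le c\Delta^{\ell}$ for all graphs $G=(V,E)$ of the family, all $v\in V$ and all $\ell\ge a\log|V|$. **Theorem 3.** Let $d\ge 1$ be an integer, $\lambda>0$, $\Delta\ge 0$, and let $\nu_\lambda(d)=\frac{d\tilde x-1}{1+\tilde x}$, where $\tilde x$ is the unique positive solution of $dx=1+\lambda/(1+x)^d$.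 Suppose $\nu_\lambda(d)\,\Delta<1$ and let $0<\lambda'\le\lambda$. Then: 1. The hard core model with activity $\lambda'$ exhibits strong spatial mixing on (finite or infinite) graphs with maximum degree at most $d+1$ and connective constant at most $\Delta$. That is, there is $\kappa>0$ such that (a) for every infinite graph $G$ with maximum degree at most $d+1$ and connective constant at most $\Delta$ and every vertex $v$ there is $C$ such that $|R_v(\sigma,G)-R_v(\tau,G)|\le Ce^{-\kappa\ell}$ for all $\ell$ and all boundary conditions $\sigma,\tau$ that differ only at distance at least $\ell$ from $v$ and do not fix $v$ to be occupied; (b) for every family of finite graphs with maximum degree at most $d+1$ and connective constant at most $\Delta$, witnessed by constants $a,c$, there is $C$ such that the same bound holds for all graphs $G=(V,E)$ of the family, all $v\in V$ and all $\ell\ge a\log|V|$. 2. For every family of finite graphs with maximum degree at most $d+1$ and connective constant at most $\Delta$ there is an FPTAS for $Z(\cdot,\lambda')$: a deterministic algorithm which, given a graph $G$ of the family on $n$ vertices and $\epsilon\in(0,1]$ (supplied as $\lceil 1/\epsilon\rceil$), and with oracle access to dyadic approximations of the real number $\lambda'$, outputs a fraction in $[(1-\epsilon)Z(G,\lambda'),(1+\epsilon)Z(G,\lambda')]$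 in a number of steps (with bit-length cost for arithmetic) that is polynomial in $n$ and $1/\epsilon$. -/

import Mathlib

namespace HardCore

noncomputable section

open scoped ENNReal NNReal Classical

universe u

/-! ### The function `ν` -/

/-- For `d ≥ 1` and `lam > 0` the equation `d x = 1 + lam / (1 + x) ^ d` has exactly one positive
solution. -/
theorem existsUnique_fixedPoint (lam : ℝ) (d : ℕ) (hlam : 0 < lam) (hd : 1 ≤ d) :
    ∃! x : ℝ, 0 < x ∧ d * x = 1 + lam / (1 + x) ^ d := by
  have hd' : (1 : ℝ) ≤ d := by exact_mod_cast hd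
  have hcont : ContinuousOn (fun x : ℝ => d * x - (1 + lam / (1 + x) ^ d))
      (Set.Icc 0 (1 + lam)) := by
    apply ContinuousOn.sub (by fun_prop)
    apply ContinuousOn.add (by fun_prop)
    apply ContinuousOn.div (by fun_prop) (by fun_prop)
    intro x hx
    have : 0 ≤ x := hx.1
    positivity
  have hiv := intermediate_value_Icc (by positivity) hcont
  have h0 : (0 : ℝ) ∈ Set.Icc ((fun x : ℝ => d * x - (1 + lam / (1 + x) ^ d)) 0)
      ((fun x : ℝ => d * x - (1 + lam / (1 + x) ^ d)) (1 + lam)) := by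
    constructor
    · simp
      linarith
    · have h1 : lam / (1 + (1 + lam)) ^ d ≤ lam :=
        div_le_self hlam.le (one_le_pow₀ (by linarith))
      have h2 : 1 * (1 + lam) ≤ (d : ℝ) * (1 + lam) :=
        mul_le_mul_of_nonneg_right hd' (by linarith)
      simp only
      linarith
  obtain ⟨x, hx, hfx⟩ := hiv h0
  have hfx' : d * x = 1 + lam / (1 + x) ^ d := sub_eq_zero.mp hfx
  have hxpos : 0 < x := by
    have h1 : 0 ≤ lam / (1 + x) ^ d := by
      have := hx.1
      positivity
    by_contra hneg
    have hx0 : x = 0 := le_antisymm (not_lt.mp hneg) hx.1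
    rw [hx0] at hfx' h1
    linarith [mul_zero (d : ℝ)]
  have key : ∀ y z : ℝ, 0 < y → y < z → d * y = 1 + lam / (1 + y) ^ d →
      d * z = 1 + lam / (1 + z) ^ d → False := by
    intro y z hy hyz h1 h2
    have h3 : lam / (1 + z) ^ d ≤ lam / (1 + y) ^ d := by gcongr
    have h4 : (d : ℝ) * y < d * z := by gcongr
    linarith
  refine ⟨x, ⟨hxpos, hfx'⟩, ?_⟩
  rintro y ⟨hy, hy'⟩
  rcases lt_trichotomy y x with h | h | h
  · exact (key y x hy h hy' hfx').elim
  · exact h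
  · exact (key x y hxpos h hfx' hy').elim

/-- The unique positive solution of `d x = 1 + lam / (1 + x) ^ d` (for `lam > 0`, `d ≥ 1`). -/
def xTilde (lam : ℝ) (d : ℕ) : ℝ :=
  Classical.epsilon fun x : ℝ => 0 < x ∧ d * x = 1 + lam / (1 + x) ^ d

theorem xTilde_spec (lam : ℝ) (d : ℕ) (hlam : 0 < lam) (hd : 1 ≤ d) :
    0 < xTilde lam d ∧ d * xTilde lam d = 1 + lam / (1 + xTilde lam d) ^ d :=
  Classical.epsilon_spec (p := fun x : ℝ => 0 < x ∧ d * x = 1 + lam / (1 + x) ^ d)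
    (existsUnique_fixedPoint lam d hlam hd).exists

/-- `ν_lam(d) = (d x̃ - 1) / (1 + x̃)`. -/
def nu (lam : ℝ) (d : ℕ) : ℝ := (d * xTilde lam d - 1) / (1 + xTilde lam d)

/-! ### Graphs, self-avoiding walks, connective constants -/

/-- Every vertex has at most `D` neighbours. -/
def MaxDegreeLE {V : Type u} (G : SimpleGraph V) (D : ℕ) : Prop :=
  ∀ v, (G.neighborSet v).encard ≤ D

/-- `N(v, ℓ)`: the number of self-avoiding walks of length `ℓ` starting at `v`
(there are finitely many of them when `G` is locally finite). -/
def sawCount {V : Type u} (G : SimpleGraph V) (v : V) (l : ℕ) : ℕ :=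
  Set.ncard {p : Σ w, G.Walk v w | p.2.IsPath ∧ p.2.length = l}

/-- The connective constant `sup_v limsup_ℓ N(v, ℓ)^(1/ℓ)` of a locally finite infinite graph. -/
def connectiveConstant {V : Type u} (G : SimpleGraph V) : ℝ≥0∞ :=
  ⨆ v : V, Filter.limsup (fun l : ℕ => (sawCount G v l : ℝ≥0∞) ^ (1 / (l : ℝ))) Filter.atTop

/-- A family of finite graphs (up to isomorphism a finite graph lives on some `Fin n`). -/
abbrev FiniteFamily : Type := Set (Σ n : ℕ, SimpleGraph (Fin n))

/-- The family `F` of finite graphs has connective constant at most `Δ`, with witnesses `a`, `c`: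
`∑_{i=1}^ℓ N(v, i) ≤ c Δ^ℓ` for all `ℓ ≥ a log |V|`. The connective constant of `F` is at most `Δ`
when some `a` and `c` exist. -/
def ConnectiveConstantLEWith (F : FiniteFamily) (Δ : ℝ≥0) (a c : ℝ) : Prop :=
  ∀ G ∈ F, ∀ (v : Fin G.1) (l : ℕ), a * Real.log G.1 ≤ l →
    ((∑ i ∈ Finset.Icc 1 l, sawCount G.2 v i : ℕ) : ℝ) ≤ c * (Δ : ℝ) ^ l

/-! ### Boundary conditions -/

/-- A boundary condition `(S, I)`: a set `S` of vertices and an independent set `I ⊆ S`. The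
vertices in `I` are fixed to be occupied, those in `S \ I` to be unoccupied. -/
structure BoundaryCondition {V : Type u} (G : SimpleGraph V) where
  S : Set V
  I : Set V
  subset : I ⊆ S
  indep : G.IsIndepSet I

/-- `σ` and `τ` differ only at distance at least `l` from `v`: they treat every vertex at distance
less than `l` from `v` in the same way. -/
def DifferOnlyFrom {V : Type u} {G : SimpleGraph V} (σ τ : BoundaryCondition G) (v : V) (l : ℕ) :
    Prop :=
  ∀ w, G.edist v w < l → (w ∈ σ.S ↔ w ∈ τ.S) ∧ (w ∈ σ.I ↔ w ∈ τ.I)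

/-! ### The hard core model on a finite graph -/

/-- The partition function `Z(G, lam) = ∑_I lam^|I|`, summed over the independent sets of `G`. -/
def partitionFunction {V : Type u} [Fintype V] (G : SimpleGraph V) (lam : ℝ) : ℝ :=
  ∑ I ∈ (Finset.univ : Finset (Finset V)).filter (fun I : Finset V => G.IsIndepSet (I : Set V)), lam ^ I.card

/-- The occupation probability `p_v(σ, G)`: the hard core distribution conditioned on agreeing
with `σ` on its domain puts `v` into the independent set with this probability. -/
def occProb {V : Type u} [Fintype V] (G : SimpleGraph V) (lam : ℝ) (σ : BoundaryCondition G)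
    (v : V) : ℝ :=
  (∑ J ∈ (Finset.univ : Finset (Finset V)).filter
      (fun J : Finset V => G.IsIndepSet (J : Set V) ∧ (J : Set V) ∩ σ.S = σ.I ∧ v ∈ J), lam ^ J.card) /
    (∑ J ∈ (Finset.univ : Finset (Finset V)).filter
      (fun J : Finset V => G.IsIndepSet (J : Set V) ∧ (J : Set V) ∩ σ.S = σ.I), lam ^ J.card)

/-- The occupation ratio `R_v(σ, G) = p / (1 - p)` (meaningful when `v` is not fixed to be
occupied, in which case `p < 1`). -/
def occRatio {V : Type u} [Fintype V] (G : SimpleGraph V) (lam : ℝ) (σ : BoundaryCondition G)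
    (v : V) : ℝ :=
  occProb G lam σ v / (1 - occProb G lam σ v)

/-! ### The hard core model on an infinite graph -/

/-- The unnormalized weight of the configuration `I` in the finite window `Λ` when the
configuration outside `Λ` is that of `ω`. -/
def windowWeight {V : Type u} (G : SimpleGraph V) (lam : ℝ) (Λ : Finset V) (ω : Set V)
    (I : Finset V) : ℝ :=
  if G.IsIndepSet (I : Set V) ∧ ∀ u ∈ I, ∀ w ∈ ω \ (Λ : Set V), ¬ G.Adj u w then
    lam ^ I.card else 0

/-- The hard core distribution in the finite window `Λ` given the configuration outside. -/
def windowGibbs {V : Type u} (G : SimpleGraph V) (lam : ℝ) (Λ : Finset V) (ω : Set V)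
    (I : Finset V) : ℝ :=
  windowWeight G lam Λ ω I / ∑ J ∈ Λ.powerset, windowWeight G lam Λ ω J

/-- `μ` is a Gibbs measure of the hard core model with activity `lam` on `G` with boundary
condition `σ`: a probability measure on the configurations that agrees with `σ` on `σ.S` almost
surely and, in every finite window of vertices that `σ` does not fix, has the hard core
distribution conditionally on the configuration outside (the Dobrushin-Lanford-Ruelle
equations). -/
structure IsGibbsMeasure {V : Type u} (G : SimpleGraph V) (lam : ℝ) (σ : BoundaryCondition G)
    (μ : MeasureTheory.Measure (Set V)) : Prop where
  prob : MeasureTheory.IsProbabilityMeasure μ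
  boundary : ∀ w ∈ σ.S, ∀ᵐ ω ∂μ, (w ∈ ω ↔ w ∈ σ.I)
  dlr : ∀ Λ : Finset V, Disjoint (Λ : Set V) σ.S → ∀ A : Set (Set V), MeasurableSet A →
    μ A = ∫⁻ ω, ∑ I ∈ Λ.powerset, ENNReal.ofReal (windowGibbs G lam Λ ω I) *
      A.indicator 1 ((I : Set V) ∪ ω \ (Λ : Set V)) ∂μ

/-- The occupation ratio at `v` under the measure `μ`. -/
def measureRatio {V : Type u} (μ : MeasureTheory.Measure (Set V)) (v : V) : ℝ :=
  μ.real {ω | v ∈ ω} / (1 - μ.real {ω | v ∈ ω})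

/-! ### Strong spatial mixing -/

/-- Strong spatial mixing on the infinite graph `G` at exponential rate `κ`: for each vertex `v`,
`|R_v(σ) - R_v(τ)| ≤ C exp (-κ ℓ)` whenever `σ` and `τ` differ only at distance at least `ℓ` from
`v`, where `C` does not depend on `ℓ`, `σ`, `τ`, nor on the choice of the Gibbs measures. -/
def InfiniteSSM {V : Type u} (G : SimpleGraph V) (lam κ : ℝ) : Prop :=
  ∀ v : V, ∃ C : ℝ, ∀ (l : ℕ) (σ τ : BoundaryCondition G)
    (μ ν : MeasureTheory.Measure (Set V)),
    IsGibbsMeasure G lam σ μ → IsGibbsMeasure G lam τ ν → DifferOnlyFrom σ τ v l →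
    v ∉ σ.I → v ∉ τ.I →
    |measureRatio μ v - measureRatio ν v| ≤ C * Real.exp (-(κ * l))

/-- Strong spatial mixing on the family `F` of finite graphs at exponential rate `κ`, for distances
`ℓ ≥ a log |V|`, with a constant that is uniform over the family. -/
def FiniteSSM (F : FiniteFamily) (lam κ a : ℝ) : Prop :=
  ∃ C : ℝ, ∀ G ∈ F, ∀ (v : Fin G.1) (l : ℕ) (σ τ : BoundaryCondition G.2),
    a * Real.log G.1 ≤ l → DifferOnlyFrom σ τ v l → v ∉ σ.I → v ∉ τ.I →
    |occRatio G.2 lam σ v - occRatio G.2 lam τ v| ≤ C * Real.exp (-(κ * l))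

/-! ### Algorithms: a first-order recursive language with a bit-cost step count -/

/-- Data: natural numbers and pairs. -/
inductive Val : Type
  | num (n : ℕ) : Val
  | pair (a b : Val) : Val

/-- Primitive arithmetic: truncated subtraction, integer division, and tests with values `0`, `1`. -/
inductive Op : Type
  | add | sub | mul | div | eq | lt

def Op.apply : Op → ℕ → ℕ → ℕ
  | .add, m, n => m + n
  | .sub, m, n => m - n
  | .mul, m, n => m * n
  | .div, m, n => m / n
  | .eq, m, n => if m = n then 1 else 0
  | .lt, m, n => if m < n then 1 else 0

/-- Expressions. `var i` is the `i`-th entry of the environment, `call f e` applies the `f`-th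
function of the program to `e`, and `oracle e` queries the oracle at `e`. -/
inductive Expr : Type
  | var (i : ℕ) : Expr
  | num (n : ℕ) : Expr
  | pair (a b : Expr) : Expr
  | fst (a : Expr) : Expr
  | snd (a : Expr) : Expr
  | op (o : Op) (a b : Expr) : Expr
  | ite (c a b : Expr) : Expr
  | letIn (a b : Expr) : Expr
  | call (f : ℕ) (a : Expr) : Expr
  | oracle (a : Expr) : Expr

/-- A program is a finite list of (mutually recursive) one-argument functions; function `0` is the
main one. -/
abbrev Program : Type := List Expr

/-- `Eval P O env e v t`: in the environment `env`, the expression `e` evaluates to `v` in `t` steps,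
where an arithmetic operation on numbers with `s` and `s'` bits costs `(s + 1) (s' + 1)` steps, a
query at `k` costs `k + 1` steps plus the number of bits of the answer, and everything else costs one
step. In a conditional, `num 0` counts as false and every other value as true. -/
inductive Eval (P : Program) (O : ℕ → ℕ) : List Val → Expr → Val → ℕ → Prop
  | var {env : List Val} {i : ℕ} {v : Val} : env[i]? = some v → Eval P O env (.var i) v 1
  | num {env : List Val} {n : ℕ} : Eval P O env (.num n) (.num n) 1
  | pair {env : List Val} {a b : Expr} {v w : Val} {s t : ℕ} :
      Eval P O env a v s → Eval P O env b w t → Eval P O env (.pair a b) (.pair v w) (s + t + 1)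
  | fst {env : List Val} {a : Expr} {v w : Val} {t : ℕ} :
      Eval P O env a (.pair v w) t → Eval P O env (.fst a) v (t + 1)
  | snd {env : List Val} {a : Expr} {v w : Val} {t : ℕ} :
      Eval P O env a (.pair v w) t → Eval P O env (.snd a) w (t + 1)
  | op {env : List Val} {o : Op} {a b : Expr} {m n s t : ℕ} :
      Eval P O env a (.num m) s → Eval P O env b (.num n) t →
      Eval P O env (.op o a b) (.num (o.apply m n)) (s + t + (m.size + 1) * (n.size + 1))
  | iteTrue {env : List Val} {c a b : Expr} {u v : Val} {s t : ℕ} :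
      Eval P O env c u s → u ≠ .num 0 → Eval P O env a v t → Eval P O env (.ite c a b) v (s + t + 1)
  | iteFalse {env : List Val} {c a b : Expr} {v : Val} {s t : ℕ} :
      Eval P O env c (.num 0) s → Eval P O env b v t → Eval P O env (.ite c a b) v (s + t + 1)
  | letIn {env : List Val} {a b : Expr} {u v : Val} {s t : ℕ} :
      Eval P O env a u s → Eval P O (u :: env) b v t → Eval P O env (.letIn a b) v (s + t + 1)
  | call {env : List Val} {f : ℕ} {a body : Expr} {u v : Val} {s t : ℕ} :
      P[f]? = some body → Eval P O env a u s → Eval P O [u] body v t →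
      Eval P O env (.call f a) v (s + t + 1)
  | oracle {env : List Val} {a : Expr} {k t : ℕ} :
      Eval P O env a (.num k) t →
      Eval P O env (.oracle a) (.num (O k)) (t + k + (O k).size + 1)

/-- On input `x`, the program `P` with oracle `O` halts with output `v` after `t` steps. -/
def Runs (P : Program) (O : ℕ → ℕ) (x v : Val) (t : ℕ) : Prop :=
  Eval P O [x] (.call 0 (.var 0)) v t

/-- Lists as data: `num 0` is the empty list, a pair is a head and a tail. -/
def Val.ofList : List Val → Val
  | [] => .num 0
  | v :: vs => .pair v (Val.ofList vs)

/-- A graph on `Fin n` as data: `n` together with the list of the (increasing) adjacency lists of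
the vertices `0, …, n - 1`. -/
def encodeGraph {n : ℕ} (G : SimpleGraph (Fin n)) : Val :=
  .pair (.num n) (Val.ofList ((List.finRange n).map fun i =>
    Val.ofList (((List.finRange n).filter fun j => G.Adj i j).map fun j => Val.num j)))

/-- `P` is a fully polynomial time approximation scheme for the partition function of the hard core
model with activity `lam` on the graphs in `F`. The real number `lam` is accessible through an oracle
that answers a query `k` with an approximation of `lam` by a multiple of `2^(-k)` up to `2^(-k)`
(any such oracle will do); the input is a graph on `n` vertices in `F` and the accuracy
`ε ∈ (0, 1]`, handed over as the integer `⌈1/ε⌉`; the output is a fraction within a factor `1 ± ε` of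
the partition function, and the number of steps is polynomial in `n` and `1/ε`. -/
def IsFPTAS (F : FiniteFamily) (lam : ℝ) (P : Program) : Prop :=
  ∃ K : ℕ, ∀ O : ℕ → ℕ, (∀ k, |lam - (O k : ℝ) / 2 ^ k| ≤ 1 / 2 ^ k) →
    ∀ G ∈ F, ∀ ε : ℝ, 0 < ε → ε ≤ 1 →
      ∃ p q t : ℕ, Runs P O (.pair (encodeGraph G.2) (.num ⌈1 / ε⌉₊)) (.pair (.num p) (.num q)) t ∧
        (t : ℝ) ≤ K * (G.1 + 1 / ε) ^ K ∧ 0 < q ∧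
        (1 - ε) * partitionFunction G.2 lam ≤ (p : ℝ) / q ∧
        (p : ℝ) / q ≤ (1 + ε) * partitionFunction G.2 lam

end

end HardCore

namespace HardCore

noncomputable section

open scoped ENNReal NNReal Classical

universe u

/-! ### The function `ν` bounds the gradient of the tree recurrence -/

/-! Fixing a vertex to be unoccupied deletes it; fixing it to be occupied also deletes its
neighbours. A conditional occupation ratio is therefore R(A, v) = Z(A) / Z(A \ {v}) - 1 for an
induced subgraph A. For v in A, telescoping over the neighbours u_i of v gives R(A, v) = λ' / ∏ (1 +
R(A_i, u_i)), where A_i is A without v and without the earlier neighbours (`ratio_eq_prodL`).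
Unfolding this produces a tree with at most N(v, k) nodes at depth k, since its branches are
self-avoiding walks (`walkCount_le_sawCount`).

In the coordinate ψ = arsinh √R the recurrence becomes ψ = arsinh (√λ' / ∏ cosh ψ_i), whose gradient
has squared Euclidean norm λ' / (λ' + ∏ cosh² ψ_i) · ∑ tanh² ψ_i. With at most d children, concavity
reduces this to d equal children, and Bernoulli's inequality bounds it by ν = ν_λ(d)
(`coeff_le_nu`). By Cauchy-Schwarz the squared error at a node is at most ν times the sum of the
squared errors at its children. Truncation at depth k thus costs a squared error of order ν^k N(v,
k) (`sq_psi_ratio_sub_le_root`). The ℓ² norm is what lets the number of walks, rather than d^k,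
enter the bound; it decays exponentially because νΔ < 1.

The truncated recurrence only sees vertices closer than its depth, so two boundary conditions that
agree there are compared through a common truncation. On an infinite graph the DLR equations in a
ball express the occupation probability as an average of finite-window probabilities that are all
close to each other.

For the algorithm, Z is a product of n factors 1 + R. Truncation at a depth logarithmic in n + ⌈1/ε⌉
is accurate enough, it visits polynomially many nodes, and the unreduced fractions have bit length
linear in the number of nodes (`ev_loop`). -/

theorem lam_eq (lam : ℝ) (d : ℕ) (hlam : 0 < lam) (hd : 1 ≤ d) :
    lam = (d * xTilde lam d - 1) * (1 + xTilde lam d) ^ d := by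
  obtain ⟨h0, h1⟩ := xTilde_spec lam d hlam hd
  rw [h1]
  field_simp
  ring

theorem nu_pos (lam : ℝ) (d : ℕ) (hlam : 0 < lam) (hd : 1 ≤ d) : 0 < nu lam d := by
  obtain ⟨h0, h1⟩ := xTilde_spec lam d hlam hd
  have : 0 < lam / (1 + xTilde lam d) ^ d := by positivity
  unfold nu
  apply div_pos <;> linarith

/-- `ν_lam(d)` is an upper bound for `d (X - 1) lam / (X (lam + X ^ d))`. -/
theorem mul_sub_one_mul_le_nu (lam : ℝ) (d : ℕ) (hlam : 0 < lam) (hd : 1 ≤ d) (X : ℝ)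
    (hX : 0 ≤ X) : d * (X - 1) * lam ≤ nu lam d * (X * (lam + X ^ d)) := by
  obtain ⟨h0, h1⟩ := xTilde_spec lam d hlam hd
  have hl := lam_eq lam d hlam hd
  have hn := nu_pos lam d hlam hd
  have hnu : nu lam d = (d * xTilde lam d - 1) / (1 + xTilde lam d) := rfl
  set x := xTilde lam d
  have hY : 0 < 1 + x := by linarith
  set Y := 1 + x with hYdef
  have hx : x = Y - 1 := by rw [hYdef]; ring
  -- In terms of r = X / (1 + x̃) the inequality `hkey` is exactly Bernoulli's inequality for r ^ (d
  -- + 1), with equality at X = 1 + x̃.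
  obtain ⟨r, hr⟩ : ∃ r, r = X / Y := ⟨_, rfl⟩
  have hXr : X = r * Y := by rw [hr]; field_simp
  have hr0 : 0 ≤ r := by rw [hr]; positivity
  have hbern : 1 + ((d + 1 : ℕ) : ℝ) * (r - 1) ≤ (1 + (r - 1)) ^ (d + 1) :=
    one_add_mul_le_pow (by linarith) _
  have hk : 0 < d * x - 1 := by
    have : 0 < lam / Y ^ d := by positivity
    linarith
  have hkey : (d : ℝ) * (X - 1) ≤ r * (d * x - 1 + r ^ d) := by
    rw [hx, hXr]
    push_cast at hbern
    have : (1 + (r - 1)) ^ (d + 1) = r * r ^ d := by ring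
    nlinarith [this]
  calc d * (X - 1) * lam = d * (X - 1) * ((d * x - 1) * Y ^ d) := by rw [← hl]
    _ ≤ r * (d * x - 1 + r ^ d) * ((d * x - 1) * Y ^ d) := by gcongr
    _ = nu lam d * (X * (lam + X ^ d)) := by
      rw [hnu, hl, hXr, mul_pow]
      field_simp

/-- The left side is the squared gradient norm of the recurrence. In t_i = log cosh² w_i it is a
function of ∑ t_i times ∑ (1 - exp (-t_i)), and the latter is concave, so replacing the t_i by their
mean can only increase it. -/
theorem coeff_le_nu {lam lam' : ℝ} {d n : ℕ} (hd : 1 ≤ d) (hpos : 0 < lam') (hle : lam' ≤ lam)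
    (hn : n ≤ d) (w : Fin n → ℝ) :
    lam' / (lam' + ∏ i, Real.cosh (w i) ^ 2) * ∑ i, Real.tanh (w i) ^ 2 ≤ nu lam d := by
  have hlam : 0 < lam := by linarith
  have hd' : (0 : ℝ) < d := by exact_mod_cast hd
  set t : Fin n → ℝ := fun i => Real.log (Real.cosh (w i) ^ 2) with ht
  have hexp : ∀ i, Real.exp (t i) = Real.cosh (w i) ^ 2 := fun i =>
    Real.exp_log (by have := Real.cosh_pos (w i); positivity)
  have ht0 : ∀ i, 0 ≤ t i := fun i => Real.log_nonneg (one_le_pow₀ (Real.one_le_cosh _))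
  -- The mean is over d terms although there are only n: missing children count as t = 0.
  set τ := (∑ i, t i) / d with hτ
  have hτ0 : 0 ≤ τ := div_nonneg (Finset.sum_nonneg fun i _ => ht0 i) hd'.le
  set X := Real.exp τ with hX
  have hXpos : 0 < X := Real.exp_pos _
  have hXd : X ^ d = ∏ i, Real.cosh (w i) ^ 2 := by
    rw [hX, ← Real.exp_nat_mul, hτ, mul_div_cancel₀ _ hd'.ne', Real.exp_sum]
    exact Finset.prod_congr rfl fun i _ => hexp i
  have htanh : ∀ i, Real.tanh (w i) ^ 2 ≤ 1 - (1 + τ - t i) / X := by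
    intro i
    have h1 : Real.tanh (w i) ^ 2 = 1 - (Real.exp (t i))⁻¹ := by
      rw [hexp, Real.tanh_eq_sinh_div_cosh, div_pow, Real.sinh_sq]
      have := (Real.cosh_pos (w i)).ne'
      field_simp
    -- The graph of exp (-t) lies above its tangent at τ.
    have h2 : (1 + τ - t i) / X ≤ (Real.exp (t i))⁻¹ := by
      rw [div_le_iff₀ hXpos, ← Real.exp_neg, hX, ← Real.exp_add]
      have := Real.add_one_le_exp (-t i + τ)
      linarith
    linarith
  -- This sign is what permits replacing n by d in the sum below.
  have hone : (1 + τ) / X ≤ 1 := by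
    rw [div_le_one hXpos]
    have := Real.add_one_le_exp τ
    linarith
  have hsum : ∑ i, Real.tanh (w i) ^ 2 ≤ d * (X - 1) / X := by
    have h1 : ∑ i, Real.tanh (w i) ^ 2 ≤ ∑ i, (1 - (1 + τ - t i) / X) :=
      Finset.sum_le_sum fun i _ => htanh i
    have h2 : ∑ i, (1 - (1 + τ - t i) / X) = n * (1 - (1 + τ) / X) + d * τ / X := by
      have h3 : (d : ℝ) * τ = ∑ i, t i := by rw [hτ]; field_simp
      rw [h3, Finset.sum_div]
      have : ∀ i, (1 - (1 + τ - t i) / X) = (1 - (1 + τ) / X) + t i / X := by intro i; ring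
      simp only [this, Finset.sum_add_distrib, Finset.sum_const, Finset.card_univ,
        Fintype.card_fin, nsmul_eq_mul]
    have h3 : (n : ℝ) * (1 - (1 + τ) / X) ≤ d * (1 - (1 + τ) / X) := by
      have : (n : ℝ) ≤ d := by exact_mod_cast hn
      exact mul_le_mul_of_nonneg_right this (by linarith)
    calc _ ≤ d * (1 - (1 + τ) / X) + d * τ / X := by linarith
      _ = d * (X - 1) / X := by field_simp; ring
  have hcoef : lam' / (lam' + X ^ d) ≤ lam / (lam + X ^ d) := by
    have : 0 < X ^ d := by positivity
    rw [div_le_div_iff₀ (by positivity) (by positivity)]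
    nlinarith
  have hX1 : 1 ≤ X := Real.one_le_exp hτ0
  rw [← hXd]
  calc lam' / (lam' + X ^ d) * ∑ i, Real.tanh (w i) ^ 2
      ≤ lam / (lam + X ^ d) * (d * (X - 1) / X) := by
        apply mul_le_mul hcoef hsum (Finset.sum_nonneg fun i _ => sq_nonneg _) (by positivity)
    _ = (d * (X - 1) * lam) / (X * (lam + X ^ d)) := by field_simp
    _ ≤ nu lam d := by
        rw [div_le_iff₀ (by positivity)]
        exact mul_sub_one_mul_le_nu lam d hlam hd X hXpos.le

/-- A crude bound for the root, which may have d + 1 children and so escapes `coeff_le_nu`. It is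
used only once per tree and costs a constant factor. -/
theorem coeff_le_card {lam' : ℝ} {D n : ℕ} (hpos : 0 < lam') (hn : n ≤ D) (w : Fin n → ℝ) :
    lam' / (lam' + ∏ i, Real.cosh (w i) ^ 2) * ∑ i, Real.tanh (w i) ^ 2 ≤ D := by
  have h1 : 0 < ∏ i, Real.cosh (w i) ^ 2 :=
    Finset.prod_pos fun i _ => pow_pos (Real.cosh_pos _) 2
  have h2 : ∑ i, Real.tanh (w i) ^ 2 ≤ ∑ i : Fin n, (1 : ℝ) := by
    apply Finset.sum_le_sum
    intro i _
    rw [Real.tanh_eq_sinh_div_cosh, div_pow, Real.sinh_sq]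
    have := Real.cosh_pos (w i)
    rw [div_le_one (by positivity)]
    linarith
  have h3 : lam' / (lam' + ∏ i, Real.cosh (w i) ^ 2) ≤ 1 := by
    rw [div_le_one (by positivity)]
    linarith
  have hn' : (n : ℝ) ≤ D := by exact_mod_cast hn
  simp only [Finset.sum_const, Finset.card_univ, Fintype.card_fin, nsmul_eq_mul, mul_one] at h2
  calc _ ≤ 1 * ∑ i, Real.tanh (w i) ^ 2 :=
        mul_le_mul_of_nonneg_right h3 (Finset.sum_nonneg fun i _ => sq_nonneg _)
    _ ≤ D := by linarith

/-- Mean value inequality along the segment from `a` to `b`. The derivative of arsinh q is q' / √(1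
+ q²), and the logarithmic derivative of the product of cosh is a sum of tanh, so the hypothesis
bounds precisely the squared gradient norm. -/
theorem sq_arsinh_sub_le {lam' K : ℝ} {n : ℕ} (hpos : 0 < lam')
    (hK : ∀ w : Fin n → ℝ,
      lam' / (lam' + ∏ i, Real.cosh (w i) ^ 2) * ∑ i, Real.tanh (w i) ^ 2 ≤ K)
    (a b : Fin n → ℝ) :
    (Real.arsinh (√lam' / ∏ i, Real.cosh (b i)) - Real.arsinh (√lam' / ∏ i, Real.cosh (a i))) ^ 2
      ≤ K * ∑ i, (b i - a i) ^ 2 := by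
  set w : ℝ → Fin n → ℝ := fun s i => a i + s * (b i - a i) with hw
  set P : ℝ → ℝ := fun s => ∏ i, Real.cosh (w s i) with hP
  have hPpos : ∀ s, 0 < P s := fun s => Finset.prod_pos fun i _ => Real.cosh_pos _
  set S : ℝ → ℝ := fun s => ∑ i, Real.tanh (w s i) * (b i - a i) with hS
  have hPd : ∀ s, HasDerivAt P (P s * S s) s := by
    intro s
    have h1 : ∀ i ∈ (Finset.univ : Finset (Fin n)),
        HasDerivAt (fun s => Real.cosh (w s i)) (Real.sinh (w s i) * (b i - a i)) s := by
      intro i _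
      apply HasDerivAt.cosh
      exact (((hasDerivAt_id s).mul_const (b i - a i)).const_add (a i)).congr_deriv (one_mul _)
    refine (HasDerivAt.fun_finsetProd h1).congr_deriv ?_
    rw [hS, Finset.mul_sum]
    apply Finset.sum_congr rfl
    intro i hi
    rw [smul_eq_mul, hP, Real.tanh_eq_sinh_div_cosh]
    simp only
    rw [← Finset.mul_prod_erase _ (fun i => Real.cosh (w s i)) hi]
    have := (Real.cosh_pos (w s i)).ne'
    field_simp
  set q : ℝ → ℝ := fun s => √lam' / P s with hq
  have hqd : ∀ s, HasDerivAt q (-(q s * S s)) s := by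
    intro s
    refine ((hasDerivAt_const s (√lam')).div (hPd s) (hPpos s).ne').congr_deriv ?_
    rw [hq]
    have := (hPpos s).ne'
    field_simp
    ring
  have hGd : ∀ s, HasDerivAt (fun s => Real.arsinh (q s))
      ((√(1 + q s ^ 2))⁻¹ • (-(q s * S s))) s := fun s => (hqd s).arsinh
  have hbound : ∀ s, ‖(√(1 + q s ^ 2))⁻¹ • (-(q s * S s))‖ ≤ √(K * ∑ i, (b i - a i) ^ 2) := by
    intro s
    apply Real.le_sqrt_of_sq_le
    rw [Real.norm_eq_abs, sq_abs, smul_eq_mul, mul_pow, inv_pow, Real.sq_sqrt (by positivity)]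
    -- Cauchy-Schwarz separates the gradient from the displacement.
    have hcs : S s ^ 2 ≤ (∑ i, Real.tanh (w s i) ^ 2) * ∑ i, (b i - a i) ^ 2 :=
      Finset.sum_mul_sq_le_sq_mul_sq _ _ _
    have hq2 : q s ^ 2 = lam' / P s ^ 2 := by
      rw [hq, div_pow, Real.sq_sqrt hpos.le]
    have hP2 : P s ^ 2 = ∏ i, Real.cosh (w s i) ^ 2 := by rw [hP, Finset.prod_pow]
    have hfrac : (1 + q s ^ 2)⁻¹ * q s ^ 2 = lam' / (lam' + ∏ i, Real.cosh (w s i) ^ 2) := by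
      rw [hq2, ← hP2]
      have := hPpos s
      field_simp
      ring
    calc (1 + q s ^ 2)⁻¹ * (-(q s * S s)) ^ 2 = ((1 + q s ^ 2)⁻¹ * q s ^ 2) * S s ^ 2 := by ring
      _ ≤ ((1 + q s ^ 2)⁻¹ * q s ^ 2) *
          ((∑ i, Real.tanh (w s i) ^ 2) * ∑ i, (b i - a i) ^ 2) := by
        gcongr
      _ = (lam' / (lam' + ∏ i, Real.cosh (w s i) ^ 2) * ∑ i, Real.tanh (w s i) ^ 2) *
          ∑ i, (b i - a i) ^ 2 := by rw [hfrac]; ring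
      _ ≤ K * ∑ i, (b i - a i) ^ 2 :=
        mul_le_mul_of_nonneg_right (hK _) (Finset.sum_nonneg fun i _ => sq_nonneg _)
  have hmv := Convex.norm_image_sub_le_of_norm_hasDerivWithin_le (s := Set.univ)
    (f := fun s => Real.arsinh (q s)) (fun s _ => (hGd s).hasDerivWithinAt) (fun s _ => hbound s)
    convex_univ (Set.mem_univ (0 : ℝ)) (Set.mem_univ (1 : ℝ))
  have hK0 : 0 ≤ K := le_trans (by
    have : 0 < ∏ i, Real.cosh (a i) ^ 2 :=
      Finset.prod_pos fun i _ => pow_pos (Real.cosh_pos _) 2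
    exact mul_nonneg (by positivity) (Finset.sum_nonneg fun i _ => sq_nonneg _)) (hK a)
  have hnn : 0 ≤ K * ∑ i, (b i - a i) ^ 2 :=
    mul_nonneg hK0 (Finset.sum_nonneg fun i _ => sq_nonneg _)
  have h1 : q 1 = √lam' / ∏ i, Real.cosh (b i) := by simp [hq, hP, hw]
  have h0 : q 0 = √lam' / ∏ i, Real.cosh (a i) := by simp [hq, hP, hw]
  simp only [h1, h0, sub_zero, norm_one, mul_one, Real.norm_eq_abs] at hmv
  rw [← sq_abs, ← Real.sq_sqrt hnn]
  exact pow_le_pow_left₀ (abs_nonneg _) hmv 2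

/-- The message `arsinh √x`: in this coordinate the tree recurrence contracts in the `ℓ²` norm. -/
def psi (x : ℝ) : ℝ := Real.arsinh √x

theorem psi_zero : psi 0 = 0 := by simp [psi]

theorem psi_nonneg (x : ℝ) : 0 ≤ psi x := Real.arsinh_nonneg_iff.2 (Real.sqrt_nonneg _)

theorem psi_mono {x y : ℝ} (h : x ≤ y) : psi x ≤ psi y :=
  Real.arsinh_le_arsinh.2 (Real.sqrt_le_sqrt h)

theorem cosh_psi {x : ℝ} (hx : 0 ≤ x) : Real.cosh (psi x) = √(1 + x) := by
  rw [psi, Real.cosh_arsinh, Real.sq_sqrt hx]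

theorem sinh_psi_sq {x : ℝ} (hx : 0 ≤ x) : Real.sinh (psi x) ^ 2 = x := by
  rw [psi, Real.sinh_arsinh, Real.sq_sqrt hx]

/-- Since cosh (ψ x) = √(1 + x), the tree recurrence in the coordinate ψ is the map of
`sq_arsinh_sub_le`. -/
theorem sq_psi_sub_le {ι : Type*} {lam' K : ℝ} (hpos : 0 < lam') (l : List ι)
    (hK : ∀ w : Fin l.length → ℝ,
      lam' / (lam' + ∏ i, Real.cosh (w i) ^ 2) * ∑ i, Real.tanh (w i) ^ 2 ≤ K)
    (x y : ι → ℝ) (hx : ∀ i ∈ l, 0 ≤ x i) (hy : ∀ i ∈ l, 0 ≤ y i) :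
    (psi (lam' / (l.map fun i => 1 + x i).prod) - psi (lam' / (l.map fun i => 1 + y i).prod)) ^ 2
      ≤ K * (l.map fun i => (psi (x i) - psi (y i)) ^ 2).sum := by
  have key : ∀ z : ι → ℝ, (∀ i ∈ l, 0 ≤ z i) → psi (lam' / (l.map fun i => 1 + z i).prod) =
      Real.arsinh (√lam' / ∏ i : Fin l.length, Real.cosh (psi (z l[i]))) := by
    intro z hz
    rw [psi, Real.sqrt_div hpos.le, ← Fin.prod_univ_fun_getElem l fun i => 1 + z i]
    congr 2
    rw [Real.sqrt_prod _ fun i _ => by exact add_nonneg zero_le_one (hz _ (List.getElem_mem _))]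
    exact Finset.prod_congr rfl fun i _ => (cosh_psi (hz _ (List.getElem_mem _))).symm
  rw [key x hx, key y hy, ← Fin.sum_univ_fun_getElem l fun i => (psi (x i) - psi (y i)) ^ 2]
  exact sq_arsinh_sub_le hpos hK _ _

/-- Back from messages to ratios. -/
theorem abs_sub_le_of_psi {x y L : ℝ} (hx : 0 ≤ x) (hy : 0 ≤ y) (hxL : x ≤ L) (hyL : y ≤ L) :
    |x - y| ≤ 2 * (1 + L) * |psi x - psi y| := by
  have hL : 0 ≤ L := hx.trans hxL
  have hb : ∀ s ∈ Set.Icc 0 (psi L), ‖2 * Real.sinh s * Real.cosh s‖ ≤ 2 * (1 + L) := by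
    intro s hs
    have h1 : 0 ≤ Real.sinh s := Real.sinh_nonneg_iff.2 hs.1
    have h2 : Real.sinh s ^ 2 ≤ L := by
      rw [← sinh_psi_sq hL]
      exact pow_le_pow_left₀ h1 (Real.sinh_le_sinh.2 hs.2) 2
    have h3 := Real.cosh_sq s
    have h4 := Real.cosh_pos s
    rw [Real.norm_eq_abs, abs_of_nonneg (by positivity)]
    -- 2 sinh cosh ≤ sinh² + cosh² = 1 + 2 sinh² ≤ 1 + 2 L.
    nlinarith [sq_nonneg (Real.sinh s - Real.cosh s)]
  have hd : ∀ s ∈ Set.Icc 0 (psi L), HasDerivWithinAt (fun s => Real.sinh s ^ 2)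
      (2 * Real.sinh s * Real.cosh s) (Set.Icc 0 (psi L)) s := by
    intro s _
    refine ((Real.hasDerivAt_sinh s).pow 2).hasDerivWithinAt.congr_deriv ?_
    simp
  have := Convex.norm_image_sub_le_of_norm_hasDerivWithin_le hd hb (convex_Icc _ _)
    (x := psi y) (y := psi x) ⟨psi_nonneg _, psi_mono hyL⟩ ⟨psi_nonneg _, psi_mono hxL⟩
  simpa only [sinh_psi_sq hx, sinh_psi_sq hy, Real.norm_eq_abs] using this

/-! ### Partition functions of vertex sets and the tree recurrence -/

section Recurrence

variable {V : Type u}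

/-- The partition function of the subgraph induced by `A`. -/
def Z (G : SimpleGraph V) (lam : ℝ) (A : Finset V) : ℝ :=
  ∑ I ∈ A.powerset, if G.IsIndepSet (I : Set V) then lam ^ I.card else 0

/-- The occupation ratio of `v` in the subgraph induced by `A` (zero when `v ∉ A`). -/
def ratio (G : SimpleGraph V) (lam : ℝ) (A : Finset V) (v : V) : ℝ :=
  Z G lam A / Z G lam (A.erase v) - 1

theorem isIndepSet_insert {G : SimpleGraph V} {v : V} {I : Finset V} (hv : v ∉ I) :
    G.IsIndepSet ((insert v I : Finset V) : Set V) ↔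
      G.IsIndepSet (I : Set V) ∧ ∀ u ∈ I, ¬ G.Adj v u := by
  rw [Finset.coe_insert, SimpleGraph.IsIndepSet, SimpleGraph.IsIndepSet, Set.pairwise_insert]
  refine and_congr_right fun _ => ⟨fun h u hu => (h u hu ?_).1, fun h u hu _ => ⟨h u hu, ?_⟩⟩
  · rintro rfl
    exact hv hu
  · rw [G.adj_comm]
    exact h u hu

theorem one_le_Z (G : SimpleGraph V) {lam : ℝ} (hpos : 0 < lam) (A : Finset V) :
    1 ≤ Z G lam A := by
  have h := Finset.single_le_sum (s := A.powerset)
    (f := fun I : Finset V => if G.IsIndepSet (I : Set V) then lam ^ I.card else 0)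
    (fun I _ => by positivity) (Finset.empty_mem_powerset A)
  simpa [Z, SimpleGraph.IsIndepSet] using h

theorem Z_pos (G : SimpleGraph V) {lam : ℝ} (hpos : 0 < lam) (A : Finset V) : 0 < Z G lam A :=
  zero_lt_one.trans_le (one_le_Z G hpos A)

theorem Z_mono (G : SimpleGraph V) {lam : ℝ} (hpos : 0 < lam) {A B : Finset V} (h : A ⊆ B) :
    Z G lam A ≤ Z G lam B :=
  Finset.sum_le_sum_of_subset_of_nonneg (Finset.powerset_mono.2 h) fun I _ _ => by positivity

theorem Z_empty (G : SimpleGraph V) (lam : ℝ) : Z G lam ∅ = 1 := by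
  simp [Z, SimpleGraph.IsIndepSet]

theorem Z_eq_erase (G : SimpleGraph V) (lam : ℝ) {A : Finset V} {v : V} (hv : v ∈ A) :
    Z G lam A = Z G lam (A.erase v) +
      lam * Z G lam ((A.erase v).filter fun u => ¬ G.Adj v u) := by
  unfold Z
  conv_lhs => rw [← Finset.insert_erase hv]
  rw [Finset.sum_powerset_insert (Finset.notMem_erase v A), Finset.mul_sum]
  congr 1
  symm
  have hsub : ((A.erase v).filter fun u => ¬ G.Adj v u).powerset ⊆ (A.erase v).powerset :=
    Finset.powerset_mono.2 (Finset.filter_subset _ _)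
  rw [← Finset.sum_subset_zero_on_sdiff hsub (g := fun I : Finset V =>
    if G.IsIndepSet ((insert v I : Finset V) : Set V) then lam ^ (insert v I).card else 0)]
  · intro I hI
    rw [Finset.mem_sdiff, Finset.mem_powerset, Finset.mem_powerset] at hI
    have hvI : v ∉ I := fun h => Finset.notMem_erase v A (hI.1 h)
    rw [if_neg]
    rw [isIndepSet_insert hvI]
    rintro ⟨_, h⟩
    exact hI.2 fun u hu => Finset.mem_filter.2 ⟨hI.1 hu, h u hu⟩
  · intro I hI
    rw [Finset.mem_powerset] at hI
    have hvI : v ∉ I := fun h => Finset.notMem_erase v A (Finset.mem_filter.1 (hI h)).1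
    have hadj : ∀ u ∈ I, ¬ G.Adj v u := fun u hu => (Finset.mem_filter.1 (hI hu)).2
    simp only [isIndepSet_insert hvI, Finset.card_insert_of_notMem hvI, pow_succ']
    by_cases h : G.IsIndepSet (I : Set V)
    · rw [if_pos h, if_pos ⟨h, hadj⟩]
    · rw [if_neg h, if_neg fun h' => h h'.1, mul_zero]

theorem one_add_ratio (G : SimpleGraph V) (lam : ℝ) (A : Finset V) (v : V) :
    1 + ratio G lam A v = Z G lam A / Z G lam (A.erase v) := by
  rw [ratio]; ring

theorem ratio_of_notMem (G : SimpleGraph V) {lam : ℝ} (hpos : 0 < lam) {A : Finset V} {v : V}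
    (hv : v ∉ A) : ratio G lam A v = 0 := by
  rw [ratio, Finset.erase_eq_of_notMem hv, div_self (Z_pos G hpos A).ne', sub_self]

theorem ratio_of_mem (G : SimpleGraph V) {lam : ℝ} (hpos : 0 < lam) {A : Finset V} {v : V}
    (hv : v ∈ A) : ratio G lam A v =
      lam * Z G lam ((A.erase v).filter fun u => ¬ G.Adj v u) / Z G lam (A.erase v) := by
  have := (Z_pos G hpos (A.erase v)).ne'
  rw [ratio, Z_eq_erase G lam hv]
  field_simp
  ring

theorem ratio_nonneg (G : SimpleGraph V) {lam : ℝ} (hpos : 0 < lam) (A : Finset V) (v : V) :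
    0 ≤ ratio G lam A v := by
  rw [ratio, sub_nonneg, one_le_div (Z_pos G hpos _)]
  exact Z_mono G hpos (Finset.erase_subset v A)

theorem ratio_le (G : SimpleGraph V) {lam : ℝ} (hpos : 0 < lam) (A : Finset V) (v : V) :
    ratio G lam A v ≤ lam := by
  by_cases hv : v ∈ A
  · rw [ratio_of_mem G hpos hv, div_le_iff₀ (Z_pos G hpos _)]
    exact mul_le_mul_of_nonneg_left (Z_mono G hpos (Finset.filter_subset _ _)) hpos.le
  · rw [ratio_of_notMem G hpos hv]
    exact hpos.le

/-- The product of `1 + r A_i u_i` over the entries `u_i` of a list, where `A_i` is `A` without the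
entries before `u_i`. -/
def prodL (r : Finset V → V → ℝ) : Finset V → List V → ℝ
  | _, [] => 1
  | A, u :: us => (1 + r A u) * prodL r (A.erase u) us

/-- The pairs `(A_i, u_i)` of `prodL` with `u_i ∈ A_i`. -/
def scan : Finset V → List V → List (Finset V × V)
  | _, [] => []
  | A, u :: us => if u ∈ A then (A, u) :: scan (A.erase u) us else scan A us

/-- Entries outside the current set contribute the factor 1. Since visited entries are erased,
repetitions in the list drop out as well, and what remains are the genuine children of a node. -/
theorem prodL_eq_scan {r : Finset V → V → ℝ} (hr : ∀ A u, u ∉ A → r A u = 0) (A : Finset V)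
    (l : List V) : prodL r A l = ((scan A l).map fun p => 1 + r p.1 p.2).prod := by
  induction l generalizing A with
  | nil => simp [prodL, scan]
  | cons u us ih =>
    by_cases hu : u ∈ A
    · simp [prodL, scan, hu, ih]
    · simp [prodL, scan, hu, ih, hr A u hu]

/-- Each factor is Z(A_i) / Z(A_i \ {u_i}), so the product telescopes. It yields both the
recurrence, with the neighbours of a vertex as list, and the partition function, with the list of
all vertices. -/
theorem prodL_ratio (G : SimpleGraph V) {lam : ℝ} (hpos : 0 < lam) (A : Finset V) (l : List V) :
    prodL (ratio G lam) A l = Z G lam A / Z G lam (A \ l.toFinset) := by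
  induction l generalizing A with
  | nil => simp [prodL, div_self (Z_pos G hpos A).ne']
  | cons u us ih =>
    have h1 := (Z_pos G hpos (A.erase u)).ne'
    have h2 : A.erase u \ us.toFinset = A \ (u :: us).toFinset := by
      ext x; simp only [Finset.mem_sdiff, Finset.mem_erase, List.toFinset_cons,
        Finset.mem_insert]; tauto
    rw [prodL, ih, one_add_ratio, h2]
    field_simp

theorem ratio_eq_prodL {G : SimpleGraph V} {nb : V → List V} (hnb : ∀ v u, u ∈ nb v ↔ G.Adj v u)
    {lam : ℝ} (hpos : 0 < lam) {A : Finset V} {v : V} (hv : v ∈ A) :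
    ratio G lam A v = lam / prodL (ratio G lam) (A.erase v) (nb v) := by
  have : A.erase v \ (nb v).toFinset = (A.erase v).filter fun u => ¬ G.Adj v u := by
    ext x; simp [hnb]
  rw [ratio_of_mem G hpos hv, prodL_ratio G hpos, this]
  have := (Z_pos G hpos (A.erase v)).ne'
  have := (Z_pos G hpos ((A.erase v).filter fun u => ¬ G.Adj v u)).ne'
  field_simp

/-- The tree recurrence for `ratio`, truncated at depth `k`. -/
def treeRatio (nb : V → List V) (lam : ℝ) : ℕ → Finset V → V → ℝ
  | 0, _, _ => 0
  | k + 1, A, v => if v ∈ A then lam / prodL (treeRatio nb lam k) (A.erase v) (nb v) else 0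

theorem treeRatio_of_notMem (nb : V → List V) (lam : ℝ) (k : ℕ) {A : Finset V} {v : V}
    (hv : v ∉ A) : treeRatio nb lam k A v = 0 := by
  cases k <;> simp [treeRatio, hv]

theorem one_le_prodL {r : Finset V → V → ℝ} (hr : ∀ A u, 0 ≤ r A u) (A : Finset V) (l : List V) :
    1 ≤ prodL r A l := by
  induction l generalizing A with
  | nil => simp [prodL]
  | cons u us ih =>
    rw [prodL]
    exact one_le_mul_of_one_le_of_one_le (by linarith [hr A u]) (ih _)

theorem treeRatio_nonneg (nb : V → List V) {lam : ℝ} (hpos : 0 < lam) (k : ℕ) (A : Finset V)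
    (v : V) : 0 ≤ treeRatio nb lam k A v := by
  induction k generalizing A v with
  | zero => simp [treeRatio]
  | succ k ih =>
    rw [treeRatio]
    split_ifs
    · have := one_le_prodL ih (A.erase v) (nb v)
      positivity
    · exact le_rfl

theorem treeRatio_le (nb : V → List V) {lam : ℝ} (hpos : 0 < lam) (k : ℕ) (A : Finset V)
    (v : V) : treeRatio nb lam k A v ≤ lam := by
  cases k with
  | zero => exact hpos.le
  | succ k =>
    rw [treeRatio]
    split_ifs
    · exact div_le_self hpos.le (one_le_prodL (treeRatio_nonneg nb hpos k) _ _)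
    · exact hpos.le

theorem prodL_congr {G : SimpleGraph V} {r : Finset V → V → ℝ} {k : ℕ}
    (hr : ∀ (A B : Finset V) (v : V), (∀ w, G.edist v w < k → (w ∈ A ↔ w ∈ B)) → r A v = r B v)
    (l : List V) (A B : Finset V)
    (h : ∀ u ∈ l, ∀ w, G.edist u w < k → (w ∈ A ↔ w ∈ B)) : prodL r A l = prodL r B l := by
  induction l generalizing A B with
  | nil => rfl
  | cons u us ih =>
    rw [prodL, prodL, hr A B u (h u List.mem_cons_self), ih (A.erase u) (B.erase u)]
    intro u' hu' w hw
    rw [Finset.mem_erase, Finset.mem_erase, h u' (List.mem_cons_of_mem _ hu') w hw]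

/-- The truncated recurrence depends only on the vertices at distance less than `k`. -/
theorem treeRatio_congr {G : SimpleGraph V} {nb : V → List V}
    (hnb : ∀ v u, u ∈ nb v ↔ G.Adj v u) (lam : ℝ) (k : ℕ) (A B : Finset V) (v : V)
    (h : ∀ w, G.edist v w < k → (w ∈ A ↔ w ∈ B)) :
    treeRatio nb lam k A v = treeRatio nb lam k B v := by
  induction k generalizing A B v with
  | zero => rfl
  | succ k ih =>
    have hv : v ∈ A ↔ v ∈ B := h v (by simp)
    rw [treeRatio, treeRatio]
    by_cases hvA : v ∈ A
    · rw [if_pos hvA, if_pos (hv.1 hvA), prodL_congr (G := G) ih]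
      intro u hu w hw
      have h1 : G.edist v u = 1 := SimpleGraph.edist_eq_one_iff_adj.2 ((hnb v u).1 hu)
      have h2 : G.edist v w < (k + 1 : ℕ) := by
        calc G.edist v w ≤ G.edist v u + G.edist u w := SimpleGraph.edist_triangle
          _ = G.edist u w + 1 := by rw [h1, add_comm]
          _ < k + 1 := by
            exact (ENat.add_lt_add_iff_right (by simp)).2 hw
          _ = (k + 1 : ℕ) := by push_cast; rfl
      rw [Finset.mem_erase, Finset.mem_erase, h w h2]
    · rw [if_neg hvA, if_neg (hv.not.1 hvA)]

/-! ### Counting the nodes of the recursion tree -/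

/-- The number of self-avoiding walks of length `k` from `v` that stay in `A` after the start. -/
def walkCount (nb : V → List V) : ℕ → Finset V → V → ℕ
  | 0, _, _ => 1
  | k + 1, A, v => ∑ u ∈ (nb v).toFinset ∩ A.erase v, walkCount nb k (A.erase v) u

theorem walkCount_mono (nb : V → List V) (k : ℕ) {A B : Finset V} (h : A ⊆ B) (v : V) :
    walkCount nb k A v ≤ walkCount nb k B v := by
  induction k generalizing A B v with
  | zero => exact le_rfl
  | succ k ih =>
    have h' : A.erase v ⊆ B.erase v := Finset.erase_subset_erase _ h
    exact (Finset.sum_le_sum fun u _ => ih h' u).trans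
      (Finset.sum_le_sum_of_subset (Finset.inter_subset_inter_left h'))

theorem scan_subset {A : Finset V} {l : List V} {p : Finset V × V} (hp : p ∈ scan A l) :
    p.1 ⊆ A ∧ p.2 ∈ p.1 ∧ p.2 ∈ l := by
  induction l generalizing A with
  | nil => simp [scan] at hp
  | cons u us ih =>
    by_cases hu : u ∈ A
    · simp only [scan, hu, if_true, List.mem_cons] at hp
      rcases hp with rfl | hp
      · exact ⟨subset_rfl, hu, List.mem_cons_self⟩
      · obtain ⟨h1, h2, h3⟩ := ih hp
        exact ⟨h1.trans (Finset.erase_subset _ _), h2, List.mem_cons_of_mem _ h3⟩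
    · simp only [scan, hu, if_false] at hp
      obtain ⟨h1, h2, h3⟩ := ih hp
      exact ⟨h1, h2, List.mem_cons_of_mem _ h3⟩

/-- The children live in shrinking sets. Monotonicity of `f` allows all of them to be charged to the
same set `A`, as in the definition of `walkCount`. -/
theorem sum_scan_le {f : Finset V → V → ℕ} (hf : ∀ A B u, A ⊆ B → f A u ≤ f B u) (A : Finset V)
    (l : List V) : ((scan A l).map fun p => f p.1 p.2).sum ≤ ∑ u ∈ l.toFinset ∩ A, f A u := by
  induction l generalizing A with
  | nil => simp [scan]
  | cons u us ih =>
    by_cases hu : u ∈ A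
    · have h1 : (u :: us).toFinset ∩ A = insert u (us.toFinset ∩ A.erase u) := by
        ext x; simp only [List.toFinset_cons, Finset.mem_inter, Finset.mem_insert,
          Finset.mem_erase]
        by_cases hx : x = u
        · simp [hx, hu]
        · simp [hx]
      rw [h1, Finset.sum_insert (by simp)]
      simp only [scan, hu, if_true, List.map_cons, List.sum_cons]
      refine Nat.add_le_add_left ((ih _).trans ?_) _
      exact Finset.sum_le_sum fun x _ => hf _ _ _ (Finset.erase_subset _ _)
    · simp only [scan, hu, if_false]
      refine (ih A).trans (Finset.sum_le_sum_of_subset ?_)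
      intro x
      simp only [List.toFinset_cons, Finset.mem_inter, Finset.mem_insert]
      tauto

theorem length_scan_le (A : Finset V) (l : List V) : (scan A l).length ≤ (l.toFinset ∩ A).card := by
  simpa using sum_scan_le (f := fun _ _ => 1) (fun _ _ _ _ => le_rfl) A l

theorem finite_walks {G : SimpleGraph V} {nb : V → List V} (hnb : ∀ v u, u ∈ nb v ↔ G.Adj v u)
    (k : ℕ) (v : V) : {p : Σ w, G.Walk v w | p.2.length = k}.Finite := by
  induction k generalizing v with
  | zero =>
    refine (Set.finite_singleton (⟨v, .nil⟩ : Σ w, G.Walk v w)).subset ?_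
    rintro ⟨w, p⟩ hp
    cases p with
    | nil => rfl
    | cons h p => simp at hp
  | succ k ih =>
    let c (u : V) (q : Σ w, G.Walk u w) : Σ w, G.Walk v w :=
      if h : G.Adj v u then ⟨q.1, .cons h q.2⟩ else ⟨v, .nil⟩
    refine ((nb v).toFinset.finite_toSet.biUnion fun u _ => (ih u).image (c u)).subset ?_
    rintro ⟨w, p⟩ hp
    cases p with
    | nil => simp at hp
    | @cons _ u _ h p =>
      rw [Set.mem_iUnion₂]
      refine ⟨u, by simpa using (hnb v u).2 h, ⟨w, p⟩, by simpa using hp, ?_⟩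
      simp only [c, dif_pos h]

/-- Prepending `v` to a path that stays in `A.erase v` gives a path from `v`. This is injective for
a fixed second vertex, and different second vertices give disjoint sets of paths. -/
theorem walkCount_le_ncard {G : SimpleGraph V} {nb : V → List V}
    (hnb : ∀ v u, u ∈ nb v ↔ G.Adj v u) (k : ℕ) (A : Finset V) (v : V) :
    walkCount nb k A v ≤ Set.ncard {p : Σ w, G.Walk v w |
      p.2.IsPath ∧ p.2.length = k ∧ ∀ x ∈ p.2.support.tail, x ∈ A} := by
  induction k generalizing A v with
  | zero =>
    rw [walkCount, Nat.one_le_iff_ne_zero, ← Nat.pos_iff_ne_zero, Set.ncard_pos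
      ((finite_walks hnb 0 v).subset fun p hp => hp.2.1)]
    exact ⟨⟨v, .nil⟩, by simp⟩
  | succ k ih =>
    set S := (nb v).toFinset ∩ A.erase v with hS
    let P (u : V) : Set (Σ w, G.Walk u w) :=
      {p | p.2.IsPath ∧ p.2.length = k ∧ ∀ x ∈ p.2.support.tail, x ∈ A.erase v}
    -- The trivial walk is a junk value for non-neighbours and is never used below.
    let c (u : V) (q : Σ w, G.Walk u w) : Σ w, G.Walk v w :=
      if h : G.Adj v u then ⟨q.1, .cons h q.2⟩ else ⟨v, .nil⟩
    have hadj : ∀ u ∈ S, G.Adj v u := fun u hu =>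
      (hnb v u).1 (List.mem_toFinset.1 (Finset.mem_inter.1 hu).1)
    have hfin : ∀ u, (P u).Finite := fun u => (finite_walks hnb k u).subset fun p hp => hp.2.1
    have hinj : ∀ u ∈ S, Set.InjOn (c u) (P u) := by
      rintro u hu ⟨w, p⟩ _ ⟨w', p'⟩ _ h
      simp only [c, dif_pos (hadj u hu)] at h
      obtain ⟨rfl, h⟩ := Sigma.mk.inj_iff.1 h
      have := eq_of_heq h
      simp only [SimpleGraph.Walk.cons.injEq, heq_eq_eq, true_and] at this
      rw [this]
    have hsnd : ∀ u ∈ S, ∀ q : Σ w, G.Walk u w, (c u q).2.getVert 1 = u := by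
      intro u hu q
      have : c u q = ⟨q.1, .cons (hadj u hu) q.2⟩ := dif_pos (hadj u hu)
      rw [this]
      simp
    let U : Finset (Σ w, G.Walk v w) :=
      S.biUnion fun u => ((hfin u).image (c u)).toFinset
    have hcard : U.card = ∑ u ∈ S, (P u).ncard := by
      rw [Finset.card_biUnion]
      · refine Finset.sum_congr rfl fun u hu => ?_
        rw [← Set.ncard_eq_toFinset_card _ ((hfin u).image (c u)), (hinj u hu).ncard_image]
      · intro u hu u' hu' hne
        rw [Function.onFun, Finset.disjoint_left]
        intro q hq hq'
        rw [Set.Finite.mem_toFinset] at hq hq'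
        obtain ⟨p, -, rfl⟩ := hq
        obtain ⟨p', -, h⟩ := hq'
        apply hne
        rw [← hsnd u hu p, ← h, hsnd u' hu' p']
    calc walkCount nb (k + 1) A v ≤ ∑ u ∈ S, (P u).ncard :=
          Finset.sum_le_sum fun u _ => ih (A.erase v) u
      _ = (U : Set (Σ w, G.Walk v w)).ncard := by rw [Set.ncard_coe_finset, hcard]
      _ ≤ _ := by
        apply Set.ncard_le_ncard _ ((finite_walks hnb (k + 1) v).subset fun p hp => hp.2.1)
        intro q hq
        simp only [U, Finset.coe_biUnion, Set.mem_iUnion, Set.Finite.coe_toFinset] at hq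
        obtain ⟨u, hu, ⟨w, p⟩, ⟨h1, h2, h3⟩, rfl⟩ := hq
        simp only [c, dif_pos (hadj u hu), Set.mem_ofPred_eq, SimpleGraph.Walk.length_cons,
          SimpleGraph.Walk.support_cons, List.tail_cons, SimpleGraph.Walk.cons_isPath_iff]
        have hsup : ∀ x ∈ p.support, x ∈ A.erase v := by
          intro x hx
          rw [← SimpleGraph.Walk.cons_tail_support] at hx
          rcases List.mem_cons.1 hx with rfl | hx
          · exact (Finset.mem_inter.1 hu).2
          · exact h3 x hx
        refine ⟨⟨h1, fun hv => Finset.notMem_erase v A (hsup v hv)⟩, by simpa using h2,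
          fun x hx => Finset.mem_of_mem_erase (hsup x hx)⟩

theorem walkCount_le_sawCount {G : SimpleGraph V} {nb : V → List V}
    (hnb : ∀ v u, u ∈ nb v ↔ G.Adj v u) (k : ℕ) (A : Finset V) (v : V) :
    walkCount nb k A v ≤ sawCount G v k :=
  (walkCount_le_ncard hnb k A v).trans (Set.ncard_le_ncard (fun _ hp => ⟨hp.1, hp.2.1⟩)
    ((finite_walks hnb k v).subset fun _ hp => hp.2))

/-! ### Decay of correlations along the recursion tree -/

/-- One level of the contraction. `K` is left open: it is ν below the root and the degree bound at
the root. -/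
theorem sq_psi_sub_step {lam' K : ℝ} (hpos : 0 < lam')
    {r s : Finset V → V → ℝ} (hr : ∀ A u, 0 ≤ r A u) (hs : ∀ A u, 0 ≤ s A u)
    (hr0 : ∀ A u, u ∉ A → r A u = 0) (hs0 : ∀ A u, u ∉ A → s A u = 0) {D : ℕ}
    (hK : ∀ n ≤ D, ∀ w : Fin n → ℝ,
      lam' / (lam' + ∏ i, Real.cosh (w i) ^ 2) * ∑ i, Real.tanh (w i) ^ 2 ≤ K)
    (A : Finset V) (l : List V) (hl : (l.toFinset ∩ A).card ≤ D) {f : Finset V → V → ℕ} {c : ℝ}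
    (hf : ∀ A B u, A ⊆ B → f A u ≤ f B u) (hc : 0 ≤ c)
    (hrs : ∀ B u, B ⊆ A → u ∈ B → u ∈ l → (psi (r B u) - psi (s B u)) ^ 2 ≤ c * f B u) :
    (psi (lam' / prodL r A l) - psi (lam' / prodL s A l)) ^ 2
      ≤ K * (c * (∑ u ∈ l.toFinset ∩ A, f A u : ℕ)) := by
  have hK0 : 0 ≤ K := by simpa using hK 0 (Nat.zero_le _) (fun _ => 0)
  rw [prodL_eq_scan hr0, prodL_eq_scan hs0]
  refine (sq_psi_sub_le hpos (scan A l) (hK _ ((length_scan_le A l).trans hl))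
    (fun p => r p.1 p.2) (fun p => s p.1 p.2) (fun _ _ => hr _ _) (fun _ _ => hs _ _)).trans ?_
  refine mul_le_mul_of_nonneg_left ?_ hK0
  calc _ ≤ ((scan A l).map fun p => c * (f p.1 p.2 : ℝ)).sum := by
        apply List.sum_le_sum
        intro p hp
        obtain ⟨h1, h2, h3⟩ := scan_subset hp
        exact hrs _ _ h1 h2 h3
    _ = c * (((scan A l).map fun p => f p.1 p.2).sum : ℕ) := by
        rw [List.sum_map_mul_left, Nat.cast_list_sum, List.map_map]
        rfl
    _ ≤ _ := by
        refine mul_le_mul_of_nonneg_left ?_ hc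
        exact_mod_cast sum_scan_le hf A l

theorem card_toFinset_le {G : SimpleGraph V} {nb : V → List V} (hnb : ∀ v u, u ∈ nb v ↔ G.Adj v u)
    {D : ℕ} (hD : MaxDegreeLE G D) (v : V) : (nb v).toFinset.card ≤ D := by
  have h1 : ((nb v).toFinset : Set V) = G.neighborSet v := by ext; simp [hnb]
  have h2 := hD v
  rw [← h1, Set.encard_coe_eq_coe_finsetCard] at h2
  exact_mod_cast h2

/-- The assumption of at most d neighbours inside `A` reproduces itself: a child has at most d + 1
neighbours, and its parent has been removed from the vertex set. -/
theorem sq_psi_ratio_sub_le {G : SimpleGraph V} {nb : V → List V}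
    (hnb : ∀ v u, u ∈ nb v ↔ G.Adj v u) {d : ℕ} (hd : 1 ≤ d) (hdeg : MaxDegreeLE G (d + 1))
    {lam lam' : ℝ} (hpos : 0 < lam') (hle : lam' ≤ lam) (k : ℕ) (A : Finset V) (v : V)
    (hA : ((nb v).toFinset ∩ A).card ≤ d) :
    (psi (ratio G lam' A v) - psi (treeRatio nb lam' k A v)) ^ 2 ≤
      psi lam' ^ 2 * nu lam d ^ k * walkCount nb k A v := by
  have hν := nu_pos lam d (hpos.trans_le hle) hd
  induction k generalizing A v with
  | zero =>
    simp only [treeRatio, psi_zero, sub_zero, pow_zero, mul_one, walkCount, Nat.cast_one]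
    exact pow_le_pow_left₀ (psi_nonneg _) (psi_mono (ratio_le G hpos A v)) 2
  | succ k ih =>
    by_cases hv : v ∈ A
    · rw [ratio_eq_prodL hnb hpos hv, treeRatio, if_pos hv, walkCount]
      refine (sq_psi_sub_step hpos (ratio_nonneg G hpos) (treeRatio_nonneg nb hpos k)
        (fun _ _ => ratio_of_notMem G hpos) (fun _ _ => treeRatio_of_notMem nb lam' k)
        (fun n hn w => coeff_le_nu hd hpos hle hn w) (A.erase v) (nb v)
        ((Finset.card_le_card (Finset.inter_subset_inter_left (Finset.erase_subset _ _))).trans hA)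
        (f := walkCount nb k) (c := psi lam' ^ 2 * nu lam d ^ k)
        (fun _ _ u h => walkCount_mono nb k h u) (by positivity) ?_).trans_eq (by ring)
      intro B u hB huB hu
      apply ih
      -- The parent `v` is a neighbour of `u` that is missing from `B`.
      have h1 : (nb u).toFinset ∩ B ⊆ (nb u).toFinset.erase v := by
        intro x hx
        rw [Finset.mem_inter] at hx
        exact Finset.mem_erase.2 ⟨fun h => Finset.notMem_erase v A (hB (h ▸ hx.2)), hx.1⟩
      have h2 : v ∈ (nb u).toFinset := List.mem_toFinset.2 ((hnb u v).2 ((hnb v u).1 hu).symm)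
      have h3 := Finset.card_le_card h1
      have h4 := card_toFinset_le hnb hdeg u
      rw [Finset.card_erase_of_mem h2] at h3
      omega
    · rw [ratio_of_notMem G hpos hv, treeRatio_of_notMem nb lam' _ hv, sub_self,
        zero_pow two_ne_zero]
      positivity

theorem sq_psi_ratio_sub_le_root {G : SimpleGraph V} {nb : V → List V}
    (hnb : ∀ v u, u ∈ nb v ↔ G.Adj v u) {d : ℕ} (hd : 1 ≤ d) (hdeg : MaxDegreeLE G (d + 1))
    {lam lam' : ℝ} (hpos : 0 < lam') (hle : lam' ≤ lam) (k : ℕ) (A : Finset V) (v : V) :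
    (psi (ratio G lam' A v) - psi (treeRatio nb lam' (k + 1) A v)) ^ 2 ≤
      (d + 1 : ℕ) * (psi lam' ^ 2 * nu lam d ^ k * sawCount G v (k + 1)) := by
  have hν := nu_pos lam d (hpos.trans_le hle) hd
  by_cases hv : v ∈ A
  · rw [ratio_eq_prodL hnb hpos hv, treeRatio, if_pos hv]
    refine (sq_psi_sub_step hpos (ratio_nonneg G hpos) (treeRatio_nonneg nb hpos k)
      (fun _ _ => ratio_of_notMem G hpos) (fun _ _ => treeRatio_of_notMem nb lam' k)
      (fun n hn w => coeff_le_card hpos hn w) (A.erase v) (nb v)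
      ((Finset.card_le_card Finset.inter_subset_left).trans (card_toFinset_le hnb hdeg v))
      (f := walkCount nb k) (c := psi lam' ^ 2 * nu lam d ^ k)
      (fun _ _ u h => walkCount_mono nb k h u) (by positivity) ?_).trans ?_
    · intro B u hB huB hu
      apply sq_psi_ratio_sub_le hnb hd hdeg hpos hle
      have h1 : (nb u).toFinset ∩ B ⊆ (nb u).toFinset.erase v := by
        intro x hx
        rw [Finset.mem_inter] at hx
        exact Finset.mem_erase.2 ⟨fun h => Finset.notMem_erase v A (hB (h ▸ hx.2)), hx.1⟩
      have h2 : v ∈ (nb u).toFinset := List.mem_toFinset.2 ((hnb u v).2 ((hnb v u).1 hu).symm)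
      have h3 := Finset.card_le_card h1
      have h4 := card_toFinset_le hnb hdeg u
      rw [Finset.card_erase_of_mem h2] at h3
      omega
    · have := walkCount_le_sawCount hnb (k + 1) A v
      rw [walkCount] at this
      gcongr
  · rw [ratio_of_notMem G hpos hv, treeRatio_of_notMem nb lam' _ hv, sub_self,
        zero_pow two_ne_zero]
    positivity

/-- The bound involves only the larger activity `lam`, so it is uniform over the approximate
activities used by the algorithm. -/
theorem abs_ratio_sub_treeRatio_le {G : SimpleGraph V} {nb : V → List V}
    (hnb : ∀ v u, u ∈ nb v ↔ G.Adj v u) {d : ℕ} (hd : 1 ≤ d) (hdeg : MaxDegreeLE G (d + 1))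
    {lam lam' : ℝ} (hpos : 0 < lam') (hle : lam' ≤ lam) (k : ℕ) (A : Finset V) (v : V) :
    |ratio G lam' A v - treeRatio nb lam' (k + 1) A v| ≤
      2 * (1 + lam) * (psi lam * √((d + 1 : ℕ) * (nu lam d ^ k * sawCount G v (k + 1)))) := by
  have h1 := abs_sub_le_of_psi (ratio_nonneg G hpos A v) (treeRatio_nonneg nb hpos (k + 1) A v)
    ((ratio_le G hpos A v).trans hle) ((treeRatio_le nb hpos (k + 1) A v).trans hle)
  have h2 := sq_psi_ratio_sub_le_root hnb hd hdeg hpos hle k A v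
  have hν := nu_pos lam d (hpos.trans_le hle) hd
  refine h1.trans (mul_le_mul_of_nonneg_left ?_ (by linarith))
  rw [← Real.sqrt_sq (psi_nonneg lam), ← Real.sqrt_mul (by positivity)]
  apply Real.le_sqrt_of_sq_le
  rw [sq_abs]
  refine h2.trans ?_
  have h3 : psi lam' ^ 2 ≤ psi lam ^ 2 := pow_le_pow_left₀ (psi_nonneg _) (psi_mono hle) 2
  calc _ = psi lam' ^ 2 * ((d + 1 : ℕ) * (nu lam d ^ k * sawCount G v (k + 1))) := by ring
    _ ≤ _ := mul_le_mul_of_nonneg_right h3 (by positivity)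

/-- Vertex sets that agree at distance less than `k + 1` from `v` have close occupation ratios. -/
theorem abs_ratio_sub_ratio_le {G : SimpleGraph V} {nb : V → List V}
    (hnb : ∀ v u, u ∈ nb v ↔ G.Adj v u) {d : ℕ} (hd : 1 ≤ d) (hdeg : MaxDegreeLE G (d + 1))
    {lam lam' : ℝ} (hpos : 0 < lam') (hle : lam' ≤ lam) (k : ℕ) (A B : Finset V) (v : V)
    (h : ∀ w, G.edist v w < (k + 1 : ℕ) → (w ∈ A ↔ w ∈ B)) :
    |ratio G lam' A v - ratio G lam' B v| ≤
      4 * (1 + lam) * (psi lam * √((d + 1 : ℕ) * (nu lam d ^ k * sawCount G v (k + 1)))) := by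
  have h1 := abs_ratio_sub_treeRatio_le hnb hd hdeg hpos hle k A v
  have h2 := abs_ratio_sub_treeRatio_le hnb hd hdeg hpos hle k B v
  rw [← treeRatio_congr hnb lam' (k + 1) A B v h, abs_sub_comm] at h2
  have := abs_sub_le (ratio G lam' A v) (treeRatio nb lam' (k + 1) A v) (ratio G lam' B v)
  linarith

end Recurrence

/-! ### Occupation probabilities and boundary conditions -/

section Gibbs

variable {V : Type u}

theorem sum_mem_eq_Z_sub (G : SimpleGraph V) (lam : ℝ) (A : Finset V) (v : V) :
    (∑ J ∈ A.powerset, if G.IsIndepSet (J : Set V) ∧ v ∈ J then lam ^ J.card else 0) =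
      Z G lam A - Z G lam (A.erase v) := by
  have h : Z G lam (A.erase v) =
      ∑ J ∈ A.powerset, if G.IsIndepSet (J : Set V) ∧ v ∉ J then lam ^ J.card else 0 := by
    unfold Z
    rw [← Finset.sum_filter, ← Finset.sum_filter]
    refine Finset.sum_congr ?_ fun _ _ => rfl
    ext J
    simp only [Finset.mem_filter, Finset.mem_powerset, Finset.subset_erase]
    tauto
  rw [h, Z, ← Finset.sum_sub_distrib]
  refine Finset.sum_congr rfl fun J _ => ?_
  by_cases h1 : G.IsIndepSet (J : Set V) <;> by_cases h2 : v ∈ J <;> simp [h1, h2]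

/-- The occupation probability at `v` in the subgraph induced by `A`. -/
def prob (G : SimpleGraph V) (lam : ℝ) (A : Finset V) (v : V) : ℝ :=
  (Z G lam A - Z G lam (A.erase v)) / Z G lam A

theorem prob_eq (G : SimpleGraph V) {lam : ℝ} (hpos : 0 < lam) (A : Finset V) (v : V) :
    prob G lam A v = 1 - 1 / (1 + ratio G lam A v) := by
  have := (Z_pos G hpos A).ne'
  have := (Z_pos G hpos (A.erase v)).ne'
  rw [one_add_ratio, prob]
  field_simp

theorem prob_nonneg (G : SimpleGraph V) {lam : ℝ} (hpos : 0 < lam) (A : Finset V) (v : V) :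
    0 ≤ prob G lam A v :=
  div_nonneg (sub_nonneg.2 (Z_mono G hpos (Finset.erase_subset _ _))) (Z_pos G hpos A).le

theorem prob_le (G : SimpleGraph V) {lam : ℝ} (hpos : 0 < lam) (A : Finset V) (v : V) :
    prob G lam A v ≤ 1 - 1 / (1 + lam) := by
  rw [prob_eq G hpos]
  have h0 := ratio_nonneg G hpos A v
  have h1 := ratio_le G hpos A v
  gcongr

theorem abs_prob_sub_le (G : SimpleGraph V) {lam : ℝ} (hpos : 0 < lam) (A B : Finset V) (v : V) :
    |prob G lam A v - prob G lam B v| ≤ |ratio G lam A v - ratio G lam B v| := by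
  have h1 := ratio_nonneg G hpos A v
  have h2 := ratio_nonneg G hpos B v
  have h3 : prob G lam A v - prob G lam B v = (ratio G lam A v - ratio G lam B v) /
      ((1 + ratio G lam A v) * (1 + ratio G lam B v)) := by
    rw [prob_eq G hpos, prob_eq G hpos]
    field_simp
    ring
  rw [h3, abs_div]
  apply div_le_self (abs_nonneg _)
  rw [abs_of_nonneg (by positivity)]
  nlinarith [mul_nonneg h1 h2]

theorem prob_div_one_sub (G : SimpleGraph V) {lam : ℝ} (hpos : 0 < lam) (A : Finset V) (v : V) :
    prob G lam A v / (1 - prob G lam A v) = ratio G lam A v := by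
  have h1 := ratio_nonneg G hpos A v
  rw [prob_eq G hpos]
  field_simp
  ring

theorem abs_div_one_sub_sub_le {lam x y : ℝ} (hlam : 0 < lam) (hx : x ≤ 1 - 1 / (1 + lam))
    (hy : y ≤ 1 - 1 / (1 + lam)) :
    |x / (1 - x) - y / (1 - y)| ≤ (1 + lam) ^ 2 * |x - y| := by
  have h0 : 0 < 1 / (1 + lam) := by positivity
  have hx' : 0 < 1 - x := by linarith
  have hy' : 0 < 1 - y := by linarith
  have h1 : x / (1 - x) - y / (1 - y) = (x - y) / ((1 - x) * (1 - y)) := by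
    field_simp
    ring
  have h2 : (1 / (1 + lam)) ^ 2 ≤ (1 - x) * (1 - y) := by
    rw [sq]
    apply mul_le_mul <;> linarith
  rw [h1, abs_div, abs_of_pos (mul_pos hx' hy'), div_le_iff₀ (mul_pos hx' hy')]
  have h3 : 1 ≤ (1 + lam) ^ 2 * ((1 - x) * (1 - y)) := by
    calc (1 : ℝ) = (1 + lam) ^ 2 * (1 / (1 + lam)) ^ 2 := by field_simp
      _ ≤ _ := by gcongr
  nlinarith [abs_nonneg (x - y)]

/-- The vertices that `σ` leaves free and that have no neighbour fixed to be occupied. -/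
def free [Fintype V] {G : SimpleGraph V} (σ : BoundaryCondition G) : Finset V :=
  Finset.univ.filter fun u => u ∉ σ.S ∧ ∀ w ∈ σ.I, ¬ G.Adj u w

/-- Removing the fixed occupied vertices is a bijection from the configurations that agree with σ to
the independent subsets of `free σ`. The weight of the fixed vertices is a common factor, which
cancels in the occupation probability. -/
theorem sum_boundary [Fintype V] {G : SimpleGraph V} (lam : ℝ) (σ : BoundaryCondition G)
    (p : Finset V → Prop) [DecidablePred p] (hp : ∀ J : Finset V, p (J \ σ.I.toFinset) ↔ p J) :
    (∑ J ∈ (Finset.univ : Finset (Finset V)).filter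
      (fun J : Finset V => G.IsIndepSet (J : Set V) ∧ (J : Set V) ∩ σ.S = σ.I ∧ p J),
        lam ^ J.card) =
    lam ^ σ.I.toFinset.card * ∑ J ∈ (free σ).powerset,
      if G.IsIndepSet (J : Set V) ∧ p J then lam ^ J.card else 0 := by
  rw [← Finset.sum_filter, Finset.mul_sum]
  have hfree : ∀ J : Finset V, J ⊆ free σ → Disjoint J σ.I.toFinset := by
    intro J hJ
    rw [Finset.disjoint_left]
    intro u hu hu'
    exact (Finset.mem_filter.1 (hJ hu)).2.1 (σ.subset (Set.mem_toFinset.1 hu'))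
  symm
  refine Finset.sum_nbij' (fun J => J ∪ σ.I.toFinset) (fun J => J \ σ.I.toFinset) ?_ ?_ ?_ ?_ ?_
  · intro J hJ
    obtain ⟨hJ1, hJ2, hJ3⟩ := by simpa only [Finset.mem_filter, Finset.mem_powerset] using hJ
    rw [Finset.mem_filter]
    refine ⟨Finset.mem_univ _, ?_, ?_, ?_⟩
    · rw [Finset.coe_union, Set.coe_toFinset]
      intro x hx y hy hxy hadj
      rcases hx with hx | hx <;> rcases hy with hy | hy
      · exact hJ2 hx hy hxy hadj
      · exact (Finset.mem_filter.1 (hJ1 hx)).2.2 y hy hadj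
      · exact (Finset.mem_filter.1 (hJ1 hy)).2.2 x hx hadj.symm
      · exact σ.indep hx hy hxy hadj
    · ext x
      simp only [Finset.coe_union, Set.coe_toFinset, Set.mem_inter_iff, Set.mem_union,
        Finset.mem_coe]
      constructor
      · rintro ⟨hx | hx, hxS⟩
        · exact absurd hxS (Finset.mem_filter.1 (hJ1 hx)).2.1
        · exact hx
      · exact fun hx => ⟨Or.inr hx, σ.subset hx⟩
    · rwa [← hp, Finset.union_sdiff_right, hp]
  · intro J hJ
    obtain ⟨-, hJ1, hJ2, hJ3⟩ := by simpa only [Finset.mem_filter] using hJ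
    rw [Finset.mem_filter, Finset.mem_powerset]
    have hIJ : ∀ x ∈ σ.I, x ∈ J := fun x hx => by
      rw [← hJ2] at hx
      exact hx.1
    refine ⟨fun u hu => ?_, hJ1.mono (by
      rw [Finset.coe_sdiff]; exact Set.sdiff_subset), (hp J).2 hJ3⟩
    rw [Finset.mem_sdiff, Set.mem_toFinset] at hu
    refine Finset.mem_filter.2 ⟨Finset.mem_univ _, fun hS => hu.2 ?_, fun w hw hadj => ?_⟩
    · rw [← hJ2]
      exact ⟨hu.1, hS⟩
    · exact hJ1 hu.1 (hIJ w hw) hadj.ne hadj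
  · intro J hJ
    have hJ1 := Finset.mem_powerset.1 (Finset.mem_filter.1 hJ).1
    simp only [Finset.union_sdiff_right]
    exact Finset.sdiff_eq_self_of_disjoint (hfree J hJ1)
  · intro J hJ
    obtain ⟨-, hJ1, hJ2, hJ3⟩ := by simpa only [Finset.mem_filter] using hJ
    apply Finset.sdiff_union_of_subset
    intro x hx
    rw [Set.mem_toFinset, ← hJ2] at hx
    exact hx.1
  · intro J hJ
    have hJ1 := Finset.mem_powerset.1 (Finset.mem_filter.1 hJ).1
    rw [Finset.card_union_of_disjoint (hfree J hJ1), pow_add, mul_comm]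

theorem occRatio_eq [Fintype V] {G : SimpleGraph V} {lam : ℝ} (hpos : 0 < lam)
    (σ : BoundaryCondition G) {v : V} (hv : v ∉ σ.I) :
    occRatio G lam σ v = ratio G lam (free σ) v := by
  have h1 := sum_boundary lam σ (fun J => v ∈ J) (fun J => by simp [hv])
  have h2 := sum_boundary lam σ (fun _ => True) (fun J => Iff.rfl)
  rw [sum_mem_eq_Z_sub] at h1
  simp only [and_true] at h2
  have h3 : occProb G lam σ v = prob G lam (free σ) v := by
    rw [occProb, h1, h2, prob, ← Z, mul_div_mul_left _ _ (by positivity)]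
  rw [occRatio, h3, prob_div_one_sub G hpos]

theorem partitionFunction_eq_Z [Fintype V] (G : SimpleGraph V) (lam : ℝ) :
    partitionFunction G lam = Z G lam Finset.univ := by
  rw [partitionFunction, Z, Finset.sum_filter, Finset.powerset_univ]

theorem edist_lt_succ {G : SimpleGraph V} {v w u : V} {k : ℕ} (h : G.edist v w < k)
    (hadj : G.Adj w u) : G.edist v u < (k + 1 : ℕ) := by
  calc G.edist v u ≤ G.edist v w + G.edist w u := SimpleGraph.edist_triangle
    _ = G.edist v w + 1 := by rw [SimpleGraph.edist_eq_one_iff_adj.2 hadj]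
    _ < k + 1 := (ENat.add_lt_add_iff_right (by simp)).2 h
    _ = (k + 1 : ℕ) := by push_cast; rfl

/-- Whether a vertex is free depends on its neighbours too, hence the loss of one unit of distance.
-/
theorem mem_free_congr [Fintype V] {G : SimpleGraph V} {σ τ : BoundaryCondition G} {v w : V}
    {k : ℕ} (h : DifferOnlyFrom σ τ v (k + 1)) (hw : G.edist v w < k) :
    w ∈ free σ ↔ w ∈ free τ := by
  have hw' : G.edist v w < (k + 1 : ℕ) := hw.trans_le (by simp)
  have h1 : (∀ u ∈ σ.I, ¬ G.Adj w u) ↔ ∀ u ∈ τ.I, ¬ G.Adj w u := by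
    constructor
    · exact fun H u hu hadj => H u ((h u (edist_lt_succ hw hadj)).2.2 hu) hadj
    · exact fun H u hu hadj => H u ((h u (edist_lt_succ hw hadj)).2.1 hu) hadj
  simp only [free, Finset.mem_filter, Finset.mem_univ, true_and, (h w hw').1, h1]

/-! ### Strong spatial mixing -/

/-- The room between Δ and Δ' absorbs the subexponential factors in the number of walks, and it
makes Δ' positive even when Δ = 0. -/
theorem nu_mul_lt_one {lam : ℝ} {d : ℕ} (hlam : 0 < lam) (hd : 1 ≤ d) {Δ : ℝ} (hΔ : 0 ≤ Δ)
    (h : nu lam d * Δ < 1) : ∃ Δ' > Δ, nu lam d * Δ' < 1 := by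
  have hν := nu_pos lam d hlam hd
  refine ⟨(Δ + 1 / nu lam d) / 2, ?_, ?_⟩
  · have : Δ < 1 / nu lam d := by rwa [lt_div_iff₀ hν, mul_comm]
    linarith
  · have : nu lam d * ((Δ + 1 / nu lam d) / 2) = (nu lam d * Δ + 1) / 2 := by field_simp
    linarith

theorem decay_le {d : ℕ} {ν Δ' c N : ℝ} {k : ℕ} (hν : 0 < ν) (hΔ : 0 < Δ')
    (hN : N ≤ c * Δ' ^ (k + 1)) :
    √((d + 1 : ℕ) * (ν ^ k * N)) ≤
      √((d + 1 : ℕ) * (|c| * Δ')) * Real.exp (-(-Real.log √(ν * Δ') * k)) := by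
  have hpos : 0 < √(ν * Δ') := Real.sqrt_pos.2 (by positivity)
  have h1 : Real.exp (-(-Real.log √(ν * Δ') * k)) = √((ν * Δ') ^ k) := by
    rw [neg_mul, neg_neg, mul_comm, Real.exp_nat_mul, Real.exp_log hpos]
    rw [← Real.sqrt_sq (pow_nonneg hpos.le k), ← pow_mul, mul_comm k 2, pow_mul,
      Real.sq_sqrt (by positivity)]
  rw [h1, ← Real.sqrt_mul (by positivity)]
  apply Real.sqrt_le_sqrt
  have h2 : N ≤ |c| * Δ' ^ (k + 1) := hN.trans (by gcongr; exact le_abs_self c)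
  calc _ ≤ ((d + 1 : ℕ) : ℝ) * (ν ^ k * (|c| * Δ' ^ (k + 1))) := by gcongr
    _ = _ := by rw [mul_pow, pow_succ]; ring

theorem rate_pos {ν Δ' : ℝ} (hν : 0 < ν) (hΔ : 0 < Δ') (h : ν * Δ' < 1) :
    0 < -Real.log √(ν * Δ') := by
  rw [neg_pos]
  apply Real.log_neg (Real.sqrt_pos.2 (by positivity))
  rw [← Real.sqrt_one]
  exact Real.sqrt_lt_sqrt (by positivity) h

theorem finiteSSM_of_nu_mul_lt_one {d : ℕ} (hd : 1 ≤ d) {lam lam' Δ' : ℝ} {Δ : ℝ≥0}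
    (hΔ : (Δ : ℝ) < Δ') (hpos : 0 < lam') (hle : lam' ≤ lam)
    (hν' : nu lam d * Δ' < 1) {F : FiniteFamily} {a c : ℝ}
    (hdeg : ∀ G ∈ F, MaxDegreeLE G.2 (d + 1)) (hF : ConnectiveConstantLEWith F Δ a c) :
    FiniteSSM F lam' (-Real.log √(nu lam d * Δ')) a := by
  have hlam := hpos.trans_le hle
  have hν := nu_pos lam d hlam hd
  have hΔ0 : 0 < Δ' := Δ.2.trans_lt hΔ
  set κ := -Real.log √(nu lam d * Δ') with hκ
  have hκ0 : 0 < κ := rate_pos hν hΔ0 hν'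
  set C₁ := 4 * (1 + lam) * (psi lam * √((d + 1 : ℕ) * (|(|c| * Δ')| * Δ'))) with hC₁
  have hC₁0 : 0 ≤ C₁ := by
    have := psi_nonneg lam
    positivity
  -- Two units of distance are lost, one in `mem_free_congr` and one at the root, where no factor ν
  -- is gained. The summand `lam` covers ℓ < 2, where ratios in [0, λ'] differ by at most λ.
  refine ⟨(C₁ + lam) * Real.exp (κ * 2), ?_⟩
  intro G hG v l σ τ hl hdiff hvσ hvτ
  have hexp : Real.exp (κ * 2) * Real.exp (-(κ * l)) = Real.exp (-(κ * (l - 2))) := by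
    rw [← Real.exp_add]; congr 1; ring
  rw [occRatio_eq hpos σ hvσ, occRatio_eq hpos τ hvτ, mul_assoc, hexp]
  rcases lt_or_ge l 2 with h2 | h2
  · have h2' : (l : ℝ) < 2 := by exact_mod_cast h2
    have h3 : 1 ≤ Real.exp (-(κ * (l - 2))) := Real.one_le_exp (by nlinarith)
    have h4 : |ratio G.2 lam' (free σ) v - ratio G.2 lam' (free τ) v| ≤ lam := by
      have := ratio_nonneg G.2 hpos (free σ) v
      have := ratio_nonneg G.2 hpos (free τ) v
      have := ratio_le G.2 hpos (free σ) v
      have := ratio_le G.2 hpos (free τ) v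
      rw [abs_le]
      constructor <;> linarith
    nlinarith
  · obtain ⟨k, rfl⟩ : ∃ k, l = k + 2 := ⟨l - 2, by omega⟩
    -- The walk bound is assumed only from length a log |V| on, so it is applied at ℓ = k + 2, at
    -- the price of an extra factor Δ'.
    have hN : (sawCount G.2 v (k + 1) : ℝ) ≤ |c| * Δ' * Δ' ^ (k + 1) := by
      have h3 : sawCount G.2 v (k + 1) ≤ ∑ i ∈ Finset.Icc 1 (k + 2), sawCount G.2 v i :=
        Finset.single_le_sum (f := fun i => sawCount G.2 v i) (fun _ _ => Nat.zero_le _)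
          (Finset.mem_Icc.2 ⟨by omega, by omega⟩)
      calc (sawCount G.2 v (k + 1) : ℝ)
          ≤ ((∑ i ∈ Finset.Icc 1 (k + 2), sawCount G.2 v i : ℕ) : ℝ) := by exact_mod_cast h3
        _ ≤ c * (Δ : ℝ) ^ (k + 2) := hF G hG v (k + 2) hl
        _ ≤ |c| * Δ' ^ (k + 2) := by
          apply mul_le_mul (le_abs_self c) _ (by positivity) (abs_nonneg c)
          exact pow_le_pow_left₀ Δ.2 hΔ.le _
        _ = _ := by ring
    have hnb : ∀ v u, u ∈ (G.2.neighborFinset v).toList ↔ G.2.Adj v u := by simp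
    have h4 := abs_ratio_sub_ratio_le hnb hd (hdeg G hG) hpos hle k (free σ) (free τ) v
      (fun w hw => mem_free_congr hdiff hw)
    have h5 := decay_le (d := d) hν hΔ0 hN
    have h6 : ((k + 2 : ℕ) : ℝ) - 2 = k := by push_cast; ring
    rw [h6]
    refine h4.trans ?_
    calc _ ≤ 4 * (1 + lam) * (psi lam * (√((d + 1 : ℕ) * (|(|c| * Δ')| * Δ')) *
          Real.exp (-(κ * k)))) := by
          have := psi_nonneg lam
          gcongr
      _ = C₁ * Real.exp (-(κ * k)) := by rw [hC₁]; ring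
      _ ≤ _ := by gcongr; linarith

end Gibbs

/-! ### Infinite graphs: Gibbs measures as averages of finite-window distributions -/

section Infinite

variable {V : Type u}

/-- The vertices of `Λ` without an occupied neighbour outside `Λ`. -/
def unblocked (G : SimpleGraph V) (Λ : Finset V) (ω : Set V) : Finset V :=
  Λ.filter fun u => ∀ w ∈ ω \ (Λ : Set V), ¬ G.Adj u w

/-- The configuration outside the window acts only by blocking neighbours, so the window
distribution is the hard core model on the unblocked vertices. -/
theorem sum_windowWeight (G : SimpleGraph V) (lam : ℝ) (Λ : Finset V) (ω : Set V)
    (p : Finset V → Prop) [DecidablePred p] :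
    (∑ J ∈ Λ.powerset, if p J then windowWeight G lam Λ ω J else 0) =
      ∑ J ∈ (unblocked G Λ ω).powerset,
        if G.IsIndepSet (J : Set V) ∧ p J then lam ^ J.card else 0 := by
  simp only [windowWeight, ← ite_and]
  rw [← Finset.sum_filter, ← Finset.sum_filter]
  refine Finset.sum_congr ?_ fun _ _ => rfl
  ext J
  simp only [Finset.mem_filter, Finset.mem_powerset, unblocked, Finset.subset_iff]
  constructor
  · rintro ⟨h1, h2, h3, h4⟩
    exact ⟨fun x hx => ⟨h1 hx, h4 x hx⟩, h3, h2⟩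
  · rintro ⟨h1, h2, h3⟩
    exact ⟨fun x hx => (h1 hx).1, h3, h2, fun x hx => (h1 hx).2⟩

theorem sum_windowGibbs (G : SimpleGraph V) (lam : ℝ) (Λ : Finset V) (ω : Set V) (v : V) :
    (∑ J ∈ Λ.powerset, if v ∈ J then windowGibbs G lam Λ ω J else 0) =
      prob G lam (unblocked G Λ ω) v := by
  have h1 := sum_windowWeight G lam Λ ω fun J => v ∈ J
  have h2 := sum_windowWeight G lam Λ ω fun _ => True
  simp only [if_true, and_true] at h2
  rw [sum_mem_eq_Z_sub] at h1
  rw [prob, ← h1, Z, ← h2, Finset.sum_div]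
  refine Finset.sum_congr rfl fun J _ => ?_
  split_ifs
  · rfl
  · rw [zero_div]

theorem windowGibbs_nonneg (G : SimpleGraph V) {lam : ℝ} (hpos : 0 < lam) (Λ : Finset V)
    (ω : Set V) (I : Finset V) : 0 ≤ windowGibbs G lam Λ ω I := by
  have h : ∀ J, 0 ≤ windowWeight G lam Λ ω J := by
    intro J
    rw [windowWeight]
    split_ifs <;> positivity
  exact div_nonneg (h I) (Finset.sum_nonneg fun J _ => h J)

theorem measurableSet_mem (v : V) : MeasurableSet {ω : Set V | v ∈ ω} :=
  measurableSet_setOfPred.2 (measurable_pi_apply (X := fun _ : V => Prop) v)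

theorem measure_mem_eq {G : SimpleGraph V} {lam : ℝ} (hpos : 0 < lam) {σ : BoundaryCondition G}
    {μ : MeasureTheory.Measure (Set V)} (hμ : IsGibbsMeasure G lam σ μ) {Λ : Finset V}
    (hΛ : Disjoint (Λ : Set V) σ.S) {v : V} (hv : v ∈ Λ) :
    μ {ω | v ∈ ω} = ∫⁻ ω, ENNReal.ofReal (prob G lam (unblocked G Λ ω) v) ∂μ := by
  rw [hμ.dlr Λ hΛ _ (measurableSet_mem v)]
  refine MeasureTheory.lintegral_congr fun ω => ?_
  rw [← sum_windowGibbs, ENNReal.ofReal_sum_of_nonneg]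
  · refine Finset.sum_congr rfl fun I _ => ?_
    by_cases h : v ∈ I
    · simp [h, Set.indicator]
    · simp [h, hv, Set.indicator]
  · intro I _
    split_ifs
    · exact windowGibbs_nonneg G hpos Λ ω I
    · exact le_rfl

theorem measureReal_mem_le {G : SimpleGraph V} {lam : ℝ} (hpos : 0 < lam)
    {σ : BoundaryCondition G} {μ : MeasureTheory.Measure (Set V)} (hμ : IsGibbsMeasure G lam σ μ)
    {Λ : Finset V} (hΛ : Disjoint (Λ : Set V) σ.S) {v : V} (hv : v ∈ Λ) {b : ℝ} (hb0 : 0 ≤ b)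
    (hb : ∀ᵐ ω ∂μ, prob G lam (unblocked G Λ ω) v ≤ b) : μ.real {ω | v ∈ ω} ≤ b := by
  have := hμ.prob
  apply ENNReal.toReal_le_of_le_ofReal hb0
  rw [measure_mem_eq hpos hμ hΛ hv]
  calc _ ≤ ∫⁻ _, ENNReal.ofReal b ∂μ :=
        MeasureTheory.lintegral_mono_ae (hb.mono fun ω h => ENNReal.ofReal_le_ofReal h)
    _ = _ := by simp

theorem le_measureReal_mem {G : SimpleGraph V} {lam : ℝ} (hpos : 0 < lam)
    {σ : BoundaryCondition G} {μ : MeasureTheory.Measure (Set V)} (hμ : IsGibbsMeasure G lam σ μ)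
    {Λ : Finset V} (hΛ : Disjoint (Λ : Set V) σ.S) {v : V} (hv : v ∈ Λ) {b : ℝ}
    (hb : ∀ᵐ ω ∂μ, b ≤ prob G lam (unblocked G Λ ω) v) : b ≤ μ.real {ω | v ∈ ω} := by
  have := hμ.prob
  apply (ENNReal.ofReal_le_iff_le_toReal (MeasureTheory.measure_ne_top μ _)).1
  rw [measure_mem_eq hpos hμ hΛ hv]
  calc _ = ∫⁻ _, ENNReal.ofReal b ∂μ := by simp
    _ ≤ _ := MeasureTheory.lintegral_mono_ae (hb.mono fun ω h => ENNReal.ofReal_le_ofReal h)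

theorem measureReal_mem_eq_zero {G : SimpleGraph V} {lam : ℝ} {σ : BoundaryCondition G}
    {μ : MeasureTheory.Measure (Set V)} (hμ : IsGibbsMeasure G lam σ μ) {v : V} (hv : v ∈ σ.S)
    (hvI : v ∉ σ.I) : μ.real {ω | v ∈ ω} = 0 := by
  have h : μ {ω | v ∈ ω} = 0 := by
    have := hμ.boundary v hv
    rw [MeasureTheory.ae_iff] at this
    convert this using 3
    simp [hvI]
  rw [MeasureTheory.measureReal_def, h, ENNReal.toReal_zero]

/-- The window {v} alone keeps the probability away from 1, so that p / (1 - p) is Lipschitz on the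
relevant range. -/
theorem measureReal_mem_le_one_sub {G : SimpleGraph V} {lam : ℝ} (hpos : 0 < lam)
    {σ : BoundaryCondition G} {μ : MeasureTheory.Measure (Set V)} (hμ : IsGibbsMeasure G lam σ μ)
    {v : V} (hvI : v ∉ σ.I) : μ.real {ω | v ∈ ω} ≤ 1 - 1 / (1 + lam) := by
  have h0 : 0 ≤ 1 - 1 / (1 + lam) := by
    rw [sub_nonneg, div_le_one (by linarith)]
    linarith
  by_cases hv : v ∈ σ.S
  · rw [measureReal_mem_eq_zero hμ hv hvI]
    exact h0
  · exact measureReal_mem_le hpos hμ (Λ := {v}) (by simpa using hv) (by simp) h0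
      (Filter.Eventually.of_forall fun ω => prob_le G hpos _ v)

theorem finite_ball {G : SimpleGraph V} {nb : V → List V} (hnb : ∀ v u, u ∈ nb v ↔ G.Adj v u)
    (v : V) (l : ℕ) : {w | G.edist v w < l}.Finite := by
  refine ((Set.finite_Iio l).biUnion fun k _ =>
    (finite_walks hnb k v).image Sigma.fst).subset ?_
  intro w hw
  have hw' : G.edist v w < l := hw
  obtain ⟨p, hp⟩ := SimpleGraph.exists_walk_of_edist_ne_top (ne_top_of_lt hw')
  rw [Set.mem_iUnion₂]
  refine ⟨p.length, ?_, ⟨w, p⟩, rfl, rfl⟩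
  rw [← hp] at hw'
  exact_mod_cast hw'

theorem infinite_sawCount_le {G : SimpleGraph V} {Δ' : ℝ} {Δ : ℝ≥0}
    (hΔ : (Δ : ℝ) < Δ') (h : connectiveConstant G ≤ (Δ : ℝ≥0∞)) (v : V) :
    ∃ c : ℝ, ∀ l, (sawCount G v l : ℝ) ≤ c * Δ' ^ l := by
  have hΔ0 : 0 < Δ' := Δ.2.trans_lt hΔ
  have h1 : Filter.limsup (fun l : ℕ => (sawCount G v l : ℝ≥0∞) ^ (1 / (l : ℝ))) Filter.atTop <
      ENNReal.ofReal Δ' := by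
    refine ((le_iSup _ v).trans h).trans_lt ?_
    rw [← ENNReal.ofReal_coe_nnreal]
    exact (ENNReal.ofReal_lt_ofReal_iff hΔ0).2 hΔ
  have h2 := Filter.eventually_lt_of_limsup_lt h1
  obtain ⟨l₀, hl₀⟩ := Filter.eventually_atTop.1 h2
  -- The 1 serves the lengths beyond the limsup threshold, the sum the finitely many lengths up to
  -- it.
  refine ⟨1 + ∑ l ∈ Finset.range (l₀ + 1), (sawCount G v l : ℝ) / Δ' ^ l, fun l => ?_⟩
  have hs : 0 ≤ ∑ l ∈ Finset.range (l₀ + 1), (sawCount G v l : ℝ) / Δ' ^ l :=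
    Finset.sum_nonneg fun _ _ => by positivity
  rcases lt_or_ge l (l₀ + 1) with hl | hl
  · have h3 : (sawCount G v l : ℝ) / Δ' ^ l ≤
        ∑ l ∈ Finset.range (l₀ + 1), (sawCount G v l : ℝ) / Δ' ^ l :=
      Finset.single_le_sum (f := fun l => (sawCount G v l : ℝ) / Δ' ^ l)
        (fun _ _ => by positivity) (Finset.mem_range.2 hl)
    rw [← div_le_iff₀ (by positivity)]
    linarith
  · have h3 := hl₀ l (by omega)
    have hl0 : (0 : ℝ) < l := by exact_mod_cast (by omega : 0 < l)
    have h4 : (sawCount G v l : ℝ≥0∞) ≤ ENNReal.ofReal (Δ' ^ l) := by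
      have h5 := ENNReal.rpow_le_rpow h3.le hl0.le
      rw [← ENNReal.rpow_mul, one_div_mul_cancel hl0.ne', ENNReal.rpow_one,
        ENNReal.rpow_natCast, ← ENNReal.ofReal_pow hΔ0.le] at h5
      exact h5
    have h6 : (sawCount G v l : ℝ) ≤ Δ' ^ l := by
      rw [← ENNReal.ofReal_natCast] at h4
      exact (ENNReal.ofReal_le_ofReal_iff (by positivity)).1 h4
    nlinarith [pow_pos hΔ0 l]

/-- Almost surely the set of unblocked vertices near `v` is determined by the boundary
condition. -/
theorem ae_mem_unblocked_iff {G : SimpleGraph V} {nb : V → List V}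
    (hnb : ∀ v u, u ∈ nb v ↔ G.Adj v u) {lam : ℝ} {σ : BoundaryCondition G}
    {μ : MeasureTheory.Measure (Set V)} (hμ : IsGibbsMeasure G lam σ μ) {v : V} {k : ℕ}
    {Λ : Finset V} (hΛ : ∀ w, w ∈ Λ ↔ G.edist v w < (k + 1 : ℕ) ∧ w ∉ σ.S) :
    ∀ᵐ ω ∂μ, ∀ u, G.edist v u < k →
      (u ∈ unblocked G Λ ω ↔ u ∉ σ.S ∧ ∀ w ∈ σ.I, ¬ G.Adj u w) := by
  -- The vertex set may be uncountable, so the almost sure boundary conditions are combined only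
  -- over a ball, which is finite.
  have h1 : ∀ᵐ ω ∂μ, ∀ w ∈ {w | G.edist v w < (k + 1 : ℕ)} ∩ σ.S, (w ∈ ω ↔ w ∈ σ.I) := by
    refine (Filter.eventually_all_finite ((finite_ball hnb v (k + 1)).inter_of_left σ.S)).2 ?_
    exact fun w hw => hμ.boundary w hw.2
  filter_upwards [h1] with ω hω u hu
  have hu' : G.edist v u < (k + 1 : ℕ) := hu.trans_le (by simp)
  rw [unblocked, Finset.mem_filter, hΛ]
  simp only [hu', true_and]
  refine and_congr_right fun _ => ⟨fun H w hw hadj => ?_, fun H w hw hadj => ?_⟩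
  · refine H w ⟨(hω w ⟨edist_lt_succ hu hadj, σ.subset hw⟩).2 hw, ?_⟩ hadj
    rw [Finset.mem_coe, hΛ]
    exact fun h => h.2 (σ.subset hw)
  · have hwS : w ∈ σ.S := by
      by_contra hwS
      exact hw.2 (Finset.mem_coe.2 ((hΛ w).2 ⟨edist_lt_succ hu hadj, hwS⟩))
    exact H w ((hω w ⟨edist_lt_succ hu hadj, hwS⟩).1 hw.1) hadj

theorem infiniteSSM_of_nu_mul_lt_one {d : ℕ} (hd : 1 ≤ d) {lam lam' Δ' : ℝ} {Δ : ℝ≥0}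
    (hΔ : (Δ : ℝ) < Δ') (hpos : 0 < lam') (hle : lam' ≤ lam)
    (hν' : nu lam d * Δ' < 1) {G : SimpleGraph V} (hdeg : MaxDegreeLE G (d + 1))
    (hG : connectiveConstant G ≤ (Δ : ℝ≥0∞)) :
    InfiniteSSM G lam' (-Real.log √(nu lam d * Δ')) := by
  intro v
  have hlam := hpos.trans_le hle
  have hν := nu_pos lam d hlam hd
  have hΔ0 : 0 < Δ' := Δ.2.trans_lt hΔ
  obtain ⟨c, hc⟩ := infinite_sawCount_le hΔ hG v
  set κ := -Real.log √(nu lam d * Δ') with hκ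
  have hκ0 : 0 < κ := rate_pos hν hΔ0 hν'
  have hfin : ∀ v, (G.neighborSet v).Finite := fun v =>
    Set.finite_of_encard_le_coe (hdeg v)
  obtain ⟨nb, hnb⟩ : ∃ nb : V → List V, ∀ v u, u ∈ nb v ↔ G.Adj v u :=
    ⟨fun v => (hfin v).toFinset.toList, by simp⟩
  set C₁ := 4 * (1 + lam) * (psi lam * √((d + 1 : ℕ) * (|c| * Δ'))) with hC₁
  have hC₁0 : 0 ≤ C₁ := by
    have := psi_nonneg lam
    positivity
  -- The square is the Lipschitz constant from probabilities to ratios, the 1 covers ℓ < 2, and 2 C₁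
  -- appears because both measures are compared with a third value `p₀`.
  refine ⟨(1 + lam') ^ 2 * (1 + 2 * C₁) * Real.exp (κ * 2), ?_⟩
  intro l σ τ μ ν hμ hν₂ hdiff hvσ hvτ
  have hexp : Real.exp (κ * 2) * Real.exp (-(κ * l)) = Real.exp (-(κ * (l - 2))) := by
    rw [← Real.exp_add]; congr 1; ring
  rw [mul_assoc, hexp, mul_assoc]
  have hμ1 := measureReal_mem_le_one_sub hpos hμ hvσ
  have hν1 := measureReal_mem_le_one_sub hpos hν₂ hvτ
  refine (abs_div_one_sub_sub_le hpos hμ1 hν1).trans ?_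
  refine mul_le_mul_of_nonneg_left ?_ (by positivity)
  have hμ0 : 0 ≤ μ.real {ω | v ∈ ω} := MeasureTheory.measureReal_nonneg
  have hν0 : 0 ≤ ν.real {ω | v ∈ ω} := MeasureTheory.measureReal_nonneg
  rcases lt_or_ge l 2 with h2 | h2
  · have h2' : (l : ℝ) < 2 := by exact_mod_cast h2
    have h3 : 1 ≤ Real.exp (-(κ * (l - 2))) := Real.one_le_exp (by nlinarith)
    have h4 : |μ.real {ω | v ∈ ω} - ν.real {ω | v ∈ ω}| ≤ 1 := by
      have : 0 < 1 / (1 + lam') := by positivity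
      rw [abs_le]
      constructor <;> linarith
    nlinarith
  obtain ⟨k, rfl⟩ : ∃ k, l = k + 2 := ⟨l - 2, by omega⟩
  have h6 : ((k + 2 : ℕ) : ℝ) - 2 = k := by push_cast; ring
  rw [h6]
  have hvd : G.edist v v < (k + 2 : ℕ) := by simp
  by_cases hvS : v ∈ σ.S
  · rw [measureReal_mem_eq_zero hμ hvS hvσ,
      measureReal_mem_eq_zero hν₂ ((hdiff v hvd).1.1 hvS) hvτ, sub_self, abs_zero]
    positivity
  -- The free vertices at distance less than ℓ = k + 2. Both boundary conditions agree there, so the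
  -- same window is admissible for both.
  set Λ : Finset V := (finite_ball hnb v (k + 2)).toFinset.filter fun w => w ∉ σ.S with hΛ
  have hΛσ : ∀ w, w ∈ Λ ↔ G.edist v w < (k + 1 + 1 : ℕ) ∧ w ∉ σ.S := by
    intro w
    rw [hΛ, Finset.mem_filter, Set.Finite.mem_toFinset]
    rfl
  have hΛτ : ∀ w, w ∈ Λ ↔ G.edist v w < (k + 1 + 1 : ℕ) ∧ w ∉ τ.S := by
    intro w
    rw [hΛσ]
    exact and_congr_right fun hw => not_congr (hdiff w hw).1
  have hdσ : Disjoint (Λ : Set V) σ.S :=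
    Set.disjoint_left.2 fun w hw => ((hΛσ w).1 hw).2
  have hdτ : Disjoint (Λ : Set V) τ.S :=
    Set.disjoint_left.2 fun w hw => ((hΛτ w).1 hw).2
  have hvΛ : v ∈ Λ := (hΛσ v).2 ⟨hvd, hvS⟩
  have hstar : ∀ u, G.edist v u < (k + 1 : ℕ) → ((u ∉ τ.S ∧ ∀ w ∈ τ.I, ¬ G.Adj u w) ↔
      (u ∉ σ.S ∧ ∀ w ∈ σ.I, ¬ G.Adj u w)) := by
    intro u hu
    have hu' : G.edist v u < (k + 2 : ℕ) := hu.trans_le (by exact_mod_cast (by omega))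
    refine and_congr (not_congr (hdiff u hu').1.symm) ⟨fun H w hw hadj => ?_, fun H w hw hadj => ?_⟩
    · exact H w ((hdiff w (edist_lt_succ hu hadj)).2.1 hw) hadj
    · exact H w ((hdiff w (edist_lt_succ hu hadj)).2.2 hw) hadj
  have haeμ := ae_mem_unblocked_iff hnb hμ hΛσ
  have haeν := ae_mem_unblocked_iff hnb hν₂ hΛτ
  have := hμ.prob
  -- A typical configuration serves as reference: under either measure, almost every unblocked set
  -- agrees with that of `ω₀` near `v`.
  obtain ⟨ω₀, hω₀⟩ := haeμ.exists
  set p₀ := prob G lam' (unblocked G Λ ω₀) v with hp₀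
  set ε := C₁ * Real.exp (-(κ * k)) with hε
  have hclose : ∀ ω, (∀ u, G.edist v u < (k + 1 : ℕ) →
      (u ∈ unblocked G Λ ω ↔ u ∉ σ.S ∧ ∀ w ∈ σ.I, ¬ G.Adj u w)) →
      |prob G lam' (unblocked G Λ ω) v - p₀| ≤ ε := by
    intro ω hω
    refine (abs_prob_sub_le G hpos _ _ v).trans ?_
    refine (abs_ratio_sub_ratio_le hnb hd hdeg hpos hle k _ _ v fun w hw =>
      (hω w hw).trans (hω₀ w hw).symm).trans ?_
    have h5 := decay_le (d := d) hν hΔ0 (hc (k + 1))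
    calc _ ≤ 4 * (1 + lam) * (psi lam * (√((d + 1 : ℕ) * (|c| * Δ')) *
          Real.exp (-(κ * k)))) := by
          have := psi_nonneg lam
          gcongr
      _ = ε := by rw [hε, hC₁]; ring
  have hboundμ : ∀ᵐ ω ∂μ, |prob G lam' (unblocked G Λ ω) v - p₀| ≤ ε := haeμ.mono hclose
  have hboundν : ∀ᵐ ω ∂ν, |prob G lam' (unblocked G Λ ω) v - p₀| ≤ ε :=
    haeν.mono fun ω hω => hclose ω fun u hu => (hω u hu).trans (hstar u hu)
  have hp₀0 : 0 ≤ p₀ := prob_nonneg G hpos _ v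
  have hε0 : 0 ≤ ε := by positivity
  have e1 := measureReal_mem_le hpos hμ hdσ hvΛ (b := p₀ + ε) (by positivity)
    (hboundμ.mono fun ω h => by linarith [(abs_le.1 h).2])
  have e2 := le_measureReal_mem hpos hμ hdσ hvΛ (b := p₀ - ε)
    (hboundμ.mono fun ω h => by linarith [(abs_le.1 h).1])
  have e3 := measureReal_mem_le hpos hν₂ hdτ hvΛ (b := p₀ + ε) (by positivity)
    (hboundν.mono fun ω h => by linarith [(abs_le.1 h).2])
  have e4 := le_measureReal_mem hpos hν₂ hdτ hvΛ (b := p₀ - ε)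
    (hboundν.mono fun ω h => by linarith [(abs_le.1 h).1])
  have e5 : (1 + 2 * C₁) * Real.exp (-(κ * k)) = Real.exp (-(κ * k)) + 2 * ε := by
    rw [hε]; ring
  rw [e5]
  have := Real.exp_pos (-(κ * k))
  rw [abs_le]
  constructor <;> linarith

end Infinite

/-! ### The truncated recurrence in exact rational arithmetic -/

section Fractions

variable {V : Type u}

/-- The product of `1 + p / q` over the entries `u ∉ rem` of a list, where `(p, q)` is
`r (u :: rem) u` and the visited entries are added to `rem`. The result is the pair of the
denominator and the numerator. -/
def fracProd (r : List V → V → ℕ × ℕ) : List V → List V → ℕ × ℕ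
  | _, [] => (1, 1)
  | rem, u :: us =>
    if u ∈ rem then fracProd r rem us else
      ((r (u :: rem) u).2 * (fracProd r (u :: rem) us).1,
        ((r (u :: rem) u).1 + (r (u :: rem) u).2) * (fracProd r (u :: rem) us).2)

/-- The numerator and the denominator of the truncated recurrence at activity `ln / ld`. -/
def fracRatio (nb : V → List V) (ln ld : ℕ) : ℕ → List V → V → ℕ × ℕ
  | 0, _, _ => (0, 1)
  | k + 1, rem, u =>
    (ln * (fracProd (fracRatio nb ln ld k) rem (nb u)).1,
      ld * (fracProd (fracRatio nb ln ld k) rem (nb u)).2)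

/-- The number of recursive calls in the computation of `fracProd`, where `c` counts the calls made
for an entry. -/
def calls (c : List V → V → ℕ) : List V → List V → ℕ
  | _, [] => 1
  | rem, u :: us =>
    1 + if u ∈ rem then calls c rem us else c (u :: rem) u + calls c (u :: rem) us

/-- The number of recursive calls in the computation of `fracRatio`. -/
def ratioCalls (nb : V → List V) : ℕ → List V → V → ℕ
  | 0, _, _ => 0
  | k + 1, rem, u => calls (ratioCalls nb k) rem (nb u)

/-- The list `rem` stores the complement of the vertex set. The call for `u` receives `u :: rem`
because `treeRatio` erases the root before it visits the neighbours. -/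
theorem fracProd_eq [Fintype V] {r : List V → V → ℕ × ℕ} {s : Finset V → V → ℝ}
    (hs : ∀ A u, u ∉ A → s A u = 0)
    (h : ∀ rem u, u ∉ rem → 0 < (r (u :: rem) u).2 ∧
      ((r (u :: rem) u).1 : ℝ) / (r (u :: rem) u).2 = s (Finset.univ \ rem.toFinset) u)
    (rem l : List V) :
    0 < (fracProd r rem l).1 ∧ 0 < (fracProd r rem l).2 ∧
      ((fracProd r rem l).2 : ℝ) / (fracProd r rem l).1 =
        prodL s (Finset.univ \ rem.toFinset) l := by
  induction l generalizing rem with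
  | nil => simp [fracProd, prodL]
  | cons u us ih =>
    have herase : (Finset.univ \ rem.toFinset).erase u = Finset.univ \ (u :: rem).toFinset := by
      ext x; simp
    by_cases hu : u ∈ rem
    · have hu' : u ∉ Finset.univ \ rem.toFinset := by simpa using hu
      rw [prodL, hs _ _ hu', Finset.erase_eq_of_notMem hu']
      simpa [fracProd, hu] using ih rem
    · obtain ⟨h1, h2⟩ := h rem u hu
      obtain ⟨h3, h4, h5⟩ := ih (u :: rem)
      rw [prodL, herase, ← h5, ← h2]
      simp only [fracProd, hu, if_false]
      refine ⟨by positivity, by positivity, ?_⟩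
      have h1' : ((r (u :: rem) u).2 : ℝ) ≠ 0 := by exact_mod_cast h1.ne'
      have h3' : ((fracProd r (u :: rem) us).1 : ℝ) ≠ 0 := by exact_mod_cast h3.ne'
      push_cast
      field_simp
      ring

theorem fracRatio_eq [Fintype V] (nb : V → List V) {ln ld : ℕ} (hld : 0 < ld) (k : ℕ)
    (rem : List V) (u : V) (hu : u ∉ rem) :
    0 < (fracRatio nb ln ld k (u :: rem) u).2 ∧
      ((fracRatio nb ln ld k (u :: rem) u).1 : ℝ) / (fracRatio nb ln ld k (u :: rem) u).2 =
        treeRatio nb ((ln : ℝ) / ld) k (Finset.univ \ rem.toFinset) u := by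
  induction k generalizing rem u with
  | zero => simp [fracRatio, treeRatio]
  | succ k ih =>
    have hu' : u ∈ Finset.univ \ rem.toFinset := by simpa using hu
    have herase : (Finset.univ \ rem.toFinset).erase u = Finset.univ \ (u :: rem).toFinset := by
      ext x; simp
    obtain ⟨h1, h2, h3⟩ := fracProd_eq
      (fun _ _ => treeRatio_of_notMem nb ((ln : ℝ) / ld) k) ih (u :: rem) (nb u)
    rw [treeRatio, if_pos hu', herase, ← h3]
    simp only [fracRatio]
    refine ⟨by positivity, ?_⟩
    have h0' : (ld : ℝ) ≠ 0 := by exact_mod_cast hld.ne'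
    have h1' : ((fracProd (fracRatio nb ln ld k) (u :: rem) (nb u)).1 : ℝ) ≠ 0 := by
      exact_mod_cast h1.ne'
    have h2' : ((fracProd (fracRatio nb ln ld k) (u :: rem) (nb u)).2 : ℝ) ≠ 0 := by
      exact_mod_cast h2.ne'
    push_cast
    field_simp

theorem size_mul_le (a b : ℕ) : (a * b).size ≤ a.size + b.size := by
  rw [Nat.size_le, pow_add]
  exact Nat.mul_lt_mul'' (Nat.lt_size_self a) (Nat.lt_size_self b)

theorem size_add_le {a b s : ℕ} (ha : a.size ≤ s) (hb : b.size ≤ s) : (a + b).size ≤ s + 1 := by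
  rw [Nat.size_le] at ha hb ⊢
  rw [pow_succ]
  omega

/-- Bit lengths add under multiplication, so without any cancellation of common factors they stay
linear in the number of calls. The `+ 1` in the hypothesis pays for the carry in the sum of
numerator and denominator. -/
theorem size_fracProd_le {r : List V → V → ℕ × ℕ} {c : List V → V → ℕ} {L : ℕ} (hL : 1 ≤ L)
    (h : ∀ rem u, (r rem u).1.size + 1 ≤ L + L * c rem u ∧ (r rem u).2.size + 1 ≤ L + L * c rem u)
    (rem l : List V) :
    (fracProd r rem l).1.size ≤ L * calls c rem l ∧
      (fracProd r rem l).2.size ≤ L * calls c rem l := by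
  induction l generalizing rem with
  | nil => simpa [fracProd, calls] using hL
  | cons u us ih =>
    by_cases hu : u ∈ rem
    · simp only [fracProd, calls, hu, if_true]
      have := ih rem
      constructor <;> nlinarith
    · simp only [fracProd, calls, hu, if_false]
      obtain ⟨h1, h2⟩ := h (u :: rem) u
      obtain ⟨h3, h4⟩ := ih (u :: rem)
      have h5 : ((r (u :: rem) u).1 + (r (u :: rem) u).2).size ≤
          L * c (u :: rem) u + L - 1 + 1 := size_add_le (by omega) (by omega)
      have h6 := size_mul_le (r (u :: rem) u).2 (fracProd r (u :: rem) us).1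
      have h7 := size_mul_le ((r (u :: rem) u).1 + (r (u :: rem) u).2)
        (fracProd r (u :: rem) us).2
      rw [mul_add, mul_add, mul_one]
      constructor <;> omega

theorem size_fracRatio_le (nb : V → List V) {ln ld L : ℕ} (hL : 2 ≤ L) (hln : ln.size + 1 ≤ L)
    (hld : ld.size + 1 ≤ L) (k : ℕ) (rem : List V) (u : V) :
    (fracRatio nb ln ld k rem u).1.size + 1 ≤ L + L * ratioCalls nb k rem u ∧
      (fracRatio nb ln ld k rem u).2.size + 1 ≤ L + L * ratioCalls nb k rem u := by
  induction k generalizing rem u with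
  | zero => simp [fracRatio, ratioCalls]; omega
  | succ k ih =>
    obtain ⟨h1, h2⟩ := size_fracProd_le (by omega) ih rem (nb u)
    simp only [fracRatio, ratioCalls]
    have h3 := size_mul_le ln (fracProd (fracRatio nb ln ld k) rem (nb u)).1
    have h4 := size_mul_le ld (fracProd (fracRatio nb ln ld k) rem (nb u)).2
    constructor <;> omega

theorem calls_le [Fintype V] {c : List V → V → ℕ} {f : Finset V → V → ℕ}
    (hf : ∀ A B u, A ⊆ B → f A u ≤ f B u)
    (h : ∀ rem u, u ∈ rem → c rem u ≤ f (Finset.univ \ rem.toFinset) u) (rem l : List V) :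
    calls c rem l ≤ 1 + l.length +
      ∑ u ∈ l.toFinset ∩ (Finset.univ \ rem.toFinset), f (Finset.univ \ rem.toFinset) u := by
  refine le_trans ?_ (Nat.add_le_add_left (sum_scan_le hf (Finset.univ \ rem.toFinset) l) _)
  induction l generalizing rem with
  | nil => simp [calls]
  | cons u us ih =>
    by_cases hu : u ∈ rem
    · have hu' : u ∉ Finset.univ \ rem.toFinset := by simpa using hu
      simp only [calls, hu, if_true, scan, hu', if_false, List.length_cons]
      have := ih rem
      omega
    · have hu' : u ∈ Finset.univ \ rem.toFinset := by simpa using hu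
      have herase : (Finset.univ \ rem.toFinset).erase u = Finset.univ \ (u :: rem).toFinset := by
        ext x; simp
      simp only [calls, hu, if_false, scan, hu', if_true, List.length_cons, List.map_cons,
        List.sum_cons, herase]
      have h1 := ih (u :: rem)
      have h2 := h (u :: rem) u List.mem_cons_self
      have h3 : f (Finset.univ \ (u :: rem).toFinset) u ≤ f (Finset.univ \ rem.toFinset) u := by
        apply hf
        rw [← herase]
        exact Finset.erase_subset _ _
      omega

/-- Each node of the recursion tree scans a neighbour list of at most D entries and makes one final
call at its end, hence the factor 1 + D per self-avoiding walk. -/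
theorem ratioCalls_le [Fintype V] {nb : V → List V} {D : ℕ} (hD : ∀ v, (nb v).length ≤ D) (k : ℕ)
    (rem : List V) (u : V) (hu : u ∈ rem) :
    ratioCalls nb k rem u ≤
      (1 + D) * ∑ i ∈ Finset.range k, walkCount nb i (Finset.univ \ rem.toFinset) u := by
  induction k generalizing rem u with
  | zero => simp [ratioCalls]
  | succ k ih =>
    set A := Finset.univ \ rem.toFinset with hA
    have hu' : A.erase u = A := Finset.erase_eq_of_notMem (by simpa [hA] using hu)
    have h1 := calls_le (c := ratioCalls nb k)
      (f := fun A u => (1 + D) * ∑ i ∈ Finset.range k, walkCount nb i A u)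
      (fun A B u h => Nat.mul_le_mul_left _ (Finset.sum_le_sum fun i _ => walkCount_mono nb i h u))
      (fun rem u hu => ih rem u hu) rem (nb u)
    rw [← hA] at h1
    rw [ratioCalls, Finset.sum_range_succ']
    simp only [walkCount, hu']
    rw [Finset.sum_comm, mul_add, Finset.mul_sum, mul_one]
    have := hD u
    omega

theorem calls_le_of_sawCount_le [Fintype V] {G : SimpleGraph V} {nb : V → List V}
    (hnb : ∀ v u, u ∈ nb v ↔ G.Adj v u) {D : ℕ} (hD : ∀ v, (nb v).length ≤ D) (k : ℕ)
    (l : List V) {M : ℕ} (hM : ∀ v, ∑ i ∈ Finset.Icc 1 k, sawCount G v i ≤ M) :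
    calls (ratioCalls nb k) [] l ≤ 1 + l.length + Fintype.card V * ((1 + D) * (1 + M)) := by
  have h1 := calls_le (c := ratioCalls nb k)
      (f := fun A u => (1 + D) * ∑ i ∈ Finset.range k, walkCount nb i A u)
      (fun A B u h => Nat.mul_le_mul_left _ (Finset.sum_le_sum fun i _ => walkCount_mono nb i h u))
      (fun rem u hu => ratioCalls_le hD k rem u hu) [] l
  refine h1.trans (Nat.add_le_add_left ?_ _)
  refine (Finset.sum_le_card_nsmul _ _ ((1 + D) * (1 + M)) fun v _ => ?_).trans ?_
  · refine Nat.mul_le_mul_left _ ?_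
    cases k with
    | zero => simp
    | succ k =>
      rw [Finset.sum_range_succ']
      have h2 : ∑ i ∈ Finset.range k, walkCount nb (i + 1) (Finset.univ \ [].toFinset) v ≤ M := by
        calc _ ≤ ∑ i ∈ Finset.range (k + 1 - 1), sawCount G v (1 + i) :=
              Finset.sum_le_sum fun i _ => by
                rw [add_comm 1 i]
                exact walkCount_le_sawCount hnb (i + 1) _ v
          _ = ∑ i ∈ Finset.Ico 1 (k + 1), sawCount G v i :=
              (Finset.sum_Ico_eq_sum_range _ _ _).symm
          _ ≤ _ := Finset.sum_le_sum_of_subset fun i => by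
              simp only [Finset.mem_Ico, Finset.mem_Icc]; omega
          _ ≤ M := hM v
      simp only [walkCount] at h2 ⊢
      omega
  · rw [smul_eq_mul]
    exact Nat.mul_le_mul_right _ (Finset.card_le_univ _)

end Fractions

/-! ### Evaluation with an upper bound on the number of steps -/

/-- The expression `e` evaluates to `v` in at most `T` steps. -/
def Ev (P : Program) (O : ℕ → ℕ) (env : List Val) (e : Expr) (v : Val) (T : ℕ) : Prop :=
  ∃ t ≤ T, Eval P O env e v t

namespace Ev

variable {P : Program} {O : ℕ → ℕ} {env : List Val}

theorem mono {e : Expr} {v : Val} {T T' : ℕ} (h : Ev P O env e v T) (hT : T ≤ T') :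
    Ev P O env e v T' :=
  let ⟨t, ht, he⟩ := h
  ⟨t, ht.trans hT, he⟩

theorem var {i : ℕ} {v : Val} (h : env[i]? = some v) : Ev P O env (.var i) v 1 :=
  ⟨1, le_rfl, .var h⟩

theorem num (n : ℕ) : Ev P O env (.num n) (.num n) 1 := ⟨1, le_rfl, .num⟩

theorem pair {a b : Expr} {v w : Val} {S T : ℕ} (ha : Ev P O env a v S) (hb : Ev P O env b w T) :
    Ev P O env (.pair a b) (.pair v w) (S + T + 1) :=
  let ⟨s, hs, ha⟩ := ha
  let ⟨t, ht, hb⟩ := hb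
  ⟨s + t + 1, by omega, .pair ha hb⟩

theorem fst {a : Expr} {v w : Val} {T : ℕ} (ha : Ev P O env a (.pair v w) T) :
    Ev P O env (.fst a) v (T + 1) :=
  let ⟨t, ht, ha⟩ := ha
  ⟨t + 1, by omega, .fst ha⟩

theorem snd {a : Expr} {v w : Val} {T : ℕ} (ha : Ev P O env a (.pair v w) T) :
    Ev P O env (.snd a) w (T + 1) :=
  let ⟨t, ht, ha⟩ := ha
  ⟨t + 1, by omega, .snd ha⟩

theorem op {o : Op} {a b : Expr} {m n S T : ℕ} (ha : Ev P O env a (.num m) S)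
    (hb : Ev P O env b (.num n) T) :
    Ev P O env (.op o a b) (.num (o.apply m n)) (S + T + (m.size + 1) * (n.size + 1)) :=
  let ⟨s, hs, ha⟩ := ha
  let ⟨t, ht, hb⟩ := hb
  ⟨s + t + (m.size + 1) * (n.size + 1), by omega, .op ha hb⟩

theorem iteTrue {c a b : Expr} {u v : Val} {S T : ℕ} (hc : Ev P O env c u S) (hu : u ≠ .num 0)
    (ha : Ev P O env a v T) : Ev P O env (.ite c a b) v (S + T + 1) :=
  let ⟨s, hs, hc⟩ := hc
  let ⟨t, ht, ha⟩ := ha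
  ⟨s + t + 1, by omega, .iteTrue hc hu ha⟩

theorem iteFalse {c a b : Expr} {v : Val} {S T : ℕ} (hc : Ev P O env c (.num 0) S)
    (hb : Ev P O env b v T) : Ev P O env (.ite c a b) v (S + T + 1) :=
  let ⟨s, hs, hc⟩ := hc
  let ⟨t, ht, hb⟩ := hb
  ⟨s + t + 1, by omega, .iteFalse hc hb⟩

theorem letIn {a b : Expr} {u v : Val} {S T : ℕ} (ha : Ev P O env a u S)
    (hb : Ev P O (u :: env) b v T) : Ev P O env (.letIn a b) v (S + T + 1) :=
  let ⟨s, hs, ha⟩ := ha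
  let ⟨t, ht, hb⟩ := hb
  ⟨s + t + 1, by omega, .letIn ha hb⟩

theorem call {f : ℕ} {a body : Expr} {u v : Val} {S T : ℕ} (hf : P[f]? = some body)
    (ha : Ev P O env a u S) (hb : Ev P O [u] body v T) : Ev P O env (.call f a) v (S + T + 1) :=
  let ⟨s, hs, ha⟩ := ha
  let ⟨t, ht, hb⟩ := hb
  ⟨s + t + 1, by omega, .call hf ha hb⟩

theorem oracle {a : Expr} {k T : ℕ} (ha : Ev P O env a (.num k) T) :
    Ev P O env (.oracle a) (.num (O k)) (T + k + (O k).size + 1) :=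
  let ⟨t, ht, ha⟩ := ha
  ⟨t + k + (O k).size + 1, by omega, .oracle ha⟩

end Ev

/-! ### The program -/

/-- Is `x.1` an entry of the list `x.2`? -/
def memBody : Expr :=
  .ite (.snd (.var 0))
    (.ite (.op .eq (.fst (.var 0)) (.fst (.snd (.var 0)))) (.num 1)
      (.call 2 (.pair (.fst (.var 0)) (.snd (.snd (.var 0))))))
    (.num 0)

/-- The entry of the list `x.1` at the position `x.2`. -/
def nthBody : Expr :=
  .ite (.snd (.var 0))
    (.call 3 (.pair (.snd (.fst (.var 0))) (.op .sub (.snd (.var 0)) (.num 1))))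
    (.fst (.fst (.var 0)))

/-- The list `x - 1, …, 0`. -/
def rangeBody : Expr :=
  .ite (.var 0)
    (.letIn (.op .sub (.var 0) (.num 1)) (.pair (.var 0) (.call 4 (.var 0))))
    (.num 0)

/-- The power `2 ^ x`. -/
def powBody : Expr :=
  .ite (.var 0) (.op .mul (.num 2) (.call 5 (.op .sub (.var 0) (.num 1)))) (.num 1)

/-- The binary logarithm of `x`. -/
def logBody : Expr :=
  .ite (.op .lt (.var 0) (.num 2)) (.num 0)
    (.op .add (.num 1) (.call 6 (.op .div (.var 0) (.num 2))))

/-- The fraction `fracRatio` of the first entry of the list in a call of `loopBody`. -/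
def ratioExpr : Expr :=
  .ite (.snd (.snd (.snd (.var 0))))
    (.letIn
      (.call 1 (.pair (.fst (.var 0))
        (.pair (.pair (.fst (.fst (.snd (.snd (.var 0))))) (.fst (.snd (.var 0))))
          (.pair (.call 3 (.pair (.fst (.fst (.var 0))) (.fst (.fst (.snd (.snd (.var 0)))))))
            (.op .sub (.snd (.snd (.snd (.var 0)))) (.num 1))))))
      (.pair (.op .mul (.fst (.snd (.fst (.var 1)))) (.fst (.var 0)))
        (.op .mul (.snd (.snd (.fst (.var 1)))) (.snd (.var 0)))))
    (.pair (.num 0) (.num 1))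

/-- The rest of the product in a call of `loopBody`. -/
def restExpr : Expr :=
  .call 1 (.pair (.fst (.var 0))
    (.pair (.pair (.fst (.fst (.snd (.snd (.var 0))))) (.fst (.snd (.var 0))))
      (.pair (.snd (.fst (.snd (.snd (.var 0))))) (.snd (.snd (.snd (.var 0)))))))

/-- The fraction `fracProd`. The argument consists of the adjacency lists and the activity, the
removed vertices, a list of vertices, and the depth. -/
def loopBody : Expr :=
  .ite (.fst (.snd (.snd (.var 0))))
    (.ite (.call 2 (.pair (.fst (.fst (.snd (.snd (.var 0))))) (.fst (.snd (.var 0)))))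
      (.call 1 (.pair (.fst (.var 0)) (.pair (.fst (.snd (.var 0)))
        (.pair (.snd (.fst (.snd (.snd (.var 0))))) (.snd (.snd (.snd (.var 0))))))))
      (.letIn (.pair ratioExpr restExpr)
        (.pair
          (.op .mul (.snd (.fst (.var 0))) (.fst (.snd (.var 0))))
          (.op .mul (.op .add (.fst (.fst (.var 0))) (.snd (.fst (.var 0))))
            (.snd (.snd (.var 0)))))))
    (.pair (.num 1) (.num 1))

/-- The main function: the fraction `fracProd` for the list of all vertices, at depth
`K₁ (1 + log₂ (n + E))` and for an activity that is accurate up to `2 ^ (1 - (n + E + K₀))`. -/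
def mainBody (K₀ K₁ : ℕ) : Expr :=
  .letIn (.op .add (.op .add (.fst (.fst (.var 0))) (.snd (.var 0))) (.num K₀))
    (.letIn
      (.call 1 (.pair
        (.pair (.snd (.fst (.var 1)))
          (.pair (.op .sub (.oracle (.var 0)) (.num 1)) (.call 5 (.var 0))))
        (.pair (.num 0) (.pair (.call 4 (.fst (.fst (.var 1))))
          (.op .mul (.num K₁) (.op .add (.num 1)
            (.call 6 (.op .add (.fst (.fst (.var 1))) (.snd (.var 1))))))))))
      (.pair (.snd (.var 0)) (.fst (.var 0))))

def prog (K₀ K₁ : ℕ) : Program :=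
  [mainBody K₀ K₁, loopBody, memBody, nthBody, rangeBody, powBody, logBody]

/-! ### Correctness and cost of the auxiliary functions -/

section Aux

variable {K₀ K₁ : ℕ} {O : ℕ → ℕ}

theorem size_le_self (n : ℕ) : n.size ≤ n := Nat.size_le.2 Nat.lt_two_pow_self

/-- Lists of vertices as data. -/
def encList {n : ℕ} (l : List (Fin n)) : Val := Val.ofList (l.map fun j => Val.num j)

theorem ev_mem {n : ℕ} (u : Fin n) (l : List (Fin n)) :
    Ev (prog K₀ K₁) O [.pair (.num u) (encList l)] memBody (.num (if u ∈ l then 1 else 0))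
      ((l.length + 1) * (20 + (n + 1) ^ 2)) := by
  induction l with
  | nil =>
    refine (Ev.iteFalse (Ev.snd (Ev.var rfl)) (Ev.num 0)).mono ?_
    simp only [List.length_nil]
    nlinarith
  | cons w l ih =>
    have hsize : ((u : ℕ).size + 1) * ((w : ℕ).size + 1) ≤ (n + 1) ^ 2 := by
      rw [sq]
      have h1 := size_le_self u
      have h2 := size_le_self w
      exact Nat.mul_le_mul (by omega) (by omega)
    have hsnd : Ev (prog K₀ K₁) O [.pair (.num u) (encList (w :: l))] (.snd (.var 0))
      (.pair (.num w) (encList l)) 2 := Ev.snd (Ev.var rfl)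
    have heq : Ev (prog K₀ K₁) O [.pair (.num u) (encList (w :: l))] _ _ _ :=
      Ev.op (o := .eq) (Ev.fst (Ev.var (i := 0) rfl)) (Ev.fst hsnd)
    by_cases huw : u = w
    · subst huw
      rw [show Op.eq.apply (u : ℕ) u = 1 from if_pos rfl] at heq
      rw [if_pos List.mem_cons_self]
      refine (Ev.iteTrue hsnd (by simp) (Ev.iteTrue heq (by simp) (Ev.num 1))).mono ?_
      simp only [List.length_cons]
      nlinarith
    · rw [show Op.eq.apply (u : ℕ) w = 0 from if_neg fun h => huw (Fin.ext h)] at heq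
      have hmem : u ∈ w :: l ↔ u ∈ l := by simp [huw]
      simp only [hmem]
      refine (Ev.iteTrue hsnd (by simp) (Ev.iteFalse heq
        (Ev.call rfl (Ev.pair (Ev.fst (Ev.var rfl)) (Ev.snd hsnd)) ih))).mono ?_
      simp only [List.length_cons]
      nlinarith

theorem ev_nth (l : List Val) (i : ℕ) {v : Val} (h : l[i]? = some v) :
    Ev (prog K₀ K₁) O [.pair (Val.ofList l) (.num i)] nthBody v
      ((i + 1) * (20 + 2 * (i + 1))) := by
  induction i generalizing l with
  | zero =>
    cases l with
    | nil => simp at h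
    | cons w l =>
      obtain rfl : w = v := by simpa using h
      refine (Ev.iteFalse (Ev.snd (Ev.var rfl)) (Ev.fst (w := Val.ofList l) (Ev.fst (Ev.var rfl)))).mono ?_
      omega
  | succ i ih =>
    cases l with
    | nil => simp at h
    | cons w l =>
      have hl : l[i]? = some v := by simpa using h
      have hsub : Ev (prog K₀ K₁) O [.pair (Val.ofList (w :: l)) (.num (i + 1))] _ _ _ :=
        Ev.op (o := .sub) (Ev.snd (Ev.var (i := 0) rfl)) (Ev.num 1)
      rw [show Op.sub.apply (i + 1) 1 = i from rfl] at hsub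
      refine (Ev.iteTrue (Ev.snd (Ev.var rfl)) (by simp) (Ev.call rfl
        (Ev.pair (Ev.snd (v := w) (Ev.fst (Ev.var rfl))) hsub) (ih l hl))).mono ?_
      have h1 := size_le_self (i + 1)
      rw [Nat.size_one]
      nlinarith

theorem ev_range (n k : ℕ) (hk : k ≤ n) :
    Ev (prog K₀ K₁) O [.num k] rangeBody
      (encList (((List.finRange n).take k).reverse)) ((k + 1) * (20 + 2 * (k + 1))) := by
  induction k with
  | zero => exact (Ev.iteFalse (Ev.var rfl) (Ev.num 0)).mono (by omega)
  | succ k ih =>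
    have hsub : Ev (prog K₀ K₁) O [.num (k + 1)] _ _ _ :=
      Ev.op (o := .sub) (Ev.var (i := 0) rfl) (Ev.num 1)
    rw [show Op.sub.apply (k + 1) 1 = k from rfl] at hsub
    have hl : encList (((List.finRange n).take (k + 1)).reverse) =
        .pair (.num k) (encList (((List.finRange n).take k).reverse)) := by
      rw [List.take_add_one, List.reverse_append]
      have : (List.finRange n)[k]? = some ⟨k, hk⟩ := by
        rw [List.getElem?_eq_getElem (by simpa using hk)]
        simp
      rw [this]
      rfl
    rw [hl]
    refine (Ev.iteTrue (Ev.var rfl) (by simp) (Ev.letIn hsub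
      (Ev.pair (Ev.var rfl) (Ev.call rfl (Ev.var rfl) (ih (by omega)))))).mono ?_
    have h1 := size_le_self (k + 1)
    rw [Nat.size_one]
    nlinarith

theorem ev_pow (k : ℕ) :
    Ev (prog K₀ K₁) O [.num k] powBody (.num (2 ^ k)) ((k + 1) * (20 + 5 * (k + 1))) := by
  induction k with
  | zero => exact (Ev.iteFalse (Ev.var rfl) (Ev.num 1)).mono (by omega)
  | succ k ih =>
    have hsub : Ev (prog K₀ K₁) O [.num (k + 1)] _ _ _ :=
      Ev.op (o := .sub) (Ev.var (i := 0) rfl) (Ev.num 1)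
    rw [show Op.sub.apply (k + 1) 1 = k from rfl] at hsub
    have hmul : Ev (prog K₀ K₁) O [.num (k + 1)] _ _ _ :=
      Ev.op (o := .mul) (Ev.num 2) (Ev.call (f := 5) rfl hsub ih)
    rw [show Op.mul.apply 2 (2 ^ k) = 2 ^ (k + 1) from (pow_succ' 2 k).symm] at hmul
    refine (Ev.iteTrue (Ev.var rfl) (by simp) hmul).mono ?_
    have h1 := size_le_self (k + 1)
    have h2 : (2 ^ k).size = k + 1 := Nat.size_pow
    have h3 : (2 : ℕ).size = 2 := Nat.size_pow (n := 1)
    rw [Nat.size_one, h2, h3]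
    nlinarith

theorem ev_log (m : ℕ) :
    Ev (prog K₀ K₁) O [.num m] logBody (.num (Nat.log 2 m)) ((m + 1) * (30 + 6 * (m + 1))) := by
  have h3 : (2 : ℕ).size = 2 := Nat.size_pow (n := 1)
  induction m using Nat.strong_induction_on with
  | _ m ih =>
    have h1 := size_le_self m
    have hlt : Ev (prog K₀ K₁) O [.num m] _ _ _ :=
      Ev.op (o := .lt) (Ev.var (i := 0) rfl) (Ev.num 2)
    by_cases hm : m < 2
    · rw [show Op.lt.apply m 2 = 1 from if_pos hm] at hlt
      rw [Nat.log_of_lt hm]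
      refine (Ev.iteTrue hlt (by simp) (Ev.num 0)).mono ?_
      rw [h3]
      nlinarith
    · rw [show Op.lt.apply m 2 = 0 from if_neg hm] at hlt
      have hdiv : Ev (prog K₀ K₁) O [.num m] _ _ _ :=
        Ev.op (o := .div) (Ev.var (i := 0) rfl) (Ev.num 2)
      have hadd : Ev (prog K₀ K₁) O [.num m] _ _ _ :=
        Ev.op (o := .add) (Ev.num 1) (Ev.call (f := 6) rfl hdiv (ih (m / 2) (by omega)))
      have hlog : Op.add.apply 1 (Nat.log 2 (m / 2)) = Nat.log 2 m := by
        rw [Nat.log_of_one_lt_of_le one_lt_two (not_lt.1 hm), add_comm]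
        rfl
      rw [hlog] at hadd
      refine (Ev.iteFalse hlt hadd).mono ?_
      have h4 := size_le_self (Nat.log 2 (m / 2))
      have h5 : Nat.log 2 (m / 2) ≤ m / 2 := Nat.log_le_self _ _
      rw [Nat.size_one, h3]
      obtain ⟨q, hq⟩ : ∃ q, q = m / 2 := ⟨_, rfl⟩
      rw [← hq] at h4 h5 ⊢
      have h6 : 2 * q ≤ m := by omega
      have h7 : 1 ≤ q := by omega
      nlinarith

end Aux

/-! ### Correctness and cost of the recursion -/

section Loop

variable {K₀ K₁ : ℕ} {O : ℕ → ℕ} {n : ℕ}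

/-- The adjacency list of a vertex, in increasing order. -/
def adjList (G : SimpleGraph (Fin n)) (v : Fin n) : List (Fin n) :=
  (List.finRange n).filter fun j => G.Adj v j

theorem mem_adjList (G : SimpleGraph (Fin n)) (v u : Fin n) : u ∈ adjList G v ↔ G.Adj v u := by
  simp [adjList]

theorem nodup_adjList (G : SimpleGraph (Fin n)) (v : Fin n) : (adjList G v).Nodup :=
  (List.nodup_finRange n).filter _

/-- The adjacency lists as data. -/
def encAdj (G : SimpleGraph (Fin n)) : List Val :=
  (List.finRange n).map fun i => encList (adjList G i)

/-- The part of the argument of `loopBody` that does not change. -/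
def ctx (G : SimpleGraph (Fin n)) (ln ld : ℕ) : Val :=
  .pair (Val.ofList (encAdj G)) (.pair (.num ln) (.num ld))

/-- The argument of `loopBody`. -/
def loopArg (G : SimpleGraph (Fin n)) (ln ld : ℕ) (rem l : List (Fin n)) (k : ℕ) : Val :=
  .pair (ctx G ln ld) (.pair (encList rem) (.pair (encList l) (.num k)))

theorem ev_nth_adj (G : SimpleGraph (Fin n)) (u : Fin n) :
    Ev (prog K₀ K₁) O [.pair (Val.ofList (encAdj G)) (.num u)] nthBody (encList (adjList G u))
      ((n + 1) * (20 + 2 * (n + 1))) := by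
  refine (ev_nth (encAdj G) u (v := encList (adjList G u)) ?_).mono ?_
  · simp [encAdj]
  · have := u.2
    gcongr

/-- A bound for the cost of one recursive call when the numbers have at most `B` bits. -/
def callCost (n B : ℕ) : ℕ :=
  300 + (n + 1) * (20 + (n + 1) ^ 2) + (n + 1) * (20 + 2 * (n + 1)) + 10 * (B + 1) ^ 2

/-- At depth 0 the fraction is the constant 0 / 1 and no inner call is made, in accordance with
`ratioCalls` being 0 there. -/
theorem ev_ratioExpr {G : SimpleGraph (Fin n)} {ln ld k B T : ℕ} {rem us : List (Fin n)}
    {u : Fin n} (hk : k ≤ B) (hln : ln.size ≤ B) (hld : ld.size ≤ B)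
    (ih : ∀ k', k = k' + 1 →
      Ev (prog K₀ K₁) O [loopArg G ln ld (u :: rem) (adjList G u) k'] loopBody
        (.pair (.num (fracProd (fracRatio (adjList G) ln ld k') (u :: rem) (adjList G u)).1)
          (.num (fracProd (fracRatio (adjList G) ln ld k') (u :: rem) (adjList G u)).2)) T ∧
      (fracProd (fracRatio (adjList G) ln ld k') (u :: rem) (adjList G u)).1.size ≤ B ∧
      (fracProd (fracRatio (adjList G) ln ld k') (u :: rem) (adjList G u)).2.size ≤ B) :
    Ev (prog K₀ K₁) O [loopArg G ln ld rem (u :: us) k] ratioExpr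
      (.pair (.num (fracRatio (adjList G) ln ld k (u :: rem) u).1)
        (.num (fracRatio (adjList G) ln ld k (u :: rem) u).2))
      ((if k = 0 then 0 else T) + (80 + (n + 1) * (20 + 2 * (n + 1)) + 4 * (B + 1) ^ 2)) := by
  cases k with
  | zero =>
    refine (Ev.iteFalse (Ev.snd (Ev.snd (Ev.snd (Ev.var rfl)))) (Ev.pair (Ev.num 0) (Ev.num 1))).mono ?_
    rw [if_pos rfl]
    omega
  | succ k =>
    obtain ⟨h1, h2, h3⟩ := ih k rfl
    set a := (fracProd (fracRatio (adjList G) ln ld k) (u :: rem) (adjList G u)).1 with ha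
    set b := (fracProd (fracRatio (adjList G) ln ld k) (u :: rem) (adjList G u)).2 with hb
    have hsub : Ev (prog K₀ K₁) O [loopArg G ln ld rem (u :: us) (k + 1)] _ _ _ :=
      Ev.op (o := .sub) (Ev.snd (Ev.snd (Ev.snd (Ev.var (i := 0) rfl)))) (Ev.num 1)
    rw [show Op.sub.apply (k + 1) 1 = k from rfl] at hsub
    have hhead : Ev (prog K₀ K₁) O [loopArg G ln ld rem (u :: us) (k + 1)]
        (.fst (.fst (.snd (.snd (.var 0))))) (.num u) 5 :=
      Ev.fst (w := encList us) (Ev.fst (Ev.snd (Ev.snd (Ev.var rfl))))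
    refine (Ev.iteTrue (Ev.snd (Ev.snd (Ev.snd (Ev.var rfl)))) (by simp)
      (Ev.letIn (Ev.call rfl (Ev.pair (Ev.fst (Ev.var rfl)) (Ev.pair
        (Ev.pair hhead (Ev.fst (Ev.snd (Ev.var rfl))))
        (Ev.pair (Ev.call rfl (Ev.pair (Ev.fst (Ev.fst (Ev.var rfl))) hhead) (ev_nth_adj G u))
          hsub))) h1)
      (Ev.pair
        (Ev.op (m := ln) (n := a) (Ev.fst (Ev.snd (Ev.fst (Ev.var rfl)))) (Ev.fst (Ev.var rfl)))
        (Ev.op (m := ld) (n := b) (Ev.snd (Ev.snd (Ev.fst (Ev.var rfl)))) (Ev.snd (Ev.var rfl)))))).mono ?_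
    rw [if_neg (by omega), Nat.size_one]
    have h4 : (ln.size + 1) * (a.size + 1) ≤ (B + 1) ^ 2 := by
      rw [sq]; exact Nat.mul_le_mul (by omega) (by omega)
    have h5 : (ld.size + 1) * (b.size + 1) ≤ (B + 1) ^ 2 := by
      rw [sq]; exact Nat.mul_le_mul (by omega) (by omega)
    have h6 := size_le_self (k + 1)
    have h7 : ((k + 1).size + 1) * (1 + 1) ≤ 2 * (B + 1) ^ 2 := by nlinarith
    omega

/-- The recursion computes `fracProd` within `callCost` steps per recursive call. -/
theorem ev_loop (G : SimpleGraph (Fin n)) {ln ld L C B : ℕ} (hL : 2 ≤ L) (hln : ln.size + 1 ≤ L)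
    (hld : ld.size + 1 ≤ L) (hB : L + L * C ≤ B) (k : ℕ) (hk : k ≤ B) (rem l : List (Fin n))
    (hrem : rem.Nodup) (hC : calls (ratioCalls (adjList G) k) rem l ≤ C) :
    Ev (prog K₀ K₁) O [loopArg G ln ld rem l k] loopBody
      (.pair (.num (fracProd (fracRatio (adjList G) ln ld k) rem l).1)
        (.num (fracProd (fracRatio (adjList G) ln ld k) rem l).2))
      (calls (ratioCalls (adjList G) k) rem l * callCost n B) := by
  have hCW : ∀ {m}, m ≤ C → L + L * m ≤ B := fun h =>
    le_trans (Nat.add_le_add_left (Nat.mul_le_mul_left _ h) _) hB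
  -- The outer induction on the depth serves the calls for neighbour lists, the inner one on the
  -- list serves the rest of the product at the same depth.
  induction k using Nat.strong_induction_on generalizing rem l with
  | _ k ihk =>
  induction l generalizing rem with
  | nil =>
    refine (Ev.iteFalse (Ev.fst (Ev.snd (Ev.snd (Ev.var rfl))))
      (Ev.pair (Ev.num 1) (Ev.num 1))).mono ?_
    simp only [calls, callCost]
    omega
  | cons u us ih =>
    -- The removed vertices are distinct, which bounds the cost of the membership test.
    have hlen : rem.length ≤ n := by simpa using hrem.length_le_card
    have hmemcost : (rem.length + 1) * (20 + (n + 1) ^ 2) ≤ (n + 1) * (20 + (n + 1) ^ 2) :=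
      Nat.mul_le_mul_right _ (by omega)
    have hlst : Ev (prog K₀ K₁) O [loopArg G ln ld rem (u :: us) k] (.fst (.snd (.snd (.var 0))))
      (.pair (.num u) (encList us)) 4 := Ev.fst (Ev.snd (Ev.snd (Ev.var rfl)))
    have hrem' : Ev (prog K₀ K₁) O [loopArg G ln ld rem (u :: us) k] (.fst (.snd (.var 0)))
      (encList rem) 3 := Ev.fst (Ev.snd (Ev.var rfl))
    have hdep : Ev (prog K₀ K₁) O [loopArg G ln ld rem (u :: us) k] (.snd (.snd (.snd (.var 0))))
      (.num k) 4 := Ev.snd (Ev.snd (Ev.snd (Ev.var rfl)))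
    have hctx : Ev (prog K₀ K₁) O [loopArg G ln ld rem (u :: us) k] (.fst (.var 0))
      (ctx G ln ld) 2 := Ev.fst (Ev.var rfl)
    have hmem := Ev.call (f := 2) rfl (Ev.pair (Ev.fst hlst) hrem')
      (ev_mem (K₀ := K₀) (K₁ := K₁) (O := O) u rem)
    have hcost : callCost n B = 300 + (n + 1) * (20 + (n + 1) ^ 2) + (n + 1) * (20 + 2 * (n + 1)) +
      10 * (B + 1) ^ 2 := rfl
    by_cases hu : u ∈ rem
    · simp only [calls, hu, if_true] at hC hmem
      have h1 := ih rem hrem (by omega)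
      simp only [fracProd, calls, hu, if_true]
      refine (Ev.iteTrue hlst (by simp) (Ev.iteTrue hmem (by simp)
        (Ev.call rfl (Ev.pair hctx (Ev.pair hrem' (Ev.pair (Ev.snd hlst) hdep))) h1))).mono ?_
      clear h1 hmem
      generalize (rem.length + 1) * (20 + (n + 1) ^ 2) = m₁ at *
      generalize (n + 1) * (20 + (n + 1) ^ 2) = m₂ at *
      generalize (n + 1) * (20 + 2 * (n + 1)) = m₃ at *
      rw [add_mul, one_mul]
      omega
    · simp only [calls, hu, if_false] at hC hmem
      have hnd : (u :: rem).Nodup := List.nodup_cons.2 ⟨hu, hrem⟩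
      have h1 := ih (u :: rem) hnd (by omega)
      have h2 := ev_ratioExpr (K₀ := K₀) (K₁ := K₁) (O := O) (G := G) (us := us) (rem := rem)
        (u := u) (T := ratioCalls (adjList G) k (u :: rem) u * callCost n B)
        hk (by omega : ln.size ≤ B) (by omega : ld.size ≤ B) (by
          rintro k' rfl
          rw [ratioCalls] at hC ⊢
          obtain ⟨h3, h4⟩ := size_fracProd_le (by omega)
            (size_fracRatio_le (adjList G) hL hln hld k') (u :: rem) (adjList G u)
          have h5 := hCW (show calls (ratioCalls (adjList G) k') (u :: rem) (adjList G u) ≤ C by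
            omega)
          exact ⟨ihk k' (by omega) (by omega) _ _ hnd (by omega), by omega, by omega⟩)
      obtain ⟨h3, h4⟩ := size_fracProd_le (by omega)
        (size_fracRatio_le (adjList G) hL hln hld k) (u :: rem) us
      obtain ⟨h5, h6⟩ := size_fracRatio_le (adjList G) hL hln hld k (u :: rem) u
      have h7 := hCW (show ratioCalls (adjList G) k (u :: rem) u ≤ C by omega)
      have h8 := hCW (show calls (ratioCalls (adjList G) k) (u :: rem) us ≤ C by omega)
      simp only [fracProd, calls, hu, if_false]
      set p := (fracRatio (adjList G) ln ld k (u :: rem) u).1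
      set q := (fracRatio (adjList G) ln ld k (u :: rem) u).2
      set a := (fracProd (fracRatio (adjList G) ln ld k) (u :: rem) us).1
      set b := (fracProd (fracRatio (adjList G) ln ld k) (u :: rem) us).2
      have h9 : (p + q).size ≤ B - 1 + 1 := size_add_le (by omega) (by omega)
      refine (Ev.iteTrue hlst (by simp) (Ev.iteFalse hmem (Ev.letIn (Ev.pair h2
        (Ev.call rfl (Ev.pair hctx (Ev.pair (Ev.pair (Ev.fst hlst) hrem')
          (Ev.pair (Ev.snd hlst) hdep))) h1))
        (Ev.pair
          (Ev.op (m := q) (n := a) (Ev.snd (Ev.fst (Ev.var rfl))) (Ev.fst (Ev.snd (Ev.var rfl))))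
          (Ev.op (o := .mul) (m := p + q) (n := b)
            (Ev.op (o := .add) (m := p) (n := q) (Ev.fst (Ev.fst (Ev.var rfl)))
              (Ev.snd (Ev.fst (Ev.var rfl))))
            (Ev.snd (Ev.snd (Ev.var rfl)))))))).mono ?_
      have e1 : (q.size + 1) * (a.size + 1) ≤ (B + 1) ^ 2 := by
        rw [sq]; exact Nat.mul_le_mul (by omega) (by omega)
      have e2 : ((p + q).size + 1) * (b.size + 1) ≤ (B + 1) ^ 2 := by
        rw [sq]; exact Nat.mul_le_mul (by omega) (by omega)
      have e3 : (p.size + 1) * (q.size + 1) ≤ (B + 1) ^ 2 := by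
        rw [sq]; exact Nat.mul_le_mul (by omega) (by omega)
      have e4 : (if k = 0 then 0 else ratioCalls (adjList G) k (u :: rem) u * callCost n B) ≤
          ratioCalls (adjList G) k (u :: rem) u * callCost n B := by
        split_ifs <;> omega
      clear h1 hmem h2
      generalize (rem.length + 1) * (20 + (n + 1) ^ 2) = m₁ at *
      generalize (n + 1) * (20 + (n + 1) ^ 2) = m₂ at *
      generalize (n + 1) * (20 + 2 * (n + 1)) = m₃ at *
      generalize (q.size + 1) * (a.size + 1) = m₄ at *
      generalize ((p + q).size + 1) * (b.size + 1) = m₅ at *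
      generalize (p.size + 1) * (q.size + 1) = m₆ at *
      rw [add_mul, add_mul, one_mul]
      omega

end Loop

/-! ### The main function -/

section Main

variable {K₀ K₁ : ℕ} {O : ℕ → ℕ} {n : ℕ}

/-- A bound for the cost of the main function on inputs of size `N`, with at most `C` recursive
calls and an activity of at most `L` bits. -/
def mainCost (K₀ K₁ N L C : ℕ) : ℕ :=
  C * callCost N (L + L * C + K₁ * (1 + N)) + (N + 1) * (20 + 2 * (N + 1)) +
    (N + K₀ + 1) * (20 + 5 * (N + K₀ + 1)) + (N + 1) * (30 + 6 * (N + 1)) +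
    2 * ((N + 1) * (N + 1)) + (N + 1) * (K₀ + 1) + (K₁ + 1) * (N + 2) + (N + K₀) + 3 * L + 2 * N +
    100

theorem callCost_mono {n N B B' : ℕ} (h : n ≤ N) (hB : B ≤ B') : callCost n B ≤ callCost N B' := by
  unfold callCost
  gcongr

/-- The components are exchanged in the output because `fracProd` lists the denominator first. -/
theorem ev_main (G : SimpleGraph (Fin n)) {E L C : ℕ} (hL : (O (n + E + K₀)).size + 1 ≤ L)
    (hL' : n + E + K₀ + 2 ≤ L)
    (hC : calls (ratioCalls (adjList G) (K₁ * (1 + Nat.log 2 (n + E)))) [] (List.finRange n).reverse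
      ≤ C) :
    Ev (prog K₀ K₁) O [.pair (encodeGraph G) (.num E)] (.call 0 (.var 0))
      (.pair
        (.num (fracProd (fracRatio (adjList G) (O (n + E + K₀) - 1) (2 ^ (n + E + K₀))
          (K₁ * (1 + Nat.log 2 (n + E)))) [] (List.finRange n).reverse).2)
        (.num (fracProd (fracRatio (adjList G) (O (n + E + K₀) - 1) (2 ^ (n + E + K₀))
          (K₁ * (1 + Nat.log 2 (n + E)))) [] (List.finRange n).reverse).1))
      (mainCost K₀ K₁ (n + E) L C) := by
  obtain ⟨N, hN⟩ : ∃ N, N = n + E := ⟨_, rfl⟩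
  rw [← hN] at hL hL' hC ⊢
  set x : Val := .pair (encodeGraph G) (.num E) with hx
  set k := N + K₀ with hk
  set dep := K₁ * (1 + Nat.log 2 N) with hdep
  set ln := O k - 1 with hln
  set B := L + L * C + K₁ * (1 + N) with hB
  have hlog : Nat.log 2 N ≤ N := Nat.log_le_self _ _
  have hdepB : dep ≤ B := by
    have : dep ≤ K₁ * (1 + N) := Nat.mul_le_mul_left _ (by omega)
    omega
  have hlnsize : ln.size + 1 ≤ L := by
    have : ln.size ≤ (O k).size := Nat.size_le_size (Nat.sub_le _ _)
    omega
  have hldsize : (2 ^ k).size + 1 ≤ L := by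
    rw [Nat.size_pow]; omega
  have hloop := ev_loop (K₀ := K₀) (K₁ := K₁) (O := O) G (by omega) hlnsize hldsize
    (by omega : L + L * C ≤ B) dep hdepB [] (List.finRange n).reverse List.nodup_nil hC
  have hrange := ev_range (K₀ := K₀) (K₁ := K₁) (O := O) n n le_rfl
  rw [List.take_of_length_le (by simp)] at hrange
  have hn1 : Ev (prog K₀ K₁) O [x] (.fst (.fst (.var 0))) (.num n) 3 :=
    Ev.fst (w := Val.ofList (encAdj G)) (Ev.fst (Ev.var rfl))
  have hk1 : Ev (prog K₀ K₁) O [x] (.op .add (.op .add (.fst (.fst (.var 0))) (.snd (.var 0)))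
      (.num K₀)) (.num k) _ :=
    Ev.op (o := .add) (m := N) (by
      rw [hN]
      exact Ev.op (o := .add) (m := n) (n := E) hn1 (Ev.snd (Ev.var rfl))) (Ev.num K₀)
  have hn2 : Ev (prog K₀ K₁) O [.num k, x] (.fst (.fst (.var 1))) (.num n) 3 :=
    Ev.fst (w := Val.ofList (encAdj G)) (Ev.fst (Ev.var rfl))
  have hadj : Ev (prog K₀ K₁) O [.num k, x] (.snd (.fst (.var 1))) (.ofList (encAdj G)) 3 :=
    Ev.snd (v := .num n) (Ev.fst (Ev.var rfl))
  have hN2 : Ev (prog K₀ K₁) O [.num k, x] (.op .add (.fst (.fst (.var 1))) (.snd (.var 1)))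
      (.num N) (3 + (1 + 1) + (n.size + 1) * (E.size + 1)) := by
    rw [hN]
    exact Ev.op (o := .add) (m := n) (n := E) hn2 (Ev.snd (Ev.var rfl))
  have hdep2 : Ev (prog K₀ K₁) O [.num k, x] _ (.num dep) _ :=
    Ev.op (o := .mul) (Ev.num K₁) (Ev.op (o := .add) (Ev.num 1) (Ev.call (f := 6) rfl hN2 (ev_log N)))
  have hln2 : Ev (prog K₀ K₁) O [.num k, x] _ (.num ln) _ :=
    Ev.op (o := .sub) (Ev.oracle (Ev.var (i := 0) rfl)) (Ev.num 1)
  refine (Ev.call (f := 0) rfl (Ev.var rfl) (Ev.letIn hk1 (Ev.letIn (Ev.call (f := 1) rfl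
    (Ev.pair (Ev.pair hadj (Ev.pair hln2 (Ev.call (f := 5) rfl (Ev.var (i := 0) rfl) (ev_pow k))))
      (Ev.pair (Ev.num 0) (Ev.pair (Ev.call (f := 4) rfl hn2 hrange) hdep2))) hloop)
    (Ev.pair (Ev.snd (Ev.var rfl)) (Ev.fst (Ev.var rfl)))))).mono ?_
  have h1 := size_le_self n
  have h2 := size_le_self E
  have h3 := size_le_self N
  have h4 := size_le_self K₀
  have h5 := size_le_self K₁
  have h6 := size_le_self (Nat.log 2 N)
  have h7 := size_le_self (1 + Nat.log 2 N)
  have e1 : (n.size + 1) * (E.size + 1) ≤ (N + 1) * (N + 1) :=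
    Nat.mul_le_mul (by omega) (by omega)
  have e2 : (N.size + 1) * (K₀.size + 1) ≤ (N + 1) * (K₀ + 1) :=
    Nat.mul_le_mul (by omega) (by omega)
  have e3 : (K₁.size + 1) * ((1 + Nat.log 2 N).size + 1) ≤ (K₁ + 1) * (N + 2) :=
    Nat.mul_le_mul (by omega) (by omega)
  have e4 : calls (ratioCalls (adjList G) dep) [] (List.finRange n).reverse * callCost n B ≤
      C * callCost N B := Nat.mul_le_mul hC (callCost_mono (by omega) le_rfl)
  have e5 : (n + 1) * (20 + 2 * (n + 1)) ≤ (N + 1) * (20 + 2 * (N + 1)) :=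
    Nat.mul_le_mul (by omega) (by omega)
  have hcost : mainCost K₀ K₁ N L C = C * callCost N B + (N + 1) * (20 + 2 * (N + 1)) +
    (k + 1) * (20 + 5 * (k + 1)) + (N + 1) * (30 + 6 * (N + 1)) +
    2 * ((N + 1) * (N + 1)) + (N + 1) * (K₀ + 1) + (K₁ + 1) * (N + 2) + k + 3 * L + 2 * N + 100 := rfl
  rw [hcost, Nat.size_one]
  clear hloop hrange hk1 hN2 hdep2 hln2 hcost
  generalize (n.size + 1) * (E.size + 1) = m₁ at *
  generalize (N.size + 1) * (K₀.size + 1) = m₂ at *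
  generalize (K₁.size + 1) * ((1 + Nat.log 2 N).size + 1) = m₃ at *
  generalize calls (ratioCalls (adjList G) dep) [] (List.finRange n).reverse * callCost n B = m₄ at *
  generalize C * callCost N B = m₅ at *
  generalize (n + 1) * (20 + 2 * (n + 1)) = m₆ at *
  generalize (N + 1) * (20 + 2 * (N + 1)) = m₇ at *
  generalize (k + 1) * (20 + 5 * (k + 1)) = m₈ at *
  generalize (N + 1) * (30 + 6 * (N + 1)) = m₉ at *
  generalize (N + 1) * (N + 1) = m₁₀ at *
  generalize (N + 1) * (K₀ + 1) = m₁₁ at *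
  generalize (K₁ + 1) * (N + 2) = m₁₂ at *
  omega

end Main

/-! ### Polynomial bounds -/

section Poly

/-- `f` is bounded by a polynomial on the positive integers. -/
def PolyBdd (f : ℕ → ℕ) : Prop := ∃ K, ∀ N, 1 ≤ N → f N ≤ K * N ^ K

theorem PolyBdd.const (c : ℕ) : PolyBdd fun _ => c :=
  ⟨c, fun _ hN => Nat.le_mul_of_pos_right c (pow_pos hN c)⟩

theorem PolyBdd.id : PolyBdd fun N => N := ⟨1, fun N _ => by simp⟩

theorem PolyBdd.add {f g : ℕ → ℕ} (hf : PolyBdd f) (hg : PolyBdd g) :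
    PolyBdd fun N => f N + g N := by
  obtain ⟨K, hK⟩ := hf
  obtain ⟨M, hM⟩ := hg
  refine ⟨K + M, fun N hN => ?_⟩
  have h1 : N ^ K ≤ N ^ (K + M) := Nat.pow_le_pow_right hN (by omega)
  have h2 : N ^ M ≤ N ^ (K + M) := Nat.pow_le_pow_right hN (by omega)
  calc f N + g N ≤ K * N ^ K + M * N ^ M := Nat.add_le_add (hK N hN) (hM N hN)
    _ ≤ K * N ^ (K + M) + M * N ^ (K + M) := by gcongr
    _ = _ := by ring

theorem PolyBdd.mul {f g : ℕ → ℕ} (hf : PolyBdd f) (hg : PolyBdd g) :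
    PolyBdd fun N => f N * g N := by
  obtain ⟨K, hK⟩ := hf
  obtain ⟨M, hM⟩ := hg
  refine ⟨K * M + K + M, fun N hN => ?_⟩
  calc f N * g N ≤ (K * N ^ K) * (M * N ^ M) := Nat.mul_le_mul (hK N hN) (hM N hN)
    _ = (K * M) * N ^ (K + M) := by rw [pow_add]; ring
    _ ≤ (K * M + K + M) * N ^ (K * M + K + M) :=
      Nat.mul_le_mul (by omega) (Nat.pow_le_pow_right hN (by omega))

theorem PolyBdd.pow {f : ℕ → ℕ} (hf : PolyBdd f) (j : ℕ) : PolyBdd fun N => f N ^ j := by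
  induction j with
  | zero => simpa using PolyBdd.const 1
  | succ j ih => simpa only [pow_succ] using ih.mul hf

theorem PolyBdd.mainCost (K₀ K₁ : ℕ) {L C : ℕ → ℕ} (hL : PolyBdd L) (hC : PolyBdd C) :
    PolyBdd fun N => mainCost K₀ K₁ N (L N) (C N) := by
  have hid := PolyBdd.id
  have h1 : ∀ c, PolyBdd fun N => N + c := fun c => hid.add (.const c)
  have hB : PolyBdd fun N => L N + L N * C N + K₁ * (1 + N) :=
    (hL.add (hL.mul hC)).add ((const K₁).mul ((const 1).add hid))
  have hcall : PolyBdd fun N => callCost N (L N + L N * C N + K₁ * (1 + N)) :=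
    (((const 300).add ((h1 1).mul ((const 20).add ((h1 1).pow 2)))).add
      ((h1 1).mul ((const 20).add ((const 2).mul (h1 1))))).add
      ((const 10).mul ((hB.add (.const 1)).pow 2))
  exact ((((((((((hC.mul hcall).add ((h1 1).mul ((const 20).add ((const 2).mul (h1 1))))).add
    (((h1 K₀).add (.const 1)).mul ((const 20).add ((const 5).mul ((h1 K₀).add (.const 1)))))).add
    ((h1 1).mul ((const 30).add ((const 6).mul (h1 1))))).add
    ((const 2).mul ((h1 1).mul (h1 1)))).add ((h1 1).mul (.const (K₀ + 1)))).add
    ((const (K₁ + 1)).mul (h1 2))).add (h1 K₀)).add ((const 3).mul hL)).add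
    ((const 2).mul hid)).add (.const 100)

end Poly

/-! ### Accuracy of the output -/

section Accuracy

variable {V : Type u}

/-- Since 1 + r ≥ 1, an additive error η in r is a relative error of at most η in each factor. -/
theorem prodL_close {r s : Finset V → V → ℝ} {η : ℝ} (hη : η ≤ 1) (hr : ∀ A u, 0 ≤ r A u)
    (hs : ∀ A u, 0 ≤ s A u) (h : ∀ A u, |r A u - s A u| ≤ η) (A : Finset V) (l : List V) :
    (1 - η) ^ l.length * prodL r A l ≤ prodL s A l ∧
      prodL s A l ≤ (1 + η) ^ l.length * prodL r A l := by
  induction l generalizing A with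
  | nil => simp [prodL]
  | cons u us ih =>
    obtain ⟨h1, h2⟩ := ih (A.erase u)
    have h3 := abs_le.1 (h A u)
    have h4 := hr A u
    have h5 := hs A u
    have h6 := one_le_prodL hr (A.erase u) us
    have h7 := one_le_prodL hs (A.erase u) us
    have hη0 : 0 ≤ η := (abs_nonneg _).trans (h A u)
    have h8 : (1 - η) * (1 + r A u) ≤ 1 + s A u := by nlinarith
    have h9 : 1 + s A u ≤ (1 + η) * (1 + r A u) := by nlinarith
    simp only [prodL, List.length_cons, pow_succ]
    constructor
    · calc _ = ((1 - η) * (1 + r A u)) * ((1 - η) ^ us.length * prodL r (A.erase u) us) := by ring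
        _ ≤ (1 + s A u) * prodL s (A.erase u) us := by
          apply mul_le_mul h8 h1 _ (by linarith)
          have : 0 ≤ 1 - η := by linarith
          positivity
    · calc _ ≤ ((1 + η) * (1 + r A u)) * ((1 + η) ^ us.length * prodL r (A.erase u) us) := by
            apply mul_le_mul h9 h2 (by linarith) (by positivity)
        _ = _ := by ring

theorem prodL_ratio_univ [Fintype V] (G : SimpleGraph V) {lam : ℝ} (hpos : 0 < lam) (l : List V)
    (hl : ∀ v, v ∈ l) : prodL (ratio G lam) Finset.univ l = Z G lam Finset.univ := by
  have : Finset.univ \ l.toFinset = ∅ := by ext x; simp [hl]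
  rw [prodL_ratio G hpos, this, Z_empty, div_one]

theorem Z_le_of_activity_le (G : SimpleGraph V) {lam₁ lam₂ : ℝ} (h1 : 0 ≤ lam₁)
    (h : lam₁ ≤ lam₂) (A : Finset V) : Z G lam₁ A ≤ Z G lam₂ A := by
  refine Finset.sum_le_sum fun I _ => ?_
  split_ifs
  · exact pow_le_pow_left₀ h1 h _
  · exact le_rfl

/-- An independent set has at most |A| vertices, so its weight loses at most a factor (1 - δ) ^ |A|.
-/
theorem pow_mul_Z_le (G : SimpleGraph V) {lam₁ lam₂ δ : ℝ} (hδ0 : 0 ≤ δ) (hδ : δ ≤ 1)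
    (h2 : 0 ≤ lam₂) (h : (1 - δ) * lam₂ ≤ lam₁) (A : Finset V) :
    (1 - δ) ^ A.card * Z G lam₂ A ≤ Z G lam₁ A := by
  have h0 : 0 ≤ 1 - δ := by linarith
  rw [Z, Z, Finset.mul_sum]
  refine Finset.sum_le_sum fun I hI => ?_
  split_ifs
  · calc (1 - δ) ^ A.card * lam₂ ^ I.card ≤ (1 - δ) ^ I.card * lam₂ ^ I.card := by
          refine mul_le_mul_of_nonneg_right ?_ (by positivity)
          exact pow_le_pow_of_le_one h0 (by linarith)
            (Finset.card_le_card (Finset.mem_powerset.1 hI))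
      _ = ((1 - δ) * lam₂) ^ I.card := (mul_pow _ _ _).symm
      _ ≤ lam₁ ^ I.card := pow_le_pow_left₀ (by positivity) h _
  · simp

theorem one_sub_le_pow {η ε : ℝ} {n : ℕ} (hη : η ≤ 1) (h : n * η ≤ ε / 4) :
    1 - ε / 4 ≤ (1 - η) ^ n := by
  have := one_add_mul_le_pow (a := -η) (by linarith) n
  rw [← sub_eq_add_neg] at this
  linarith

theorem pow_le_one_add {η ε : ℝ} {n : ℕ} (hη : 0 ≤ η) (hε0 : 0 ≤ ε) (hε : ε ≤ 1)
    (h : n * η ≤ ε / 4) : (1 + η) ^ n ≤ 1 + ε := by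
  have h1 : (1 + η) ^ n ≤ Real.exp (n * η) := by
    rw [Real.exp_nat_mul]
    exact pow_le_pow_left₀ (by linarith) (by linarith [Real.add_one_le_exp η]) n
  have h2 : Real.exp (n * η) ≤ Real.exp (ε / 4) := Real.exp_le_exp.2 h
  have h3 := Real.add_one_le_exp (-(ε / 4))
  have h4 : Real.exp (ε / 4) * Real.exp (-(ε / 4)) = 1 := by
    rw [← Real.exp_add]; simp
  have h5 := Real.exp_pos (ε / 4)
  nlinarith

/-- Two errors enter: truncation, in both directions, and the activity, which is only rounded down.
Hence the upper bound needs one factor and the lower bound two, each of them at least 1 - ε / 4. -/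
theorem approx_partitionFunction {n : ℕ} {G : SimpleGraph (Fin n)} {lam' ε η δ : ℝ}
    {ln ld dep : ℕ} (hln : 0 < ln) (hld : 0 < ld) (hle : (ln : ℝ) / ld ≤ lam')
    (hge : (1 - δ) * lam' ≤ (ln : ℝ) / ld) (hδ0 : 0 ≤ δ) (hδ1 : δ ≤ 1) (hη0 : 0 ≤ η) (hη1 : η ≤ 1)
    (hε0 : 0 ≤ ε) (hε1 : ε ≤ 1) (hδ : n * δ ≤ ε / 4) (hη : n * η ≤ ε / 4)
    (h : ∀ A v, |ratio G ((ln : ℝ) / ld) A v - treeRatio (adjList G) ((ln : ℝ) / ld) dep A v| ≤ η) :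
    let z := fracProd (fracRatio (adjList G) ln ld dep) [] (List.finRange n).reverse
    0 < z.1 ∧ (1 - ε) * partitionFunction G lam' ≤ (z.2 : ℝ) / z.1 ∧
      (z.2 : ℝ) / z.1 ≤ (1 + ε) * partitionFunction G lam' := by
  intro z
  set lam₁ : ℝ := (ln : ℝ) / ld with hlam₁
  have hpos : 0 < lam₁ := by positivity
  obtain ⟨hz, -, heq⟩ := fracProd_eq (fun _ _ => treeRatio_of_notMem (adjList G) lam₁ dep)
    (fracRatio_eq (adjList G) hld dep) [] (List.finRange n).reverse
  refine ⟨hz, ?_⟩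
  rw [heq]
  obtain ⟨h1, h2⟩ := prodL_close hη1 (ratio_nonneg G hpos) (treeRatio_nonneg (adjList G) hpos dep) h
    (Finset.univ \ [].toFinset) (List.finRange n).reverse
  have hZ : prodL (ratio G lam₁) (Finset.univ \ [].toFinset) (List.finRange n).reverse =
      Z G lam₁ Finset.univ := by
    rw [List.toFinset_nil, Finset.sdiff_empty]
    exact prodL_ratio_univ G hpos _ (by simp)
  rw [hZ, List.length_reverse, List.length_finRange] at h1 h2
  rw [partitionFunction_eq_Z]
  have h3 := Z_le_of_activity_le G hpos.le hle Finset.univ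
  have h4 := pow_mul_Z_le G hδ0 hδ1 (hpos.le.trans hle) hge Finset.univ
  rw [Finset.card_univ, Fintype.card_fin] at h4
  have h5 := one_sub_le_pow hδ1 hδ
  have h6 := one_sub_le_pow hη1 hη
  have h7 := pow_le_one_add hη0 hε0 hε1 hη
  have hZ0 := Z_pos G (hpos.trans_le hle) Finset.univ
  have hZ1 := Z_pos G hpos Finset.univ
  constructor
  · calc (1 - ε) * Z G lam' Finset.univ
        ≤ ((1 - ε / 4) * (1 - ε / 4)) * Z G lam' Finset.univ := by
          refine mul_le_mul_of_nonneg_right ?_ hZ0.le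
          nlinarith
      _ ≤ ((1 - η) ^ n * (1 - δ) ^ n) * Z G lam' Finset.univ := by
          refine mul_le_mul_of_nonneg_right ?_ hZ0.le
          exact mul_le_mul h6 h5 (by linarith) (pow_nonneg (by linarith) _)
      _ = (1 - η) ^ n * ((1 - δ) ^ n * Z G lam' Finset.univ) := by ring
      _ ≤ (1 - η) ^ n * Z G lam₁ Finset.univ :=
          mul_le_mul_of_nonneg_left h4 (pow_nonneg (by linarith) _)
      _ ≤ _ := h1
  · calc _ ≤ (1 + η) ^ n * Z G lam₁ Finset.univ := h2
      _ ≤ (1 + ε) * Z G lam' Finset.univ := mul_le_mul h7 h3 hZ1.le (by linarith)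

end Accuracy

/-! ### The approximation scheme -/

section Scheme

theorem log_le_one_add_log {N : ℕ} (hN : 1 ≤ N) : Real.log N ≤ ((1 + Nat.log 2 N : ℕ) : ℝ) := by
  have h1 : N < 2 ^ (Nat.log 2 N).succ := Nat.lt_pow_succ_log_self one_lt_two N
  have h2 : (N : ℝ) ≤ (2 : ℝ) ^ (1 + Nat.log 2 N) := by
    rw [add_comm]
    exact_mod_cast h1.le
  have h3 : Real.log N ≤ ((1 + Nat.log 2 N : ℕ) : ℝ) * Real.log 2 := by
    rw [← Real.log_pow]
    exact Real.log_le_log (by exact_mod_cast hN) h2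
  have h4 : Real.log 2 ≤ 1 := by linarith [Real.log_two_lt_d9]
  calc _ ≤ _ := h3
    _ ≤ ((1 + Nat.log 2 N : ℕ) : ℝ) * 1 := by gcongr
    _ = _ := mul_one _

/-- At depth `K₁ (1 + log₂ N)` the truncation error is at most `1 / (4 N²)`. -/
theorem truncation_error_le {κ C₀ : ℝ} {K₁ N dep : ℕ} (hN : 1 ≤ N)
    (hK₁ : 2 + 4 * C₀ * Real.exp κ ≤ κ * K₁) (hC₀ : 0 ≤ C₀)
    (hdep : dep + 1 = K₁ * (1 + Nat.log 2 N)) :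
    C₀ * Real.exp (-(κ * dep)) ≤ 1 / (4 * (N : ℝ) ^ 2) := by
  set s := 4 * C₀ * Real.exp κ with hs
  have hs0 : 0 ≤ s := by positivity
  have hN0 : (0 : ℝ) < N := by exact_mod_cast hN
  have hd : (dep : ℝ) + 1 = K₁ * (1 + Nat.log 2 N : ℕ) := by exact_mod_cast hdep
  have hl := log_le_one_add_log hN
  have hl1 : (1 : ℝ) ≤ (1 + Nat.log 2 N : ℕ) := by exact_mod_cast Nat.le_add_right 1 _
  -- The 2 in the choice of K₁ yields the decay N ^ (-2); the summand `s` yields exp (-s), which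
  -- absorbs the constant C₀ through s exp (-s) ≤ 1.
  have h1 : s + 2 * Real.log N ≤ κ * (dep + 1) := by
    rw [hd, ← mul_assoc]
    nlinarith
  have h2 : Real.exp (-(κ * (dep + 1))) ≤ Real.exp (-(s + 2 * Real.log N)) :=
    Real.exp_le_exp.2 (by linarith)
  have h3 : Real.exp (-(s + 2 * Real.log N)) = Real.exp (-s) / (N : ℝ) ^ 2 := by
    rw [neg_add, Real.exp_add, Real.exp_neg (2 * _), two_mul, Real.exp_add, Real.exp_log hN0]
    field_simp
  have h4 : s * Real.exp (-s) ≤ 1 := by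
    have h5 := Real.add_one_le_exp s
    have h6 : Real.exp s * Real.exp (-s) = 1 := by rw [← Real.exp_add]; simp
    have h7 := Real.exp_pos (-s)
    nlinarith
  have h5 : Real.exp (-(κ * dep)) = Real.exp κ * Real.exp (-(κ * (dep + 1))) := by
    rw [← Real.exp_add]; congr 1; ring
  have hN2 : (0 : ℝ) < (N : ℝ) ^ 2 := by positivity
  calc C₀ * Real.exp (-(κ * dep)) = s / 4 * Real.exp (-(κ * (dep + 1))) := by rw [h5, hs]; ring
    _ ≤ s / 4 * (Real.exp (-s) / (N : ℝ) ^ 2) := by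
      rw [← h3]
      gcongr
    _ = (s * Real.exp (-s)) / (4 * (N : ℝ) ^ 2) := by field_simp
    _ ≤ 1 / (4 * (N : ℝ) ^ 2) := by gcongr

/-- The number of self-avoiding walks up to logarithmic length is polynomial. -/
theorem pow_log_le {J K₁ N : ℕ} (hN : 1 ≤ N) :
    (2 ^ J) ^ (K₁ * (1 + Nat.log 2 N)) ≤ (2 * N) ^ (J * K₁) := by
  have h1 : 2 ^ Nat.log 2 N ≤ N := Nat.pow_log_le_self 2 (by omega)
  calc (2 ^ J) ^ (K₁ * (1 + Nat.log 2 N)) = (2 * 2 ^ Nat.log 2 N) ^ (J * K₁) := by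
        rw [← pow_succ', ← pow_mul, ← pow_mul]
        congr 1
        ring
    _ ≤ _ := Nat.pow_le_pow_left (Nat.mul_le_mul_left 2 h1) _

theorem sum_sawCount_le {F : FiniteFamily} {a c : ℝ} {Δ : ℝ≥0} (hF : ConnectiveConstantLEWith F Δ a c)
    {G : Σ n : ℕ, SimpleGraph (Fin n)} (hG : G ∈ F) {J K₁ N : ℕ} (hΔ : (Δ : ℝ) ≤ 2 ^ J)
    (hN : 1 ≤ N) (hl : a * Real.log G.1 ≤ (K₁ * (1 + Nat.log 2 N) : ℕ)) (v : Fin G.1) :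
    ∑ i ∈ Finset.Icc 1 (K₁ * (1 + Nat.log 2 N)), sawCount G.2 v i ≤
      ⌈|c|⌉₊ * (2 * N) ^ (J * K₁) := by
  refine le_trans ?_ (Nat.mul_le_mul_left _ (pow_log_le (J := J) (K₁ := K₁) hN))
  have h1 := hF G hG v _ hl
  have h2 : c * (Δ : ℝ) ^ (K₁ * (1 + Nat.log 2 N)) ≤
      ⌈|c|⌉₊ * (2 ^ J) ^ (K₁ * (1 + Nat.log 2 N)) := by
    apply mul_le_mul ((le_abs_self c).trans (Nat.le_ceil _)) _ (by positivity) (by positivity)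
    exact pow_le_pow_left₀ Δ.2 hΔ _
  exact_mod_cast h1.trans h2

theorem size_oracle_le {O : ℕ → ℕ} {lam' : ℝ} {k : ℕ}
    (hO : |lam' - (O k : ℝ) / 2 ^ k| ≤ 1 / 2 ^ k) : (O k).size ≤ k + (⌈lam'⌉₊ + 1) := by
  have h2 : (0 : ℝ) < 2 ^ k := by positivity
  have h3 : (O k : ℝ) ≤ 2 ^ k * (⌈lam'⌉₊ + 1 : ℕ) := by
    have h4 : (O k : ℝ) / 2 ^ k ≤ lam' + 1 / 2 ^ k := by linarith [(abs_le.1 hO).1]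
    have h5 : (1 : ℝ) / 2 ^ k ≤ 1 := by
      rw [div_le_one h2]
      exact one_le_pow₀ one_le_two
    rw [div_le_iff₀ h2] at h4
    have h6 := Nat.le_ceil lam'
    push_cast
    calc (O k : ℝ) ≤ (lam' + 1 / 2 ^ k) * 2 ^ k := h4
      _ ≤ ((⌈lam'⌉₊ : ℝ) + 1) * 2 ^ k := by gcongr
      _ = _ := by ring
  rw [Nat.size_le, pow_add]
  have h4 : O k ≤ 2 ^ k * (⌈lam'⌉₊ + 1) := by exact_mod_cast h3
  exact h4.trans_lt (Nat.mul_lt_mul_of_pos_left Nat.lt_two_pow_self (by positivity))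

/-- Subtracting 1 from the answer makes the approximate activity at most λ', so that the contraction
estimates for activities up to λ apply to it. -/
theorem oracle_bounds {O : ℕ → ℕ} {lam' : ℝ} (hpos : 0 < lam') {n E K₀ : ℕ}
    (hK₀ : 8 / lam' ≤ 2 ^ K₀) (hE : 1 ≤ E)
    (hO : |lam' - (O (n + E + K₀) : ℝ) / 2 ^ (n + E + K₀)| ≤ 1 / 2 ^ (n + E + K₀)) :
    0 < O (n + E + K₀) - 1 ∧
      ((O (n + E + K₀) - 1 : ℕ) : ℝ) / (2 ^ (n + E + K₀) : ℕ) ≤ lam' ∧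
      ∃ δ : ℝ, 0 ≤ δ ∧ δ ≤ 1 ∧ n * δ ≤ 1 / E / 4 ∧
        (1 - δ) * lam' ≤ ((O (n + E + K₀) - 1 : ℕ) : ℝ) / (2 ^ (n + E + K₀) : ℕ) := by
  set k := n + E + K₀ with hk
  have h2 : (0 : ℝ) < 2 ^ k := by positivity
  have hE' : (1 : ℝ) ≤ E := by exact_mod_cast hE
  have hnE : ((n : ℝ) + 1) * E ≤ 2 ^ (n + E) := by
    have h3 : n + 1 ≤ 2 ^ n := Nat.lt_two_pow_self
    have h4 : E ≤ 2 ^ E := Nat.lt_two_pow_self.le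
    rw [pow_add]
    exact_mod_cast Nat.mul_le_mul h3 h4
  have h8 : 8 * (((n : ℝ) + 1) * E) ≤ lam' * 2 ^ k := by
    rw [div_le_iff₀ hpos] at hK₀
    rw [hk, pow_add]
    calc 8 * (((n : ℝ) + 1) * E) ≤ (2 ^ K₀ * lam') * 2 ^ (n + E) := by gcongr
      _ = _ := by ring
  have hn0 : (0 : ℝ) ≤ n := Nat.cast_nonneg n
  have h8' : 8 ≤ lam' * 2 ^ k := by nlinarith
  obtain ⟨hO1, hO2⟩ := abs_le.1 hO
  have h3 : lam' * 2 ^ k - 1 ≤ O k := by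
    have : lam' - 1 / 2 ^ k ≤ (O k : ℝ) / 2 ^ k := by linarith
    rw [le_div_iff₀ h2, sub_mul, one_div_mul_cancel h2.ne'] at this
    exact this
  have h4 : (O k : ℝ) ≤ lam' * 2 ^ k + 1 := by
    have : (O k : ℝ) / 2 ^ k ≤ lam' + 1 / 2 ^ k := by linarith
    rw [div_le_iff₀ h2, add_mul, one_div_mul_cancel h2.ne'] at this
    exact this
  have h5 : 2 ≤ O k := by
    have : (2 : ℝ) ≤ O k := by linarith
    exact_mod_cast this
  have hcast : ((O k - 1 : ℕ) : ℝ) = O k - 1 := by rw [Nat.cast_sub (by omega)]; simp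
  have hcast2 : ((2 ^ k : ℕ) : ℝ) = 2 ^ k := by push_cast; rfl
  rw [hcast, hcast2]
  -- The numerator is at least λ' 2^k - 2, which is a relative error of 2 / (λ' 2^k). The choice of
  -- K₀ gives λ' 2^k ≥ 8 (n + 1) E.
  refine ⟨by omega, ?_, 2 / (lam' * 2 ^ k), by positivity, ?_, ?_, ?_⟩
  · rw [div_le_iff₀ h2]
    linarith
  · rw [div_le_one (by positivity)]
    linarith
  · rw [div_div, mul_div_assoc', div_le_div_iff₀ (by positivity) (by positivity)]
    nlinarith
  · rw [le_div_iff₀ h2]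
    have : (1 - 2 / (lam' * 2 ^ k)) * lam' * 2 ^ k = lam' * 2 ^ k - 2 := by field_simp
    linarith

theorem exists_isFPTAS {d : ℕ} (hd : 1 ≤ d) {lam lam' Δ' : ℝ} {Δ : ℝ≥0}
    (hΔ : (Δ : ℝ) < Δ') (hpos : 0 < lam') (hle : lam' ≤ lam) (hν' : nu lam d * Δ' < 1)
    {F : FiniteFamily} {a c : ℝ} (hdeg : ∀ G ∈ F, MaxDegreeLE G.2 (d + 1))
    (hF : ConnectiveConstantLEWith F Δ a c) : ∃ P, IsFPTAS F lam' P := by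
  have hlam := hpos.trans_le hle
  have hν := nu_pos lam d hlam hd
  have hΔ0 : 0 < Δ' := Δ.2.trans_lt hΔ
  set κ := -Real.log √(nu lam d * Δ') with hκ
  have hκ0 : 0 < κ := rate_pos hν hΔ0 hν'
  -- The doubled absolute value arises because `decay_le` is applied with the constant `|c|`.
  set C₀ := 2 * (1 + lam) * (psi lam * √((d + 1 : ℕ) * (|(|c|)| * Δ'))) with hC₀
  have hC₀0 : 0 ≤ C₀ := by
    have := psi_nonneg lam
    positivity
  obtain ⟨K₀, hK₀⟩ := pow_unbounded_of_one_lt (8 / lam') one_lt_two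
  obtain ⟨J, hJ⟩ := pow_unbounded_of_one_lt (Δ : ℝ) one_lt_two
  -- The three lower bounds on K₁ ensure the truncation accuracy, a depth of at least a log n, where
  -- the walk bound holds, and a positive depth.
  obtain ⟨K₁, hK₁⟩ := exists_nat_ge (max ((2 + 4 * C₀ * Real.exp κ) / κ) (max a 1))
  have hK₁κ : 2 + 4 * C₀ * Real.exp κ ≤ κ * K₁ := by
    have := (le_max_left _ _).trans hK₁
    rw [div_le_iff₀ hκ0] at this
    linarith
  have hK₁a : a ≤ K₁ := ((le_max_left _ _).trans (le_max_right _ _)).trans hK₁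
  have hK₁1 : 1 ≤ K₁ := by
    have : (1 : ℝ) ≤ K₁ := ((le_max_right _ _).trans (le_max_right _ _)).trans hK₁
    exact_mod_cast this
  set Λ := ⌈lam'⌉₊ with hΛ
  set L : ℕ → ℕ := fun N => N + (K₀ + Λ + 2) with hL
  set C : ℕ → ℕ := fun N =>
    1 + N + N * ((1 + (d + 1)) * (1 + ⌈|c|⌉₊ * (2 * N) ^ (J * K₁))) with hC
  obtain ⟨K, hK⟩ := PolyBdd.mainCost K₀ K₁ (L := L) (C := C) (PolyBdd.id.add (.const _))
    (((PolyBdd.const 1).add .id).add (PolyBdd.id.mul ((PolyBdd.const _).mul ((PolyBdd.const 1).add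
      ((PolyBdd.const _).mul (((PolyBdd.const 2).mul .id).pow _))))))
  -- The cost is at most K N^K, where N = n + ⌈1/ε⌉ ≤ 2 (n + 1/ε); the 2^K goes into the constant.
  refine ⟨prog K₀ K₁, K * 2 ^ K + K, fun O hO G hG ε hε0 hε1 => ?_⟩
  set n := G.1 with hn
  set E := ⌈1 / ε⌉₊ with hE
  have hE1 : 1 ≤ E := Nat.one_le_ceil_iff.2 (by positivity)
  set N := n + E with hNdef
  have hN1 : 1 ≤ N := by omega
  set k := N + K₀ with hk
  set dep := K₁ * (1 + Nat.log 2 N) with hdep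
  have hdep1 : 1 ≤ dep := Nat.mul_pos hK₁1 (by omega)
  have hNnpos : (1 : ℝ) ≤ N := by exact_mod_cast hN1
  have hdepa : a * Real.log n ≤ dep := by
    have h1 : Real.log n ≤ Real.log N := by
      rcases Nat.eq_zero_or_pos n with h0 | h0
      · rw [h0]
        simpa using Real.log_nonneg hNnpos
      · exact Real.log_le_log (by exact_mod_cast h0) (by exact_mod_cast (by omega))
    have h2 : 0 ≤ Real.log n := Real.log_natCast_nonneg n
    have h3 := log_le_one_add_log hN1
    calc a * Real.log n ≤ K₁ * Real.log n := mul_le_mul_of_nonneg_right hK₁a h2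
      _ ≤ K₁ * (1 + Nat.log 2 N : ℕ) := by gcongr; exact h1.trans h3
      _ = dep := by rw [hdep]; push_cast; ring
  have hsaw : ∀ v, ∑ i ∈ Finset.Icc 1 dep, sawCount G.2 v i ≤
      ⌈|c|⌉₊ * (2 * N) ^ (J * K₁) := sum_sawCount_le hF hG hJ.le hN1 hdepa
  have hdegree : ∀ v, (adjList G.2 v).length ≤ d + 1 := by
    intro v
    rw [← List.toFinset_card_of_nodup (nodup_adjList G.2 v)]
    convert card_toFinset_le (mem_adjList G.2) (hdeg G hG) v
  have hcalls : calls (ratioCalls (adjList G.2) dep) [] (List.finRange n).reverse ≤ C N := by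
    refine (calls_le_of_sawCount_le (mem_adjList G.2) hdegree dep _ hsaw).trans ?_
    rw [List.length_reverse, List.length_finRange, Fintype.card_fin]
    have : n ≤ N := by omega
    simp only [hC]
    gcongr
  have hsize := size_oracle_le (hO k)
  obtain ⟨t, ht, heval⟩ := ev_main (K₀ := K₀) (K₁ := K₁) (O := O) G.2 (E := E) (L := L N)
    (C := C N) (by
      change (O k).size + 1 ≤ N + (K₀ + Λ + 2)
      omega) (by simp only [hL]; omega) hcalls
  obtain ⟨hln, hact, δ, hδ0, hδ1, hδ, hact'⟩ := oracle_bounds hpos hK₀.le hE1 (hO k)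
  have hεE : 1 / (E : ℝ) ≤ ε := by
    rw [div_le_iff₀ (by exact_mod_cast hE1)]
    have := Nat.le_ceil (1 / ε)
    rw [div_le_iff₀ hε0] at this
    linarith
  have herr : ∀ A v, |ratio G.2 (((O k - 1 : ℕ) : ℝ) / (2 ^ k : ℕ)) A v -
      treeRatio (adjList G.2) (((O k - 1 : ℕ) : ℝ) / (2 ^ k : ℕ)) dep A v| ≤
      1 / (4 * (N : ℝ) ^ 2) := by
    intro A v
    obtain ⟨m, hm⟩ : ∃ m, m + 1 = dep := ⟨dep - 1, by omega⟩
    have h1 := abs_ratio_sub_treeRatio_le (mem_adjList G.2) hd (hdeg G hG)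
      (div_pos (by exact_mod_cast hln) (by positivity)) (hact.trans hle) m A v
    rw [← hm]
    refine h1.trans ((?_ : _ ≤ C₀ * Real.exp (-(κ * m))).trans
      (truncation_error_le hN1 hK₁κ hC₀0 (hm.trans hdep)))
    have h2 : (sawCount G.2 v (m + 1) : ℝ) ≤ |c| * Δ' ^ (m + 1) := by
      have h3 : sawCount G.2 v (m + 1) ≤ ∑ i ∈ Finset.Icc 1 dep, sawCount G.2 v i :=
        Finset.single_le_sum (f := fun i => sawCount G.2 v i) (fun _ _ => Nat.zero_le _)
          (Finset.mem_Icc.2 ⟨by omega, by omega⟩)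
      calc (sawCount G.2 v (m + 1) : ℝ)
          ≤ ((∑ i ∈ Finset.Icc 1 dep, sawCount G.2 v i : ℕ) : ℝ) := by exact_mod_cast h3
        _ ≤ c * (Δ : ℝ) ^ dep := hF G hG v dep hdepa
        _ ≤ |c| * Δ' ^ (m + 1) := by
          rw [hm]
          apply mul_le_mul (le_abs_self c) _ (by positivity) (abs_nonneg c)
          exact pow_le_pow_left₀ Δ.2 hΔ.le _
    calc _ ≤ 2 * (1 + lam) * (psi lam * (√((d + 1 : ℕ) * (|(|c|)| * Δ')) *
          Real.exp (-(κ * m)))) := by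
          have := psi_nonneg lam
          have := decay_le (d := d) hν hΔ0 h2
          gcongr
      _ = C₀ * Real.exp (-(κ * m)) := by rw [hC₀]; ring
  have hN2 : (1 : ℝ) / (4 * (N : ℝ) ^ 2) ≤ 1 := by
    rw [div_le_one (by positivity)]
    nlinarith
  -- One factor N pays for the n factors of the product, the other one, being at least E, for the
  -- accuracy ε.
  have hnη : n * (1 / (4 * (N : ℝ) ^ 2)) ≤ ε / 4 := by
    have h1 : (n : ℝ) ≤ N := by exact_mod_cast (by omega)
    have h2 : (E : ℝ) ≤ N := by exact_mod_cast (by omega)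
    have hE0 : (0 : ℝ) < E := by exact_mod_cast hE1
    calc (n : ℝ) * (1 / (4 * (N : ℝ) ^ 2)) ≤ N * (1 / (4 * (N : ℝ) ^ 2)) := by gcongr
      _ = 1 / (N : ℝ) / 4 := by field_simp
      _ ≤ 1 / (E : ℝ) / 4 := by gcongr
      _ ≤ ε / 4 := by gcongr
  obtain ⟨hz, hz1, hz2⟩ := approx_partitionFunction (G := G.2) hln (by positivity) hact hact' hδ0 hδ1
    (by positivity) hN2 hε0.le hε1 (by linarith) hnη herr
  refine ⟨_, _, t, heval, ?_, hz, hz1, hz2⟩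
  have hb : (1 : ℝ) ≤ n + 1 / ε := by
    have : 1 ≤ 1 / ε := by rw [le_div_iff₀ hε0]; linarith
    have : (0 : ℝ) ≤ n := Nat.cast_nonneg n
    linarith
  have hNb : (N : ℝ) ≤ 2 * (n + 1 / ε) := by
    have h1 := Nat.ceil_lt_add_one (show 0 ≤ 1 / ε by positivity)
    have h2 : 1 ≤ 1 / ε := by rw [le_div_iff₀ hε0]; linarith
    have h3 : (0 : ℝ) ≤ n := Nat.cast_nonneg n
    have h4 : (N : ℝ) = n + E := by rw [hNdef]; push_cast; rfl
    rw [h4]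
    linarith
  have ht' : (t : ℝ) ≤ K * (N : ℝ) ^ K := by exact_mod_cast ht.trans (hK N hN1)
  calc (t : ℝ) ≤ K * (N : ℝ) ^ K := ht'
    _ ≤ K * (2 * (n + 1 / ε)) ^ K := by gcongr
    _ = (K * 2 ^ K) * (n + 1 / ε) ^ K := by rw [mul_pow]; ring
    _ ≤ (K * 2 ^ K + K) * (n + 1 / ε) ^ (K * 2 ^ K + K) := by
      apply mul_le_mul _ _ (by positivity) (by positivity)
      · linarith [(Nat.cast_nonneg K : (0 : ℝ) ≤ K)]
      · exact pow_le_pow_right₀ hb (by omega)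
    _ = _ := by push_cast; rfl

end Scheme

end

end HardCore

theorem theorem3 (d : ℕ) (hd : 1 ≤ d) (lam : ℝ) (Δ : NNReal)
    (hν : HardCore.nu lam d * (Δ : ℝ) < 1) (lam' : ℝ) (hpos : 0 < lam') (hle : lam' ≤ lam) :
    (∃ κ : ℝ, 0 < κ ∧
      (∀ (V : Type*) [Infinite V] (G : SimpleGraph V), HardCore.MaxDegreeLE G (d + 1) →
        HardCore.connectiveConstant G ≤ (Δ : ENNReal) → HardCore.InfiniteSSM G lam' κ) ∧
      (∀ (F : HardCore.FiniteFamily) (a c : ℝ), (∀ G ∈ F, HardCore.MaxDegreeLE G.2 (d + 1)) →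
        HardCore.ConnectiveConstantLEWith F Δ a c → HardCore.FiniteSSM F lam' κ a)) ∧
    (∀ (F : HardCore.FiniteFamily), (∀ G ∈ F, HardCore.MaxDegreeLE G.2 (d + 1)) →
      (∃ a c : ℝ, HardCore.ConnectiveConstantLEWith F Δ a c) →
        ∃ P : HardCore.Program, HardCore.IsFPTAS F lam' P) := by
  have hlam := hpos.trans_le hle
  -- Δ' depends only on d, λ and Δ, so one rate κ serves all graphs and families.
  obtain ⟨Δ', hΔ, hν'⟩ := HardCore.nu_mul_lt_one hlam hd Δ.2 hν
  refine ⟨⟨_, HardCore.rate_pos (HardCore.nu_pos lam d hlam hd) (Δ.2.trans_lt hΔ) hν', ?_, ?_⟩, ?_⟩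
  · intro V _ G hdeg hG
    exact HardCore.infiniteSSM_of_nu_mul_lt_one hd hΔ hpos hle hν' hdeg hG
  · intro F a c hdeg hF
    exact HardCore.finiteSSM_of_nu_mul_lt_one hd hΔ hpos hle hν' hdeg hF
  · rintro F hdeg ⟨a, c, hF⟩
    exact HardCore.exists_isFPTAS hd hΔ hpos hle hν' hdeg hF
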